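/- Let $N\ge 1$. A lower triangular matrix $H=[h_{k,j}]\in\mathbb R^{(N-1)\times(N-1)}$ defines, for an operator $T$ on a real Hilbert space $\mathcal X$, the algorithm $y_{k+1}=y_k-\sum_{j=0}^{k}h_{k+1,j+1}(y_j-Ty_j)$, $k=0,\dots,N-2$. Let $\mathcal H_\star(N-1)$ be the set of all such $H$ for which $\|y_{N-1}-Ty_{N-1}\|^2\le 4\|y_0-y_\star\|^2/N^2$ holds for every real Hilbert space $\mathcal X$, every nonexpansive $T:\mathcal X\to\mathcal X$, every fixed point $y_\star$ of $T$ and every $y_0\in\mathcal X$. Put $$Q(m,j;H)=\sum_{j=j(1)\le i(1)<j(2)\le i(2)<\dots<j(m)\le i(m)\le N-1}\ \prod_{r=1}^m h_{i(r),j(r)},$$ and define the H-certificates $$\lambda^\star_{N,j}(H)=N\sum_{m=1}^{N-1}(-1)^{m-1}Q(m,j;H)\quad(1\le j\le N-1),$$ $$\lambda^\star_{k,j}(H)=N\sum_{\ell=1}^{N-1}\sum_{m=1}^{N-1}(-1)^{\ell+m-1}\binom{\ell+m}{m}Q(\ell,j;H)\,Q(m,k;H)\quad(1\le j<k\le N-1).$$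 A \emph{vertex} (vertex algorithm) of $\mathcal H_\star(N-1)$ is an element of $\mathcal H_\star(N-1)$ for which the number of vanishing H-certificates is maximal among all elements of $\mathcal H_\star(N-1)$. The \emph{diagram} $\mathcal G(H)$ is the graph on $\{1,\dots,N\}$ in which $j<k$ are joined if and only if $\lambda^\star_{k,j}(H)\ne0$. An \emph{arc diagram} on $N$ nodes is a graph on $\{1,\dots,N\}$ in which every $j<N$ is joined to exactly one larger node $k(j)$. It is \emph{non-crossing} if there are no $j_1<j_2$ with $j_1<j_2<k(j_1)<k(j_2)$. The \emph{gluing} of diagrams $\mathcal G_1,\mathcal G_2$ on $N'$ and $N-N'$ nodes ($1\le N'\le N-1$) is the diagram on $N$ nodes obtained by placing $\mathcal G_2$, relabeled to $N'+1,\dots,N$, to the right of $\mathcal G_1$ and adding the arc joining $N'$ and $N$. A diagram is \emph{basic} if it is a single node or a gluing of two smaller basic diagrams. The \emph{gluing} of $H_1\in\mathbb R^{(N'-1)\times(N'-1)}$ and $H_2\in\mathbb R^{(N-N'-1)\times(N-N'-1)}$ is the lower triangular $H\in\mathbb R^{(N-1)\times(N-1)}$ with diagonal blocks $H_1$ (indices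 $1,\dots,N'-1$) and $H_2$ (indices $N'+1,\dots,N-1$), with $h_{k,j}=0$ for $j<N'<k$, with $h_{N',j}=-\frac{N-N'}{N}\sum_{k=j}^{N'-1}(H_1)_{k,j}$ for $j<N'$, with $h_{N',N'}=\frac{N'(N-N')}{N}$, and with the rest of column $N'$ determined by $Q(k,N';H)=\frac{N'(N-N'+1)}{N(k+1)}\binom{N-N'-1}{k-1}$ for $k=1,\dots,N-N'$. An H-matrix is \emph{basic} if it is the $0\times0$ matrix or a gluing of two smaller basic H-matrices. Finally, the H-dual of $H$ is its anti-diagonal transpose $H^{\mathsf A}$, with entries $(H^{\mathsf A})_{k,j}=h_{N-j,N-k}$. Let $C_{N-1}=\frac1N\binom{2N-2}{N-1}$ be the Catalan number. Then: 1. A graph on $\{1,\dots,N\}$ is a basic diagram if and only if it is a non-crossing arc diagram, and the number of these is $C_{N-1}$. 2. A matrix $H\in\mathbb R^{(N-1)\times(N-1)}$ is basic if and only if it is a vertex of $\mathcal H_\star(N-1)$ and $\mathcal G(H)$ is a non-crossing arc diagram, and the number of these $H$ is $C_{N-1}$. 3. The number of vertices $H$ of $\mathcal H_\star(N-1)$ that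 remain optimal under H-dual, i.e. with $H^{\mathsf A}\in\mathcal H_\star(N-1)$, is $C_{N-1}$. -/

import Mathlib

open scoped Classical in
/-- The Q-function `Q(m, j; H)` of an `n × n` matrix `H` (used for `m ≥ 1`): the sum over all index
chains `j = J 0 ≤ I 0 < J 1 ≤ I 1 < ⋯ < J (m-1) ≤ I (m-1)` of the products of the entries
`H (I r) (J r)`. Indices start from `0`. -/
noncomputable def qFun {n : ℕ} (H : Matrix (Fin n) (Fin n) ℝ) (m : ℕ) (j : Fin n) : ℝ :=
  ∑ p ∈ (Finset.univ : Finset ((Fin m → Fin n) × (Fin m → Fin n))).filter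
      (fun p => (∀ r : Fin m, (r : ℕ) = 0 → p.2 r = j) ∧ (∀ r, p.2 r ≤ p.1 r) ∧
        (∀ r s : Fin m, r < s → p.1 r < p.2 s)),
    ∏ r : Fin m, H (p.1 r) (p.2 r)

/-- The H-certificate `λ⋆_{k,j}(H)`, where `N = n + 1`. The nodes `1, …, N` are represented by
`Fin (n + 1)`, and the columns `1, …, N - 1` by `Fin n`; the certificate is used for `j < k`. -/
noncomputable def hCert {n : ℕ} (H : Matrix (Fin n) (Fin n) ℝ) (k : Fin (n + 1)) (j : Fin n) : ℝ :=
  if hk : k = Fin.last n then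
    ((n : ℝ) + 1) * ∑ m ∈ Finset.Icc 1 n, (-1 : ℝ) ^ (m - 1) * qFun H m j
  else
    ((n : ℝ) + 1) * ∑ l ∈ Finset.Icc 1 n, ∑ m ∈ Finset.Icc 1 n,
      (-1 : ℝ) ^ (l + m - 1) * ((l + m).choose m : ℝ) * qFun H l j * qFun H m (k.castPred hk)

/-- `y 0, …, y n` are the iterates of the fixed-step algorithm with step sizes `H` applied to `T`:
`y_{k+1} = y_k - ∑_{j ≤ k} h_{k+1,j+1} (y_j - T y_j)`. -/
def IsTrajectory {n : ℕ} (H : Matrix (Fin n) (Fin n) ℝ) {X : Type} [NormedAddCommGroup X]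
    [InnerProductSpace ℝ X] (T : X → X) (y : Fin (n + 1) → X) : Prop :=
  ∀ k : Fin n, y k.succ =
    y k.castSucc - ∑ j ∈ Finset.Iic k, H k j • (y j.castSucc - T (y j.castSucc))

/-- The set `ℋ⋆(n)` of exact minimax optimal H-matrices, `n = N - 1`: the lower triangular matrices
whose algorithm satisfies `‖y_{N-1} - T y_{N-1}‖² ≤ 4 ‖y_0 - y⋆‖² / N²` for every nonexpansive
operator `T` on a real Hilbert space, every fixed point `y⋆` of `T` and every starting point. -/
def optimalH (n : ℕ) : Set (Matrix (Fin n) (Fin n) ℝ) :=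
  {H | (∀ i j, i < j → H i j = 0) ∧
    ∀ (X : Type) [NormedAddCommGroup X] [InnerProductSpace ℝ X] [CompleteSpace X]
      (T : X → X), (∀ x x' : X, ‖T x - T x'‖ ≤ ‖x - x'‖) →
      ∀ yStar : X, T yStar = yStar →
      ∀ y : Fin (n + 1) → X, IsTrajectory H T y →
        ‖y (Fin.last n) - T (y (Fin.last n))‖ ^ 2 ≤ 4 * ‖y 0 - yStar‖ ^ 2 / ((n : ℝ) + 1) ^ 2}

open scoped Classical in
/-- The set of index pairs `(k, j)`, `j < k`, whose H-certificate vanishes. -/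
noncomputable def zeroCerts {n : ℕ} (H : Matrix (Fin n) (Fin n) ℝ) : Finset (Fin (n + 1) × Fin n) :=
  Finset.univ.filter (fun p => p.2.castSucc < p.1 ∧ hCert H p.1 p.2 = 0)

/-- A vertex of `ℋ⋆(n)`: an element lying in a maximal number of zero sets of H-certificates. -/
def IsVertexAlg {n : ℕ} (H : Matrix (Fin n) (Fin n) ℝ) : Prop :=
  H ∈ optimalH n ∧ ∀ H' ∈ optimalH n, (zeroCerts H').card ≤ (zeroCerts H).card

/-- The diagram of `H`, identified with its support graph: the nodes `j < k` are joined
when `λ⋆_{k,j}(H) ≠ 0`. -/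
def algDiagram {n : ℕ} (H : Matrix (Fin n) (Fin n) ℝ) : SimpleGraph (Fin (n + 1)) :=
  SimpleGraph.fromRel (fun a b => ∃ j : Fin n, a = j.castSucc ∧ a < b ∧ hCert H b j ≠ 0)

/-- An arc diagram on `n + 1` nodes: every node except the last is joined to exactly one larger
node. -/
def IsArcDiagram {n : ℕ} (G : SimpleGraph (Fin (n + 1))) : Prop :=
  ∀ j : Fin n, ∃! k : Fin (n + 1), j.castSucc < k ∧ G.Adj j.castSucc k

/-- No two arcs `(j₁, k₁)`, `(j₂, k₂)` satisfy `j₁ < j₂ < k₁ < k₂`. -/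
def NonCrossing {n : ℕ} (G : SimpleGraph (Fin (n + 1))) : Prop :=
  ¬ ∃ j₁ j₂ k₁ k₂ : Fin (n + 1), G.Adj j₁ k₁ ∧ G.Adj j₂ k₂ ∧ j₁ < j₂ ∧ j₂ < k₁ ∧ k₁ < k₂

/-- Gluing of diagrams: `G₂` is placed to the right of `G₁`, and the two rightmost nodes are
joined. -/
def glueDiagram {a b : ℕ} (G₁ : SimpleGraph (Fin (a + 1))) (G₂ : SimpleGraph (Fin (b + 1))) :
    SimpleGraph (Fin (a + 1 + b + 1)) :=
  G₁.map (Fin.castAddEmb (b + 1)) ⊔ G₂.map (Fin.natAddEmb (a + 1)) ⊔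
    SimpleGraph.edge (Fin.castAdd (b + 1) (Fin.last a)) (Fin.last (a + 1 + b))

/-- Basic diagrams: those built from single-node diagrams by gluing. -/
inductive IsBasicDiagram : ∀ {n : ℕ}, SimpleGraph (Fin (n + 1)) → Prop
  | single (G : SimpleGraph (Fin (0 + 1))) : IsBasicDiagram G
  | glue {a b : ℕ} (G₁ : SimpleGraph (Fin (a + 1))) (G₂ : SimpleGraph (Fin (b + 1))) :
      IsBasicDiagram G₁ → IsBasicDiagram G₂ → IsBasicDiagram (glueDiagram G₁ G₂)

/-- `H` is the gluing of the `a × a` matrix `H₁` and the `b × b` matrix `H₂`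
(`N' = a + 1`, `N - N' = b + 1`, `N = a + b + 2`). The block structure has one extra row and column,
of index `N'`, between the blocks; the entries of that column below the diagonal are
determined by the prescribed values of its Q-functions. -/
structure IsGluing {a b : ℕ} (H₁ : Matrix (Fin a) (Fin a) ℝ) (H₂ : Matrix (Fin b) (Fin b) ℝ)
    (H : Matrix (Fin (a + 1 + b)) (Fin (a + 1 + b)) ℝ) : Prop where
  lower : ∀ i j, i < j → H i j = 0
  left : ∀ i j : Fin a, H (Fin.castAdd b i.castSucc) (Fin.castAdd b j.castSucc) = H₁ i j
  right : ∀ i j : Fin b, H (Fin.natAdd (a + 1) i) (Fin.natAdd (a + 1) j) = H₂ i j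
  corner : ∀ (i : Fin b) (j : Fin a), H (Fin.natAdd (a + 1) i) (Fin.castAdd b j.castSucc) = 0
  row : ∀ j : Fin a, H (Fin.castAdd b (Fin.last a)) (Fin.castAdd b j.castSucc) =
    -(((b : ℝ) + 1) / ((a : ℝ) + b + 2)) * ∑ k ∈ Finset.Ici j, H₁ k j
  diag : H (Fin.castAdd b (Fin.last a)) (Fin.castAdd b (Fin.last a)) =
    ((a : ℝ) + 1) * ((b : ℝ) + 1) / ((a : ℝ) + b + 2)
  column : ∀ k ∈ Finset.Icc 1 (b + 1), qFun H k (Fin.castAdd b (Fin.last a)) =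
    ((a : ℝ) + 1) * ((b : ℝ) + 2) / (((a : ℝ) + b + 2) * ((k : ℝ) + 1)) * (b.choose (k - 1) : ℝ)

/-- Basic H-matrices: those built from the empty matrix by gluing. -/
inductive IsBasicMatrix : ∀ {n : ℕ}, Matrix (Fin n) (Fin n) ℝ → Prop
  | empty (H : Matrix (Fin 0) (Fin 0) ℝ) : IsBasicMatrix H
  | glue {a b : ℕ} (H₁ : Matrix (Fin a) (Fin a) ℝ) (H₂ : Matrix (Fin b) (Fin b) ℝ)
      (H : Matrix (Fin (a + 1 + b)) (Fin (a + 1 + b)) ℝ) :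
      IsBasicMatrix H₁ → IsBasicMatrix H₂ → IsGluing H₁ H₂ H → IsBasicMatrix H

/-- The H-dual (anti-diagonal transpose): its `(k, j)` entry is `h_{N-j,N-k}`. -/
def hDual {n : ℕ} (H : Matrix (Fin n) (Fin n) ℝ) : Matrix (Fin n) (Fin n) ℝ :=
  Matrix.of fun k j => H j.rev k.rev

/-!
# Vertices of the set of optimal H-matrices, non-crossing arc diagrams and H-duality

Write `N = n + 1`. To a lower triangular matrix `H` belong the *residual polynomials*
`q_j = ∑ m ≥ 1, Q(m, j; H) (X - 1) ^ m` of the nodes `j < N`, and `q_N = 1` (`resPoly`). With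
respect to the coefficientwise inner product of polynomials, the powers of `X - 1` have the inner
products `± (l + m).choose m`, so the H-certificates are the off-diagonal entries of the Gram matrix
`G` of the `q_j`, times `-N` (`hCert_eq`). The recursion of the `Q`-functions says that
`q_b = [b = N] + (X - 1) ∑ a, B_{a b} q_a`, where `B` holds the partial column sums of `H` and is
strictly lower triangular. As multiplication by `X` is an isometry with image orthogonal to the
constants, this is the Lyapunov equation `G + G B + Bᵀ G = e eᵀ`, `e` being the last coordinate
vector (`resGram_lyapunov`). Together with the positivity and the row sums of `G`, collected in
`IsLyapunovPair`, this equation carries most of the argument.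

**Optimality.** `H` is optimal if and only if the `q_j` add up to `(1 + X + ⋯ + X ^ n) / N` and all
off-diagonal entries of `G` are nonpositive. For sufficiency, the nonexpansiveness inequalities
between the iterates are added up with the certificates as weights (`mem_optimalH_of_resGram`). The
condition on the sum is necessary because the negacyclic shift of `ℝ ^ N` is a nonexpansive operator
(`isInvariantH_of_mem_optimalH`). For the necessity of the signs, the scaled inverse of `G` is the
Gram matrix of the residuals in a worst-case run for which all these inequalities are tight; if some
entry of `G` were positive, a small perturbation that makes only the corresponding inequality slack
would enlarge the last residual, and by Kirszbraun's extension theorem the perturbed data come from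
a nonexpansive operator (`resGram_nonpos_of_mem_optimalH`).

**Vertices.** Multiplying the Lyapunov equation of a trailing principal block by the inverse of the
block and taking traces shows that the size of the block can be read off from the block of `G`
alone. Hence each node but the last has a larger neighbour in the diagram: otherwise two consecutive
trailing blocks would have the same size (`IsLyapunovPair.exists_gt_ne_zero`). So the vertices are
the optimal matrices whose diagram is an arc diagram (`isVertexAlg_iff`).

**Basic matrices.** A gluing of matrices glues the Gram matrices (`resGram_glueMatrix`), so it
preserves optimality and glues the diagrams. Conversely, an optimal matrix with a basic diagram is
determined by the diagram: the trace identity fixes the weight of the arc added by the last gluing,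
and `G` follows by induction (`IsBasicDiagram.gram_unique`); then `G` determines `B`, because the
difference of two solutions is both nilpotent and skew-adjoint (`IsLyapunovPair.left_unique`). Basic
diagrams are the non-crossing arc diagrams (`isBasicDiagram_iff`), and they correspond to binary
trees, which are counted by the Catalan numbers.

**H-duality.** The H-dual of a gluing is a gluing of the H-duals, so duals of basic matrices are
optimal (`IsBasicMatrix.hDual`). Conversely, the Gram matrix of the H-dual consists of the second
differences of the scaled inverse of `G`, so optimality of the H-dual makes the rows of the inverse
decrease to the right of the diagonal (`forwardGram_antitone`). When the diagram is a tree, a row of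
the inverse is the potential of a unit flow from a node to the root, which violates this
monotonicity as soon as two arcs cross (`nonCrossing_of_hDual_mem`).
-/

/-! ### Chain sums and residual polynomials -/

theorem sum_fun_fin_succ {α M : Type*} [Fintype α] [AddCommMonoid M] {m : ℕ}
    (f : (Fin (m + 1) → α) → M) : ∑ g, f g = ∑ x, ∑ g', f (Fin.cons x g') := by
  rw [← (Fin.consEquiv (fun _ => α)).sum_comp, Fintype.sum_prod_type]
  rfl

/-- The pairs `(J r, I r)`, `r < m`, form an index chain `t ≤ J 0 ≤ I 0 < J 1 ≤ I 1 < ⋯`. In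
contrast to the chains of `qFun`, the first index is only bounded from below, which makes the
recursion on the length of the chain possible. -/
def IsIndexChain {n : ℕ} (m t : ℕ) (I J : Fin m → Fin n) : Prop :=
  (∀ r, t ≤ (J r : ℕ)) ∧ (∀ r, J r ≤ I r) ∧ ∀ r s, r < s → I r < J s

open scoped Classical in
/-- The sum of the products of entries of `H` over all index chains of length `m` whose indices are
at least `t`. -/
noncomputable def chainSum {n : ℕ} (H : Matrix (Fin n) (Fin n) ℝ) (m t : ℕ) : ℝ :=
  ∑ I : Fin m → Fin n, ∑ J : Fin m → Fin n,
    if IsIndexChain m t I J then ∏ r, H (I r) (J r) else 0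

theorem chainSum_zero {n : ℕ} (H : Matrix (Fin n) (Fin n) ℝ) (t : ℕ) : chainSum H 0 t = 1 := by
  simp [chainSum, IsIndexChain]

/-- Removal of the first pair of a chain. -/
theorem qFun_succ {n : ℕ} (H : Matrix (Fin n) (Fin n) ℝ) (m : ℕ) (j : Fin n) :
    qFun H (m + 1) j = ∑ i, if j ≤ i then H i j * chainSum H m (i + 1) else 0 := by
  classical
  rw [qFun, Finset.sum_filter, Fintype.sum_prod_type, sum_fun_fin_succ]
  refine Finset.sum_congr rfl fun i _ => ?_
  have key : ∀ (I' : Fin m → Fin n) (j' : Fin n) (J' : Fin m → Fin n),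
      ((∀ r : Fin (m + 1), (r : ℕ) = 0 → (Fin.cons j' J' : Fin (m + 1) → Fin n) r = j) ∧
        (∀ r, (Fin.cons j' J' : Fin (m + 1) → Fin n) r ≤ (Fin.cons i I' : Fin (m + 1) → Fin n) r) ∧
        (∀ r s : Fin (m + 1), r < s → (Fin.cons i I' : Fin (m + 1) → Fin n) r <
          (Fin.cons j' J' : Fin (m + 1) → Fin n) s)) ↔
      j' = j ∧ (j ≤ i ∧ IsIndexChain m (i + 1) I' J') := by
    intro I' j' J'
    simp only [Fin.forall_fin_succ, IsIndexChain, Fin.cons_zero, Fin.cons_succ, Fin.val_zero,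
      Fin.val_succ, Fin.lt_def, Fin.le_def]
    constructor
    · rintro ⟨⟨h1, -⟩, ⟨h2, h3⟩, h4, h5⟩
      have h1 := h1 trivial
      subst h1
      refine ⟨rfl, h2, fun r => ?_, h3, fun r s hrs => ?_⟩
      · exact h4.2 r (by simp)
      · exact (h5 r).2 s (by simpa using hrs)
    · rintro ⟨rfl, h2, h3, h4, h5⟩
      refine ⟨⟨fun _ => rfl, fun r h => by simp at h⟩, ⟨h2, h4⟩, ⟨by simp, fun r _ => h3 r⟩,
        fun r => ⟨by simp, fun s hrs => h5 r s (by simpa using hrs)⟩⟩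
  by_cases hji : j ≤ i
  · rw [if_pos hji, chainSum, Finset.mul_sum]
    refine Finset.sum_congr rfl fun I' _ => ?_
    rw [sum_fun_fin_succ, Finset.mul_sum]
    simp only [key, Fin.prod_univ_succ, Fin.cons_zero, Fin.cons_succ]
    rw [Finset.sum_eq_single j]
    · simp [hji]
    · intro j' _ hj'
      simp [hj']
    · simp
  · rw [if_neg hji]
    refine Finset.sum_eq_zero fun I' _ => ?_
    rw [sum_fun_fin_succ]
    simp only [key, hji, false_and, and_false, if_false, Finset.sum_const_zero]

/-- Chains of positive length, sorted by their first index. -/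
theorem chainSum_succ {n : ℕ} (H : Matrix (Fin n) (Fin n) ℝ) (m t : ℕ) :
    chainSum H (m + 1) t = ∑ j : Fin n, if t ≤ (j : ℕ) then qFun H (m + 1) j else 0 := by
  classical
  simp only [qFun, Finset.sum_filter, Fintype.sum_prod_type]
  rw [chainSum]
  have : ∀ j : Fin n, (if t ≤ (j : ℕ) then ∑ I : Fin (m + 1) → Fin n, ∑ J : Fin (m + 1) → Fin n,
      (if (∀ r : Fin (m + 1), (r : ℕ) = 0 → J r = j) ∧ (∀ r, J r ≤ I r) ∧
        (∀ r s, r < s → I r < J s) then ∏ r, H (I r) (J r) else 0) else 0) =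
      ∑ I : Fin (m + 1) → Fin n, ∑ J : Fin (m + 1) → Fin n,
      (if j = J 0 then (if t ≤ (j : ℕ) ∧ (∀ r, J r ≤ I r) ∧
        (∀ r s, r < s → I r < J s) then ∏ r, H (I r) (J r) else 0) else 0) := by
    intro j
    have h0 : ∀ J : Fin (m + 1) → Fin n, (∀ r : Fin (m + 1), (r : ℕ) = 0 → J r = j) ↔ j = J 0 := by
      intro J
      constructor
      · intro h
        exact (h 0 rfl).symm
      · rintro rfl r hr
        have : r = 0 := Fin.ext hr
        rw [this]
    split_ifs with h
    · refine Finset.sum_congr rfl fun I _ => Finset.sum_congr rfl fun J _ => ?_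
      simp only [h0, h, true_and, ite_and]
    · simp [h]
  rw [Fintype.sum_congr _ _ this]
  symm
  rw [Finset.sum_comm]
  refine Finset.sum_congr rfl fun I _ => ?_
  rw [Finset.sum_comm]
  refine Finset.sum_congr rfl fun J _ => ?_
  rw [Finset.sum_eq_single (J 0) (fun j _ hj => if_neg hj) (by simp), if_pos rfl]
  refine if_congr ?_ rfl rfl
  constructor
  · rintro ⟨h1, h2, h3⟩
    refine ⟨fun r => ?_, h2, h3⟩
    rcases Fin.eq_zero_or_eq_succ r with rfl | ⟨s, rfl⟩
    · exact h1
    · have h4 := h3 0 s.succ (Fin.succ_pos s)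
      have h5 := h2 0
      rw [Fin.lt_def] at h4
      rw [Fin.le_def] at h5
      omega
  · rintro ⟨h1, h2, h3⟩
    exact ⟨h1 0, h2, h3⟩

/-- A chain of length `m` whose indices lie in `[t, n)` has `m ≤ n - t`. -/
theorem chainSum_eq_zero {n : ℕ} (H : Matrix (Fin n) (Fin n) ℝ) :
    ∀ (m t : ℕ), n < m + t → t ≤ n → chainSum H m t = 0 := by
  intro m
  induction m with
  | zero => intro t h1 h2; omega
  | succ m ih =>
    intro t h1 h2
    rw [chainSum_succ]
    refine Finset.sum_eq_zero fun j _ => ?_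
    split_ifs with h
    · rw [qFun_succ]
      refine Finset.sum_eq_zero fun i _ => ?_
      split_ifs with h3
      · rw [ih, mul_zero]
        · rw [Fin.le_def] at h3; omega
        · omega
      · rfl
    · rfl

theorem qFun_eq_zero {n : ℕ} (H : Matrix (Fin n) (Fin n) ℝ) (m : ℕ) (j : Fin n)
    (h : n < m + j) : qFun H m j = 0 := by
  cases m with
  | zero => omega
  | succ m =>
    rw [qFun_succ]
    refine Finset.sum_eq_zero fun i _ => ?_
    split_ifs with h3
    · rw [chainSum_eq_zero, mul_zero]
      · rw [Fin.le_def] at h3; omega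
      · omega
    · rfl

theorem sum_Icc_one {M : Type*} [AddCommMonoid M] (f : ℕ → M) (n : ℕ) :
    ∑ m ∈ Finset.Icc 1 n, f m = ∑ m ∈ Finset.range n, f (m + 1) := by
  induction n with
  | zero => simp
  | succ n ih => rw [Finset.sum_Icc_succ_top (by omega), ih, Finset.sum_range_succ]

open Polynomial in
/-- The residual polynomials of `H`, one for each node: the polynomial of a node `j` other than the
last is `∑ m ≥ 1, Q(m, j; H) (X - 1) ^ m`, and the polynomial of the last node is `1`. -/
noncomputable def resPoly {n : ℕ} (H : Matrix (Fin n) (Fin n) ℝ) : Fin (n + 1) → ℝ[X] :=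
  Fin.snoc (α := fun _ => ℝ[X]) (fun j => ∑ m ∈ Finset.Icc 1 n, qFun H m j • (X - 1) ^ m) 1

/-- The partial sums of the columns of `H`: the entry `(a, b)` is `∑ i < a, h_{i, b}`, with a zero
column appended. The iterates of the algorithm are
`y_a = y_0 - ∑ b, (cumMat H a b) • (y_b - T y_b)`. -/
noncomputable def cumMat {n : ℕ} (H : Matrix (Fin n) (Fin n) ℝ) :
    Matrix (Fin (n + 1)) (Fin (n + 1)) ℝ :=
  fun a b => ∑ i : Fin n, if i.castSucc < a then Fin.snoc (α := fun _ => ℝ) (H i) 0 b else 0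

open Polynomial in
/-- The bilinear form `∑ i ≤ n, p_i q_i` on polynomials, where `p_i`, `q_i` are the coefficients. -/
noncomputable def coeffForm (n : ℕ) : LinearMap.BilinForm ℝ ℝ[X] :=
  ∑ i ∈ Finset.range (n + 1), LinearMap.BilinForm.linMulLin (lcoeff ℝ i) (lcoeff ℝ i)

/-- The Gram matrix of the residual polynomials. -/
noncomputable def resGram {n : ℕ} (H : Matrix (Fin n) (Fin n) ℝ) :
    Matrix (Fin (n + 1)) (Fin (n + 1)) ℝ :=
  fun a b => coeffForm n (resPoly H a) (resPoly H b)

open Polynomial in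
theorem coeffForm_apply (n : ℕ) (p q : ℝ[X]) :
    coeffForm n p q = ∑ i ∈ Finset.range (n + 1), p.coeff i * q.coeff i := by
  simp [coeffForm, LinearMap.sum_apply]

theorem coeffForm_comm (n : ℕ) (p q : Polynomial ℝ) : coeffForm n p q = coeffForm n q p := by
  simp only [coeffForm_apply, mul_comm]

@[simp] theorem resPoly_last {n : ℕ} (H : Matrix (Fin n) (Fin n) ℝ) :
    resPoly H (Fin.last n) = 1 := by
  simp [resPoly]

open Polynomial in
theorem resPoly_castSucc {n : ℕ} (H : Matrix (Fin n) (Fin n) ℝ) (j : Fin n) :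
    resPoly H j.castSucc = ∑ m ∈ Finset.Icc 1 n, qFun H m j • (X - 1) ^ m := by
  simp [resPoly]

theorem cumMat_strictLower {n : ℕ} {H : Matrix (Fin n) (Fin n) ℝ}
    (hH : ∀ i j, i < j → H i j = 0) (a b : Fin (n + 1)) (hab : a ≤ b) : cumMat H a b = 0 := by
  refine Finset.sum_eq_zero fun i _ => ?_
  split_ifs with h
  · cases b using Fin.lastCases with
    | last => simp
    | cast b =>
      simp only [Fin.snoc_castSucc]
      exact hH _ _ (by simpa using lt_of_lt_of_le h hab)
  · rfl

theorem cumMat_last {n : ℕ} (H : Matrix (Fin n) (Fin n) ℝ) (a : Fin (n + 1)) :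
    cumMat H a (Fin.last n) = 0 := by
  simp [cumMat]

theorem cumMat_castSucc {n : ℕ} (H : Matrix (Fin n) (Fin n) ℝ) (a : Fin (n + 1)) (b : Fin n) :
    cumMat H a b.castSucc = ∑ i : Fin n, if i.castSucc < a then H i b else 0 := by
  simp [cumMat]

theorem cumMat_zero {n : ℕ} (H : Matrix (Fin n) (Fin n) ℝ) (b : Fin (n + 1)) :
    cumMat H 0 b = 0 := by
  simp [cumMat]

theorem cumMat_succ_sub {n : ℕ} (H : Matrix (Fin n) (Fin n) ℝ) (i : Fin n) (b : Fin (n + 1)) :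
    cumMat H i.succ b = cumMat H i.castSucc b + Fin.snoc (α := fun _ => ℝ) (H i) 0 b := by
  have : ∀ k : Fin n, (if k.castSucc < i.succ then Fin.snoc (α := fun _ => ℝ) (H k) 0 b else 0) =
      (if k.castSucc < i.castSucc then Fin.snoc (α := fun _ => ℝ) (H k) 0 b else 0) +
      (if k = i then Fin.snoc (α := fun _ => ℝ) (H k) 0 b else 0) := by
    intro k
    rcases lt_trichotomy k i with h | h | h
    · simp [h, h.le, h.ne, Fin.castSucc_lt_succ_iff]
    · simp [h]
    · simp [h.not_ge, h.not_gt, h.ne', Fin.castSucc_lt_succ_iff]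
  rw [cumMat, Finset.sum_congr rfl fun k _ => this k, Finset.sum_add_distrib]
  simp [cumMat]

open Polynomial in
theorem sum_resPoly_ge {n : ℕ} (H : Matrix (Fin n) (Fin n) ℝ) (t : ℕ) (ht : t ≤ n) :
    ∑ a : Fin (n + 1), (if t ≤ (a : ℕ) then resPoly H a else 0) =
      ∑ m ∈ Finset.range (n + 1), chainSum H m t • (X - 1 : ℝ[X]) ^ m := by
  rw [Fin.sum_univ_castSucc]
  simp only [Fin.val_last, ht, if_true, resPoly_last, Fin.val_castSucc, resPoly_castSucc]
  rw [Finset.sum_range_succ', chainSum_zero]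
  simp only [pow_zero, one_smul, add_left_inj, chainSum_succ, Finset.sum_smul]
  rw [Finset.sum_comm]
  refine Finset.sum_congr rfl fun j _ => ?_
  split_ifs with h
  · rw [sum_Icc_one]
  · simp

open Polynomial in
/-- The recursion of the residual polynomials. As `cumMat H` is strictly lower triangular, it
expresses the polynomial of a node by those of the larger nodes. -/
theorem resPoly_rec {n : ℕ} {H : Matrix (Fin n) (Fin n) ℝ} (hH : ∀ i j, i < j → H i j = 0)
    (b : Fin (n + 1)) : resPoly H b = (if b = Fin.last n then 1 else 0) +
      (X - 1) * ∑ a, cumMat H a b • resPoly H a := by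
  cases b using Fin.lastCases with
  | last => simp [cumMat_last]
  | cast j =>
    have h1 : ∑ a, cumMat H a j.castSucc • resPoly H a = ∑ i : Fin n, H i j •
        ∑ m ∈ Finset.range (n + 1), chainSum H m (i + 1) • (X - 1 : ℝ[X]) ^ m := by
      simp only [← sum_resPoly_ge H _ (Nat.succ_le_of_lt (Fin.is_lt _)), cumMat_castSucc,
        Finset.sum_smul, Finset.smul_sum]
      rw [Finset.sum_comm]
      refine Finset.sum_congr rfl fun i _ => Finset.sum_congr rfl fun a _ => ?_
      simp only [Fin.lt_def, Fin.val_castSucc, Nat.succ_le_iff, ite_smul, zero_smul, smul_ite,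
        smul_zero]
    rw [h1, resPoly_castSucc, if_neg (Fin.castSucc_lt_last j).ne, zero_add]
    have h2 : ∀ m ∈ Finset.range n, qFun H (m + 1) j • (X - 1 : ℝ[X]) ^ (m + 1) =
        (X - 1) * ∑ i : Fin n, H i j • chainSum H m (i + 1) • (X - 1 : ℝ[X]) ^ m := by
      intro m _
      rw [qFun_succ, Finset.sum_smul, Finset.mul_sum]
      refine Finset.sum_congr rfl fun i _ => ?_
      split_ifs with h
      · rw [mul_smul, pow_succ']
        simp only [mul_smul_comm]
      · rw [hH i j (not_le.mp h)]
        simp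
    rw [sum_Icc_one, Finset.sum_congr rfl h2, ← Finset.mul_sum, Finset.sum_comm]
    congr 1
    refine Finset.sum_congr rfl fun i _ => ?_
    rw [Finset.sum_range_succ, chainSum_eq_zero H n (i + 1) (by omega) (by omega), zero_smul,
      add_zero, Finset.smul_sum]

open Polynomial in
/-- The binomial coefficients of the H-certificates are inner products of powers of `X - 1`, by
Vandermonde's identity. -/
theorem coeffForm_X_sub_one_pow (n l m : ℕ) (hl : l ≤ n) :
    coeffForm n ((X - 1) ^ l) ((X - 1) ^ m) = (-1) ^ (l + m) * ((l + m).choose m : ℝ) := by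
  have hc : ∀ k i : ℕ, ((X - 1 : ℝ[X]) ^ k).coeff i = (-1) ^ (k - i) * (k.choose i : ℝ) := by
    intro k i
    have := coeff_X_add_C_pow (-1 : ℝ) k i
    rwa [C_neg, C_1, ← sub_eq_add_neg] at this
  rw [coeffForm_apply]
  have h1 : ∑ i ∈ Finset.range (n + 1), ((X - 1 : ℝ[X]) ^ l).coeff i *
        ((X - 1 : ℝ[X]) ^ m).coeff i =
      ∑ i ∈ Finset.range (l + 1), ((X - 1 : ℝ[X]) ^ l).coeff i * ((X - 1 : ℝ[X]) ^ m).coeff i := by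
    refine (Finset.sum_subset (by simpa using hl) fun i _ hi => ?_).symm
    rw [hc l i, Nat.choose_eq_zero_of_lt (by simpa using hi)]
    simp
  have h2 : ((l + m).choose m : ℝ) = ∑ i ∈ Finset.range (l + 1), (l.choose i : ℝ) * m.choose i := by
    rw [← Nat.choose_symm_add, Nat.add_choose_eq, Finset.Nat.sum_antidiagonal_eq_sum_range_succ_mk,
      ← Finset.sum_range_reflect]
    push_cast
    refine Finset.sum_congr rfl fun i hi => ?_
    have hi' : i ≤ l := by simpa [Nat.lt_succ_iff] using hi
    rw [Nat.choose_symm hi', show l - (l - i) = i by omega]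
  rw [h1, h2, Finset.mul_sum]
  refine Finset.sum_congr rfl fun i hi => ?_
  have hi' : i ≤ l := by simpa [Nat.lt_succ_iff] using hi
  rw [hc, hc]
  by_cases him : i ≤ m
  · have : ((-1 : ℝ)) ^ (l - i) * (-1) ^ (m - i) = (-1) ^ (l + m) := by
      rw [← pow_add, show l + m = (l - i + (m - i)) + 2 * i by omega, pow_add _ _ (2 * i), pow_mul]
      simp
    rw [← this]
    ring
  · rw [Nat.choose_eq_zero_of_lt (not_le.mp him)]
    simp

/-- The H-certificates are, up to the factor `-N`, the off-diagonal entries of the Gram matrix. -/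
theorem hCert_eq {n : ℕ} (H : Matrix (Fin n) (Fin n) ℝ) (k : Fin (n + 1)) (j : Fin n) :
    hCert H k j = -((n : ℝ) + 1) * resGram H k j.castSucc := by
  have hsign : ∀ m : ℕ, 1 ≤ m → (-1 : ℝ) ^ (m - 1) = -(-1) ^ m := by
    intro m hm
    obtain ⟨m, rfl⟩ := Nat.exists_eq_add_of_le' hm
    simp [pow_succ]
  cases k using Fin.lastCases with
  | last =>
    rw [hCert, dif_pos rfl, resGram, resPoly_last, resPoly_castSucc, neg_mul, ← mul_neg, map_sum]
    congr 1
    rw [← Finset.sum_neg_distrib]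
    refine Finset.sum_congr rfl fun m hm => ?_
    have := coeffForm_X_sub_one_pow n 0 m (Nat.zero_le n)
    rw [pow_zero] at this
    rw [map_smul, this, hsign m (Finset.mem_Icc.mp hm).1]
    simp
    ring
  | cast k =>
    rw [hCert, dif_neg (Fin.castSucc_lt_last k).ne, resGram, coeffForm_comm, resPoly_castSucc,
      resPoly_castSucc, neg_mul, ← mul_neg, map_sum (coeffForm n), LinearMap.sum_apply]
    congr 1
    rw [← Finset.sum_neg_distrib]
    refine Finset.sum_congr rfl fun l hl => ?_
    rw [map_sum, ← Finset.sum_neg_distrib]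
    refine Finset.sum_congr rfl fun m hm => ?_
    rw [map_smul, map_smul, LinearMap.smul_apply,
      coeffForm_X_sub_one_pow n l m (Finset.mem_Icc.mp hl).2,
      hsign (l + m) (by have := (Finset.mem_Icc.mp hl).1; omega)]
    simp
    ring

/-! ### The Lyapunov equation of the Gram matrix -/

/-- The matrix is strictly lower triangular. -/
def StrictLower {m : ℕ} (B : Matrix (Fin m) (Fin m) ℝ) : Prop := ∀ a b, a ≤ b → B a b = 0

/-- The homogeneous Lyapunov equation with a strictly lower triangular matrix has only the trivial
solution: every entry is a combination of entries with a larger index sum. -/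
theorem StrictLower.eq_zero_of_lyapunov {m : ℕ} {B M : Matrix (Fin m) (Fin m) ℝ}
    (hB : StrictLower B) (h : M + M * B + B.transpose * M = 0) : M = 0 := by
  have key : ∀ s : ℕ, ∀ a b : Fin m, 2 * m ≤ a + b + s → M a b = 0 := by
    intro s
    induction s with
    | zero => intro a b hab; omega
    | succ s ih =>
      intro a b hab
      have h1 := congrFun (congrFun h a) b
      simp only [Matrix.add_apply, Matrix.mul_apply, Matrix.transpose_apply,
        Matrix.zero_apply] at h1
      rw [Finset.sum_eq_zero, Finset.sum_eq_zero] at h1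
      · simpa using h1
      · intro c _
        by_cases hc : c ≤ a
        · rw [hB c a hc, zero_mul]
        · rw [ih c b, mul_zero]
          rw [not_le, Fin.lt_def] at hc
          omega
      · intro c _
        by_cases hc : c ≤ b
        · rw [hB c b hc, mul_zero]
        · rw [ih a c, zero_mul]
          rw [not_le, Fin.lt_def] at hc
          omega
  ext a b
  exact key (2 * m) a b (by omega)

theorem StrictLower.lyapunov_unique {m : ℕ} {B M M' R : Matrix (Fin m) (Fin m) ℝ}
    (hB : StrictLower B) (h : M + M * B + B.transpose * M = R)
    (h' : M' + M' * B + B.transpose * M' = R) : M = M' := by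
  rw [← sub_eq_zero]
  apply hB.eq_zero_of_lyapunov
  rw [Matrix.sub_mul, Matrix.mul_sub]
  calc _ = (M + M * B + B.transpose * M) - (M' + M' * B + B.transpose * M') := by abel
    _ = 0 := by rw [h, h', sub_self]

/-- The dual Lyapunov equation is the Lyapunov equation of the anti-diagonal transpose. -/
theorem StrictLower.eq_zero_of_dual_lyapunov {m : ℕ} {B M : Matrix (Fin m) (Fin m) ℝ}
    (hB : StrictLower B) (h : M + B * M + M * B.transpose = 0) : M = 0 := by
  have hB' : StrictLower ((B.submatrix Fin.rev Fin.rev).transpose) := by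
    intro a b hab
    exact hB _ _ (Fin.rev_le_rev.mpr hab)
  have h' : M.submatrix Fin.rev Fin.rev = 0 := by
    apply hB'.eq_zero_of_lyapunov
    have e : ∀ P Q : Matrix (Fin m) (Fin m) ℝ, P.submatrix Fin.rev Fin.rev *
        Q.submatrix Fin.rev Fin.rev = (P * Q).submatrix Fin.rev Fin.rev := fun P Q =>
      Matrix.submatrix_mul_equiv P Q _ Fin.revPerm _
    rw [Matrix.transpose_transpose, Matrix.transpose_submatrix, e, e]
    ext a b
    have := congrFun (congrFun h a.rev) b.rev
    simp only [Matrix.add_apply, Matrix.zero_apply, Matrix.submatrix_apply] at this ⊢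
    linarith
  ext a b
  have := congrFun (congrFun h' a.rev) b.rev
  simpa using this

/-- Injectivity of the dual Lyapunov operator gives surjectivity, by finite dimension. -/
theorem StrictLower.exists_dual_lyapunov {m : ℕ} {B : Matrix (Fin m) (Fin m) ℝ}
    (hB : StrictLower B) (R : Matrix (Fin m) (Fin m) ℝ) :
    ∃ M, M + B * M + M * B.transpose = R := by
  let f : Matrix (Fin m) (Fin m) ℝ →ₗ[ℝ] Matrix (Fin m) (Fin m) ℝ :=
    { toFun := fun M => M + B * M + M * B.transpose
      map_add' := fun M M' => by rw [Matrix.mul_add, Matrix.add_mul]; abel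
      map_smul' := fun r M => by simp }
  have hinj : Function.Injective f := by
    rw [← LinearMap.ker_eq_bot, LinearMap.ker_eq_bot']
    exact fun M hM => hB.eq_zero_of_dual_lyapunov hM
  exact LinearMap.injective_iff_surjective.mp hinj R

/-- The matrix with a single `1`, in the bottom right corner. -/
noncomputable abbrev cornerMat (n : ℕ) : Matrix (Fin (n + 1)) (Fin (n + 1)) ℝ :=
  Matrix.single (Fin.last n) (Fin.last n) 1

theorem resGram_comm {n : ℕ} (H : Matrix (Fin n) (Fin n) ℝ) (a b : Fin (n + 1)) :
    resGram H a b = resGram H b a := coeffForm_comm _ _ _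

theorem resGram_transpose {n : ℕ} (H : Matrix (Fin n) (Fin n) ℝ) :
    (resGram H).transpose = resGram H := by
  ext a b
  exact resGram_comm H b a

theorem strictLower_cumMat {n : ℕ} {H : Matrix (Fin n) (Fin n) ℝ}
    (hH : ∀ i j, i < j → H i j = 0) : StrictLower (cumMat H) :=
  fun a b hab => cumMat_strictLower hH a b hab

open Polynomial in
theorem coeff_X_sub_one_mul_succ (p : ℝ[X]) (i : ℕ) :
    ((X - 1) * p).coeff (i + 1) = p.coeff i - p.coeff (i + 1) := by
  rw [sub_mul, coeff_sub, coeff_X_mul, one_mul]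

theorem coeff_resPoly_castSucc_succ {n : ℕ} {H : Matrix (Fin n) (Fin n) ℝ}
    (hH : ∀ i j, i < j → H i j = 0) (j : Fin n) (i : ℕ) :
    (resPoly H j.castSucc).coeff (i + 1) =
      ∑ a, cumMat H a j.castSucc * ((resPoly H a).coeff i - (resPoly H a).coeff (i + 1)) := by
  rw [resPoly_rec hH, if_neg (Fin.castSucc_lt_last j).ne, zero_add, coeff_X_sub_one_mul_succ]
  simp only [Polynomial.finsetSum_coeff, Polynomial.coeff_smul, smul_eq_mul,
    ← Finset.sum_sub_distrib, mul_sub]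

/-- The residual polynomial of the node `a` has degree at most `n - a`. -/
theorem resPoly_coeff_eq_zero {n : ℕ} {H : Matrix (Fin n) (Fin n) ℝ}
    (hH : ∀ i j, i < j → H i j = 0) : ∀ (a : Fin (n + 1)) (i : ℕ), n < a + i →
    (resPoly H a).coeff i = 0 := by
  have key : ∀ (s : ℕ) (a : Fin (n + 1)), n ≤ a + s → ∀ i : ℕ, n < a + i →
      (resPoly H a).coeff i = 0 := by
    intro s
    induction s with
    | zero =>
      intro a ha i hi
      have : a = Fin.last n := Fin.ext (by simp; omega)
      subst this
      rw [resPoly_last, Polynomial.coeff_one, if_neg]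
      simp at hi
      omega
    | succ s ih =>
      intro a ha i hi
      cases a using Fin.lastCases with
      | last => exact ih _ (by simp) i hi
      | cast j =>
        simp only [Fin.val_castSucc] at ha hi
        obtain ⟨i, rfl⟩ : ∃ k, i = k + 1 := ⟨i - 1, by omega⟩
        rw [coeff_resPoly_castSucc_succ hH]
        refine Finset.sum_eq_zero fun a _ => ?_
        by_cases hja : a ≤ j.castSucc
        · rw [cumMat_strictLower hH a _ hja, zero_mul]
        · rw [not_le, Fin.lt_def, Fin.val_castSucc] at hja
          rw [ih a (by omega) i (by omega), ih a (by omega) (i + 1) (by omega), sub_zero, mul_zero]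
  exact fun a i hi => key n a (by omega) i hi

theorem coeff_resPoly_top {n : ℕ} {H : Matrix (Fin n) (Fin n) ℝ}
    (hH : ∀ i j, i < j → H i j = 0) (j : Fin n) :
    (resPoly H j.castSucc).coeff (n - j) = H j j * (resPoly H j.succ).coeff (n - (j + 1)) := by
  have hj := j.is_lt
  rw [show n - (j : ℕ) = (n - (j + 1)) + 1 by omega, coeff_resPoly_castSucc_succ hH,
    Finset.sum_eq_single j.succ]
  · rw [resPoly_coeff_eq_zero hH j.succ (n - (j + 1) + 1) (by simp; omega), sub_zero,
      cumMat_succ_sub, cumMat_strictLower hH _ _ le_rfl, zero_add, Fin.snoc_castSucc]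
  · intro a _ ha
    by_cases hja : a ≤ j.castSucc
    · rw [cumMat_strictLower hH a _ hja, zero_mul]
    · rw [not_le, Fin.lt_def, Fin.val_castSucc] at hja
      have : (a : ℕ) ≠ j + 1 := fun h => ha (Fin.ext (by simpa using h))
      rw [resPoly_coeff_eq_zero hH a _ (by omega), resPoly_coeff_eq_zero hH a _ (by omega),
        sub_zero, mul_zero]
  · simp

/-- The polynomial H-invariance condition: the residual polynomials add up to
`(1 + X + ⋯ + X ^ n) / (n + 1)`. -/
def IsInvariantH {n : ℕ} (H : Matrix (Fin n) (Fin n) ℝ) : Prop :=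
  (∀ i j, i < j → H i j = 0) ∧ ∀ i ≤ n, (∑ a, resPoly H a).coeff i = 1 / ((n : ℝ) + 1)

theorem IsInvariantH.coeff_top_ne_zero {n : ℕ} {H : Matrix (Fin n) (Fin n) ℝ}
    (hH : IsInvariantH H) (a : Fin (n + 1)) : (resPoly H a).coeff (n - a) ≠ 0 := by
  induction a using Fin.induction with
  | zero =>
    have h := hH.2 n le_rfl
    rw [Polynomial.finsetSum_coeff, Finset.sum_eq_single 0] at h
    · simp only [Fin.val_zero, Nat.sub_zero]
      rw [h]
      positivity
    · intro b _ hb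
      apply resPoly_coeff_eq_zero hH.1
      have := Fin.pos_iff_ne_zero.mpr hb
      rw [Fin.lt_def] at this
      simp at this
      omega
    · simp
  | succ j ih =>
    intro h
    rw [Fin.val_castSucc, coeff_resPoly_top hH.1] at ih
    exact ih (by rw [Fin.val_succ] at h; rw [h, mul_zero])

/-- The residual polynomials have distinct degrees. -/
theorem IsInvariantH.linearIndependent {n : ℕ} {H : Matrix (Fin n) (Fin n) ℝ}
    (hH : IsInvariantH H) {x : Fin (n + 1) → ℝ} (hx : ∑ a, x a • resPoly H a = 0) : x = 0 := by
  by_contra hne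
  have hex : ∃ a, x a ≠ 0 := by
    by_contra! hall
    exact hne (funext hall)
  obtain ⟨a, ha, hmin⟩ := WellFounded.has_min (wellFounded_lt (α := Fin (n + 1))) {a | x a ≠ 0} hex
  have h := congrArg (fun p => p.coeff (n - a)) hx
  simp only [Polynomial.finsetSum_coeff, Polynomial.coeff_smul, smul_eq_mul,
    Polynomial.coeff_zero] at h
  rw [Finset.sum_eq_single a] at h
  · rcases mul_eq_zero.mp h with h | h
    · exact ha h
    · exact hH.coeff_top_ne_zero a h
  · intro b _ hb
    rcases lt_or_gt_of_ne hb with hlt | hgt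
    · have : x b = 0 := by
        by_contra hb'
        exact hmin b hb' hlt
      rw [this, zero_mul]
    · rw [resPoly_coeff_eq_zero hH.1 b, mul_zero]
      rw [Fin.lt_def] at hgt
      omega
  · simp

theorem IsInvariantH.posDef {n : ℕ} {H : Matrix (Fin n) (Fin n) ℝ}
    (hH : IsInvariantH H) : (resGram H).PosDef := by
  refine Matrix.PosDef.of_dotProduct_mulVec_pos (by
    rw [Matrix.IsHermitian, Matrix.conjTranspose_eq_transpose_of_trivial, resGram_transpose])
    fun x hx => ?_
  have h1 : star x ⬝ᵥ (resGram H).mulVec x =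
      coeffForm n (∑ a, x a • resPoly H a) (∑ a, x a • resPoly H a) := by
    simp only [map_sum, map_smul, LinearMap.sum_apply, LinearMap.smul_apply, dotProduct,
      Matrix.mulVec, resGram, star_trivial, smul_eq_mul, Finset.mul_sum]
    rw [Finset.sum_comm]
    refine Finset.sum_congr rfl fun a _ => Finset.sum_congr rfl fun b _ => ?_
    ring
  rw [h1, coeffForm_apply]
  by_contra hle
  apply hx
  apply hH.linearIndependent
  have h2 : ∀ i ∈ Finset.range (n + 1), (∑ a, x a • resPoly H a).coeff i *
      (∑ a, x a • resPoly H a).coeff i = 0 := by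
    rw [← Finset.sum_eq_zero_iff_of_nonneg fun i _ => mul_self_nonneg _]
    exact le_antisymm (not_lt.mp hle) (Finset.sum_nonneg fun i _ => mul_self_nonneg _)
  ext i
  rw [Polynomial.coeff_zero]
  by_cases hi : i ≤ n
  · exact mul_self_eq_zero.mp (h2 i (by simpa [Nat.lt_succ_iff] using hi))
  · rw [Polynomial.finsetSum_coeff]
    refine Finset.sum_eq_zero fun a _ => ?_
    rw [Polynomial.coeff_smul, resPoly_coeff_eq_zero hH.1 a i (by omega), smul_zero]

theorem eval_one_resPoly {n : ℕ} {H : Matrix (Fin n) (Fin n) ℝ}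
    (hH : ∀ i j, i < j → H i j = 0) (a : Fin (n + 1)) :
    (resPoly H a).eval 1 = if a = Fin.last n then 1 else 0 := by
  rw [resPoly_rec hH a]
  split_ifs <;> simp

/-- Every row sum of the Gram matrix is the value of a residual polynomial at `1`, because the sum
of the residual polynomials reproduces evaluation at `1`. -/
theorem IsInvariantH.sum_resGram {n : ℕ} {H : Matrix (Fin n) (Fin n) ℝ}
    (hH : IsInvariantH H) (a : Fin (n + 1)) :
    ∑ b, resGram H a b = if a = Fin.last n then 1 / ((n : ℝ) + 1) else 0 := by
  have h1 : ∑ b, resGram H a b = coeffForm n (resPoly H a) (∑ b, resPoly H b) := by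
    simp [resGram, map_sum]
  have h2 : (resPoly H a).eval 1 = ∑ i ∈ Finset.range (n + 1), (resPoly H a).coeff i * 1 ^ i := by
    refine Polynomial.eval_eq_sum_range' (Nat.lt_succ_iff.mpr ?_) 1
    rw [Polynomial.natDegree_le_iff_coeff_eq_zero]
    exact fun i hi => resPoly_coeff_eq_zero hH.1 a i (by omega)
  rw [h1, coeffForm_apply, Finset.sum_congr rfl (g := fun i =>
    (resPoly H a).coeff i * 1 ^ i * (1 / ((n : ℝ) + 1))), ← Finset.sum_mul, ← h2,
    eval_one_resPoly hH.1]
  · split_ifs <;> simp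
  · intro i hi
    rw [hH.2 i (by simpa [Nat.lt_succ_iff] using hi), one_pow, mul_one]

open Polynomial in
/-- Multiplication by `X` preserves the form `coeffForm` and maps to the orthogonal complement of
the constants; taking Gram matrices in `resPoly_rec` gives a Lyapunov equation. -/
theorem resGram_lyapunov {n : ℕ} {H : Matrix (Fin n) (Fin n) ℝ}
    (hH : ∀ i j, i < j → H i j = 0) :
    resGram H + resGram H * cumMat H + (cumMat H).transpose * resGram H = cornerMat n := by
  set R : Fin (n + 1) → ℝ[X] := fun b => ∑ a, cumMat H a b • resPoly H a with hR
  have hRdeg : ∀ b, (R b).coeff n = 0 := by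
    intro b
    simp only [hR, finsetSum_coeff, coeff_smul, smul_eq_mul]
    refine Finset.sum_eq_zero fun a _ => ?_
    by_cases ha : a ≤ b
    · rw [cumMat_strictLower hH a b ha, zero_mul]
    · rw [resPoly_coeff_eq_zero hH a n, mul_zero]
      rw [not_le, Fin.lt_def] at ha
      omega
  have hrec : ∀ b, resPoly H b + R b = C (if b = Fin.last n then 1 else 0) + X * R b := by
    intro b
    rw [resPoly_rec hH b]
    simp only [hR]
    split_ifs <;> simp <;> ring
  -- the bilinear form is invariant under multiplication by `X` as long as no coefficient is cut off
  have hshift : ∀ (r s : ℝ) (p q : ℝ[X]), p.coeff n = 0 →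
      coeffForm n (C r + X * p) (C s + X * q) = r * s + coeffForm n p q := by
    intro r s p q hp
    rw [coeffForm_apply, coeffForm_apply, Finset.sum_range_succ', Finset.sum_range_succ, hp]
    simp [coeff_C, add_comm]
  ext a b
  have h1 := hshift (if a = Fin.last n then 1 else 0) (if b = Fin.last n then 1 else 0) (R a) (R b)
    (hRdeg a)
  rw [← hrec, ← hrec] at h1
  have h2 : (resGram H * cumMat H) a b = coeffForm n (resPoly H a) (R b) := by
    simp [Matrix.mul_apply, hR, resGram, mul_comm]
  have h3 : ((cumMat H).transpose * resGram H) a b = coeffForm n (R a) (resPoly H b) := by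
    simp [Matrix.mul_apply, hR, resGram, LinearMap.sum_apply]
  have h4 : cornerMat n a b =
      (if a = Fin.last n then 1 else 0) * (if b = Fin.last n then 1 else 0) := by
    simp only [cornerMat, Matrix.single_apply, eq_comm (a := Fin.last n), mul_ite, mul_one,
      mul_zero]
    split_ifs <;> simp_all
  rw [Matrix.add_apply, Matrix.add_apply, h2, h3, h4]
  simp only [map_add, LinearMap.add_apply] at h1
  simp only [resGram]
  linarith

/-- A Gram matrix `G` with its strictly lower triangular matrix `B`, abstracting the pair
`resGram H`, `cumMat H` of an H-matrix satisfying the invariance condition. As `G` is symmetric, the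
last condition says that `(n + 1) G` is the sum of `cornerMat n` and a weighted graph Laplacian; the
weights may have any sign. -/
structure IsLyapunovPair {n : ℕ} (B G : Matrix (Fin (n + 1)) (Fin (n + 1)) ℝ) : Prop where
  lower : StrictLower B
  lyapunov : G + G * B + B.transpose * G = cornerMat n
  posDef : G.PosDef
  sum_row : ∀ a, ∑ b, G a b = if a = Fin.last n then 1 / ((n : ℝ) + 1) else 0

theorem IsInvariantH.isLyapunovPair {n : ℕ} {H : Matrix (Fin n) (Fin n) ℝ}
    (hH : IsInvariantH H) : IsLyapunovPair (cumMat H) (resGram H) :=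
  ⟨strictLower_cumMat hH.1, resGram_lyapunov hH.1, hH.posDef, hH.sum_resGram⟩

theorem IsLyapunovPair.symm {n : ℕ} {B G : Matrix (Fin (n + 1)) (Fin (n + 1)) ℝ}
    (h : IsLyapunovPair B G) (a b : Fin (n + 1)) : G a b = G b a := by
  have := congrFun (congrFun h.posDef.isHermitian b) a
  simpa using this

/-! ### Trajectories, and the invariance condition from a negacyclic shift -/

theorem sum_Iic_eq_sum_snoc {n : ℕ} {H : Matrix (Fin n) (Fin n) ℝ}
    (hH : ∀ i j, i < j → H i j = 0) {X : Type*} [AddCommGroup X] [Module ℝ X]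
    (g : Fin (n + 1) → X) (k : Fin n) :
    ∑ j ∈ Finset.Iic k, H k j • g j.castSucc =
      ∑ b, Fin.snoc (α := fun _ => ℝ) (H k) 0 b • g b := by
  rw [Fin.sum_univ_castSucc]
  simp only [Fin.snoc_castSucc, Fin.snoc_last, zero_smul, add_zero]
  refine Finset.sum_subset (Finset.subset_univ _) fun j _ hj => ?_
  rw [hH k j (by simpa using hj), zero_smul]

/-- The iterates in terms of the partial column sums of `H`. -/
theorem isTrajectory_iff {n : ℕ} {H : Matrix (Fin n) (Fin n) ℝ}
    (hH : ∀ i j, i < j → H i j = 0) {X : Type} [NormedAddCommGroup X] [InnerProductSpace ℝ X]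
    (T : X → X) (y : Fin (n + 1) → X) :
    IsTrajectory H T y ↔ ∀ a, y a = y 0 - ∑ b, cumMat H a b • (y b - T (y b)) := by
  simp only [IsTrajectory, sum_Iic_eq_sum_snoc hH (fun b => y b - T (y b))]
  have hstep : ∀ k : Fin n, ∑ b, cumMat H k.succ b • (y b - T (y b)) =
      ∑ b, cumMat H k.castSucc b • (y b - T (y b)) +
        ∑ b, Fin.snoc (α := fun _ => ℝ) (H k) 0 b • (y b - T (y b)) := by
    intro k
    simp only [cumMat_succ_sub, add_smul, Finset.sum_add_distrib]
  constructor
  · intro h a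
    induction a using Fin.induction with
    | zero => simp [cumMat_zero]
    | succ k ih => rw [h k, hstep, ← sub_sub, ← ih]
  · intro h k
    rw [h k.succ, hstep, ← sub_sub, ← h k.castSucc]

theorem exists_isTrajectory {n : ℕ} (H : Matrix (Fin n) (Fin n) ℝ) {X : Type}
    [NormedAddCommGroup X] [InnerProductSpace ℝ X] (T : X → X) (x : X) :
    ∃ y : Fin (n + 1) → X, y 0 = x ∧ IsTrajectory H T y := by
  have key : ∀ m : ℕ, ∃ y : Fin (n + 1) → X, y 0 = x ∧ ∀ k : Fin n, (k : ℕ) < m → y k.succ =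
      y k.castSucc - ∑ j ∈ Finset.Iic k, H k j • (y j.castSucc - T (y j.castSucc)) := by
    intro m
    induction m with
    | zero => exact ⟨fun _ => x, rfl, fun k hk => by omega⟩
    | succ m ih =>
      obtain ⟨y, h0, hy⟩ := ih
      by_cases hm : m < n
      · let k₀ : Fin n := ⟨m, hm⟩
        let y' := Function.update y k₀.succ (y k₀.castSucc -
          ∑ j ∈ Finset.Iic k₀, H k₀ j • (y j.castSucc - T (y j.castSucc)))
        have hne : ∀ j : Fin n, (j : ℕ) ≤ m → y' j.castSucc = y j.castSucc := by
          intro j hj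
          refine Function.update_of_ne (fun h => ?_) _ _
          have := congrArg Fin.val h
          simp [k₀] at this
          omega
        refine ⟨y', ?_, fun k hk => ?_⟩
        · rw [← h0]
          exact Function.update_of_ne (Fin.succ_ne_zero _).symm _ _
        · rw [hne k (by omega), Finset.sum_congr rfl fun j hj => by
            rw [hne j (by have := Finset.mem_Iic.mp hj; rw [Fin.le_def] at this; omega)]]
          rcases Nat.lt_succ_iff_lt_or_eq.mp hk with hk | hk
          · rw [← hy k hk]
            refine Function.update_of_ne (fun h => ?_) _ _
            have := congrArg Fin.val h
            simp [k₀] at this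
            omega
          · have : k = k₀ := Fin.ext hk
            subst this
            exact Function.update_self _ _ _
      · exact ⟨y, h0, fun k _ => hy k (by omega)⟩
  obtain ⟨y, h0, hy⟩ := key n
  exact ⟨y, h0, fun k => hy k k.is_lt⟩

open Polynomial in
/-- For a linear operator `T`, the last iterate is the sum of the residual polynomials evaluated at
`T`, applied to the starting point. -/
theorem IsTrajectory.last_eq_aeval {n : ℕ} {H : Matrix (Fin n) (Fin n) ℝ}
    (hH : ∀ i j, i < j → H i j = 0) {E : Type} [NormedAddCommGroup E] [InnerProductSpace ℝ E]
    (T : E →ₗ[ℝ] E) {y : Fin (n + 1) → E} (hy : IsTrajectory H T y) :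
    y (Fin.last n) = aeval T (∑ a, resPoly H a) (y 0) := by
  rw [isTrajectory_iff hH] at hy
  have h1 : ∀ b, aeval T (resPoly H b) (y b) = (if b = Fin.last n then y b else 0) -
      ∑ a, aeval T (resPoly H a) (cumMat H a b • (y b - T (y b))) := by
    intro b
    conv_lhs => rw [resPoly_rec hH b]
    have h2 : aeval T ((X - 1) * ∑ a, cumMat H a b • resPoly H a) (y b) =
        - ∑ a, aeval T (resPoly H a) (cumMat H a b • (y b - T (y b))) := by
      rw [mul_comm, map_mul, map_sum, Module.End.mul_apply, LinearMap.sum_apply,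
        ← Finset.sum_neg_distrib]
      refine Finset.sum_congr rfl fun a _ => ?_
      simp only [map_smul, LinearMap.smul_apply, map_sub, aeval_X, map_one, LinearMap.sub_apply,
        Module.End.one_apply]
      rw [← smul_neg, neg_sub, smul_sub]
    rw [map_add, LinearMap.add_apply, h2, ← sub_eq_add_neg]
    split_ifs
    · rw [map_one, Module.End.one_apply]
    · rw [map_zero, LinearMap.zero_apply]
  have h3 : aeval T (∑ a, resPoly H a) (y 0) = ∑ a, aeval T (resPoly H a) (y a) +
      ∑ a, ∑ b, aeval T (resPoly H a) (cumMat H a b • (y b - T (y b))) := by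
    rw [map_sum, LinearMap.sum_apply, ← Finset.sum_add_distrib]
    refine Finset.sum_congr rfl fun a _ => ?_
    rw [← map_sum, ← map_add]
    congr 1
    rw [hy a]
    abel
  rw [h3, Finset.sum_congr rfl fun b _ => h1 b, Finset.sum_sub_distrib,
    Finset.sum_comm (γ := Fin (n + 1))]
  simp

/-- The negacyclic shift `e_0 ↦ e_1 ↦ ⋯ ↦ e_n ↦ -e_0`. -/
noncomputable def negacyclicShift (n : ℕ) :
    EuclideanSpace ℝ (Fin (n + 1)) →ₗ[ℝ] EuclideanSpace ℝ (Fin (n + 1)) where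
  toFun x := WithLp.toLp 2 (Fin.cons (-x (Fin.last n)) fun i => x i.castSucc)
  map_add' x y := by
    ext i
    cases i using Fin.cases <;> simp [add_comm]
  map_smul' r x := by
    ext i
    cases i using Fin.cases <;> simp

@[simp] theorem negacyclicShift_zero {n : ℕ} (x : EuclideanSpace ℝ (Fin (n + 1))) :
    negacyclicShift n x 0 = -x (Fin.last n) := rfl

@[simp] theorem negacyclicShift_succ {n : ℕ} (x : EuclideanSpace ℝ (Fin (n + 1))) (i : Fin n) :
    negacyclicShift n x i.succ = x i.castSucc := rfl

theorem norm_negacyclicShift {n : ℕ} (x : EuclideanSpace ℝ (Fin (n + 1))) :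
    ‖negacyclicShift n x‖ = ‖x‖ := by
  rw [← sq_eq_sq₀ (norm_nonneg _) (norm_nonneg _), EuclideanSpace.real_norm_sq_eq,
    EuclideanSpace.real_norm_sq_eq, Fin.sum_univ_succ, Fin.sum_univ_castSucc]
  simp [add_comm]

theorem negacyclicShift_pow {n : ℕ} (i : ℕ) (hi : i < n + 1) :
    (negacyclicShift n ^ i) (EuclideanSpace.single 0 1) = EuclideanSpace.single ⟨i, hi⟩ 1 := by
  induction i with
  | zero => rfl
  | succ i ih =>
    rw [pow_succ', Module.End.mul_apply, ih (by omega)]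
    ext k
    cases k using Fin.cases with
    | zero =>
      rw [negacyclicShift_zero]
      simp [Fin.ext_iff]
      omega
    | succ k =>
      rw [negacyclicShift_succ]
      simp [Fin.ext_iff]

open Polynomial in
/-- Optimality on the negacyclic shift, started at `(1, …, 1)`, bounds the sum of the squared
coefficients of the last iterate's polynomial by `1 / (n + 1)`; since the coefficients add up to
`1`, they are all equal. -/
theorem isInvariantH_of_mem_optimalH {n : ℕ} {H : Matrix (Fin n) (Fin n) ℝ}
    (hopt : H ∈ optimalH n) : IsInvariantH H := by
  have hH := hopt.1
  refine ⟨hH, ?_⟩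
  set p : ℝ[X] := ∑ a, resPoly H a with hp
  set T := negacyclicShift n
  let o : EuclideanSpace ℝ (Fin (n + 1)) := WithLp.toLp 2 fun _ => 1
  obtain ⟨y, hy0, hy⟩ := exists_isTrajectory H T o
  have hb := hopt.2 _ T (fun x x' => by rw [← map_sub, norm_negacyclicShift]) 0 (map_zero T) y hy
  have hdeg : p.natDegree < n + 1 := by
    rw [Nat.lt_succ_iff, natDegree_le_iff_coeff_eq_zero]
    intro i hi
    rw [hp, finsetSum_coeff]
    exact Finset.sum_eq_zero fun a _ => resPoly_coeff_eq_zero hH a i (by omega)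
  -- the starting point has the residual `2 e_0`, which the powers of the shift turn into an
  -- orthogonal basis, so the norm of the last residual is a norm of coefficients
  have ho : o - T o = (2 : ℝ) • EuclideanSpace.single 0 1 := by
    ext k
    cases k using Fin.cases with
    | zero =>
      rw [PiLp.sub_apply, negacyclicShift_zero]
      simp [o]
      norm_num
    | succ k =>
      rw [PiLp.sub_apply, negacyclicShift_succ]
      simp [o]
  have hres : y (Fin.last n) - T (y (Fin.last n)) =
      (2 : ℝ) • WithLp.toLp 2 (fun i : Fin (n + 1) => p.coeff i) := by
    have hcomm : T (aeval T p o) = aeval T p (T o) := by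
      have : T * aeval T p = aeval T p * T := by
        have h := (Commute.all X p).map (aeval T)
        rwa [aeval_X] at h
      exact congrArg (fun f => f o) this
    rw [IsTrajectory.last_eq_aeval hH T hy, hy0, hcomm, ← map_sub, ho, map_smul,
      aeval_eq_sum_range' hdeg, LinearMap.sum_apply]
    congr 1
    rw [← Fin.sum_univ_eq_sum_range (fun i => (p.coeff i • T ^ i) (EuclideanSpace.single 0 1))]
    simp only [LinearMap.smul_apply]
    ext k
    rw [WithLp.ofLp_sum, Finset.sum_apply, Finset.sum_congr rfl fun i _ => by
      rw [negacyclicShift_pow (i : ℕ) i.is_lt]]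
    simp
  have hsq : ∑ i : Fin (n + 1), p.coeff i ^ 2 ≤ 1 / ((n : ℝ) + 1) := by
    rw [hres, hy0, sub_zero, norm_smul, mul_pow, EuclideanSpace.real_norm_sq_eq,
      EuclideanSpace.real_norm_sq_eq] at hb
    simp only [o, one_pow, Finset.sum_const, Finset.card_univ, Fintype.card_fin, nsmul_eq_mul,
      mul_one, Real.norm_ofNat, Nat.cast_add, Nat.cast_one] at hb
    have hn : (0 : ℝ) < (n : ℝ) + 1 := by positivity
    have h4 : 4 * ((n : ℝ) + 1) / ((n : ℝ) + 1) ^ 2 = 4 * (1 / ((n : ℝ) + 1)) := by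
      field_simp
    rw [h4] at hb
    linarith
  have hsum : ∑ i : Fin (n + 1), p.coeff i = 1 := by
    have h1 : p.eval 1 = 1 := by
      rw [hp, eval_finsetSum]
      simp [eval_one_resPoly hH]
    rw [eval_eq_sum_range' hdeg] at h1
    rw [Fin.sum_univ_eq_sum_range (fun i => p.coeff i)]
    simpa using h1
  have hzero : ∑ i : Fin (n + 1), (p.coeff i - 1 / ((n : ℝ) + 1)) ^ 2 ≤ 0 := by
    have hn : (0 : ℝ) < (n : ℝ) + 1 := by positivity
    have : ∑ i : Fin (n + 1), (p.coeff i - 1 / ((n : ℝ) + 1)) ^ 2 =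
        ∑ i : Fin (n + 1), p.coeff i ^ 2 -
          2 * (1 / ((n : ℝ) + 1)) * ∑ i : Fin (n + 1), p.coeff i + 1 / ((n : ℝ) + 1) := by
      simp only [sub_sq, Finset.sum_add_distrib, Finset.sum_sub_distrib, Finset.mul_sum,
        Finset.sum_const, Finset.card_univ, Fintype.card_fin, nsmul_eq_mul]
      push_cast
      have : ((n : ℝ) + 1) * (1 / ((n : ℝ) + 1)) ^ 2 = 1 / ((n : ℝ) + 1) := by field_simp
      rw [this]
      congr 2
      exact Finset.sum_congr rfl fun i _ => by ring
    rw [this, hsum]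
    linarith
  intro i hi
  have h5 := (Finset.sum_eq_zero_iff_of_nonneg (fun i _ => sq_nonneg _)).mp
    (le_antisymm hzero (Finset.sum_nonneg fun i _ => sq_nonneg _)) ⟨i, by omega⟩ (Finset.mem_univ _)
  have := pow_eq_zero_iff (two_ne_zero) |>.mp h5
  linarith

/-! ### Sufficiency of the certificates -/

theorem trace_mul_dual_lyapunov {m : ℕ} (B G Γ : Matrix (Fin m) (Fin m) ℝ) :
    (G * (Γ + B * Γ + Γ * B.transpose)).trace = ((G + G * B + B.transpose * G) * Γ).trace := by
  rw [Matrix.mul_add, Matrix.mul_add, Matrix.add_mul, Matrix.add_mul, Matrix.trace_add,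
    Matrix.trace_add, Matrix.trace_add, Matrix.trace_add, ← Matrix.mul_assoc, ← Matrix.mul_assoc,
    Matrix.trace_mul_comm (G * Γ) B.transpose, ← Matrix.mul_assoc]

/-- Duality of the two Lyapunov equations: if the Gram matrix of the residuals is `Γ`, its last
diagonal entry, the squared norm of the last residual, is a combination of the entries of `Y` with
the coefficients `G`. -/
theorem sum_mul_dual_lyapunov {n : ℕ} {B G Γ Y : Matrix (Fin (n + 1)) (Fin (n + 1)) ℝ}
    (hG : G + G * B + B.transpose * G = cornerMat n)
    (hY : Γ + B * Γ + Γ * B.transpose = Y) :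
    ∑ a, ∑ b, G a b * Y b a = Γ (Fin.last n) (Fin.last n) := by
  have h := trace_mul_dual_lyapunov B G Γ
  rw [hG, hY] at h
  have h2 : (G * Y).trace = ∑ a, ∑ b, G a b * Y b a := by
    simp [Matrix.trace, Matrix.mul_apply]
  rw [← h2, h]
  rw [Matrix.trace_mul_comm]
  simp [cornerMat, Matrix.trace_mul_single]

/-- The sum of the increments of `Y`, weighted with `G`: the Laplacian part of `G` is a sum over
pairs of nodes, and the corner entry gives the first term. -/
theorem sum_mul_increment {n : ℕ} {G Y : Matrix (Fin (n + 1)) (Fin (n + 1)) ℝ}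
    (hsymm : ∀ a b, G a b = G b a)
    (hsum : ∀ a, ∑ b, G a b = if a = Fin.last n then 1 / ((n : ℝ) + 1) else 0) :
    ∑ a, ∑ b, G a b * (Y a a + Y b b - Y a b - Y b a) =
      2 / ((n : ℝ) + 1) * Y (Fin.last n) (Fin.last n) - 2 * ∑ a, ∑ b, G a b * Y b a := by
  have h1 : ∑ a, ∑ b, G a b * Y a a = 1 / ((n : ℝ) + 1) * Y (Fin.last n) (Fin.last n) := by
    simp only [← Finset.sum_mul, hsum]
    simp
  have h2 : ∑ a, ∑ b, G a b * Y b b = 1 / ((n : ℝ) + 1) * Y (Fin.last n) (Fin.last n) := by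
    rw [Finset.sum_comm, ← h1]
    exact Finset.sum_congr rfl fun a _ => Finset.sum_congr rfl fun b _ => by rw [hsymm]
  have h3 : ∑ a, ∑ b, G a b * Y a b = ∑ a, ∑ b, G a b * Y b a := by
    rw [Finset.sum_comm]
    exact Finset.sum_congr rfl fun a _ => Finset.sum_congr rfl fun b _ => by rw [hsymm]
  simp only [mul_sub, mul_add, Finset.sum_sub_distrib, Finset.sum_add_distrib, h1, h2, h3]
  ring

open scoped InnerProductSpace in
/-- The dual Lyapunov operator, applied to a Gram matrix. -/
theorem dual_lyapunov_gram_apply {m : ℕ} {X : Type*} [NormedAddCommGroup X] [InnerProductSpace ℝ X]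
    (B : Matrix (Fin m) (Fin m) ℝ) {Γ : Matrix (Fin m) (Fin m) ℝ} {g : Fin m → X}
    (hΓ : ∀ a b, ⟪g a, g b⟫_ℝ = Γ a b) (a b : Fin m) :
    (Γ + B * Γ + Γ * B.transpose) a b =
      ⟪g a, g b⟫_ℝ + ⟪∑ c, B a c • g c, g b⟫_ℝ + ⟪g a, ∑ c, B b c • g c⟫_ℝ := by
  simp only [Matrix.add_apply, Matrix.mul_apply, Matrix.transpose_apply, sum_inner, inner_sum,
    real_inner_smul_left, real_inner_smul_right, hΓ, mul_comm]

open scoped InnerProductSpace in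
/-- If the row sums of the Gram matrix are those of a Laplacian plus a corner entry, and all its
off-diagonal entries are nonpositive, then the weighted sum of the nonexpansiveness inequalities
proves the optimal rate. -/
theorem mem_optimalH_of_resGram {n : ℕ} {H : Matrix (Fin n) (Fin n) ℝ}
    (hH : ∀ i j, i < j → H i j = 0)
    (hsum : ∀ a, ∑ b, resGram H a b = if a = Fin.last n then 1 / ((n : ℝ) + 1) else 0)
    (hneg : ∀ a b, a ≠ b → resGram H a b ≤ 0) : H ∈ optimalH n := by
  refine ⟨hH, ?_⟩
  intro X _ _ _ T hT yStar hfix y hy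
  rw [isTrajectory_iff hH] at hy
  set g : Fin (n + 1) → X := fun a => y a - T (y a) with hg
  set d : Fin (n + 1) → X := fun a => ∑ b, cumMat H a b • g b with hd
  let Γ : Matrix (Fin (n + 1)) (Fin (n + 1)) ℝ := fun a b => ⟪g a, g b⟫_ℝ
  let Y : Matrix (Fin (n + 1)) (Fin (n + 1)) ℝ := fun a b =>
    ⟪g a, g b⟫_ℝ + ⟪d a, g b⟫_ℝ + ⟪g a, d b⟫_ℝ
  have hY : Γ + cumMat H * Γ + Γ * (cumMat H).transpose = Y := by
    ext a b
    exact dual_lyapunov_gram_apply (cumMat H) (fun _ _ => rfl) a b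
  -- nonexpansiveness of `T` in terms of `1 - T`
  have hcoco : ∀ x x' : X, ‖(x - T x) - (x' - T x')‖ ^ 2 ≤
      2 * ⟪x - x', (x - T x) - (x' - T x')⟫_ℝ := by
    intro x x'
    have h1 : T x - T x' = (x - x') - ((x - T x) - (x' - T x')) := by abel
    have h2 := pow_le_pow_left₀ (norm_nonneg _) (hT x x') 2
    rw [h1, norm_sub_sq_real] at h2
    linarith
  -- the inequality between the iterates `a` and `b`
  have hpair : ∀ a b, 0 ≤ -(Y a a + Y b b - Y a b - Y b a) := by
    intro a b
    have h1 := hcoco (y a) (y b)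
    have h2 : y a - y b = d b - d a := by
      rw [hy a, hy b]
      abel
    have h3 : -(Y a a + Y b b - Y a b - Y b a) =
        2 * ⟪d b - d a, g a - g b⟫_ℝ - ‖g a - g b‖ ^ 2 := by
      simp only [Y]
      rw [← real_inner_self_eq_norm_sq]
      simp only [inner_sub_left, inner_sub_right]
      rw [real_inner_comm (d a) (g a), real_inner_comm (d b) (g b), real_inner_comm (d b) (g a),
        real_inner_comm (d a) (g b)]
      ring
    rw [h3, ← h2]
    linarith
  have htotal : ∑ a, ∑ b, resGram H a b * -(Y a a + Y b b - Y a b - Y b a) ≤ 0 := by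
    refine Finset.sum_nonpos fun a _ => Finset.sum_nonpos fun b _ => ?_
    by_cases hab : a = b
    · subst hab
      simp
    · exact mul_nonpos_of_nonpos_of_nonneg (hneg a b hab) (hpair a b)
  have hid := sum_mul_increment (Y := Y) (resGram_comm H) hsum
  rw [sum_mul_dual_lyapunov (resGram_lyapunov hH) hY] at hid
  simp only [mul_neg, Finset.sum_neg_distrib] at htotal
  rw [hid] at htotal
  set gN := g (Fin.last n) with hgN
  have hn : (0 : ℝ) < (n : ℝ) + 1 := by positivity
  have hΓ : Γ (Fin.last n) (Fin.last n) = ‖gN‖ ^ 2 := real_inner_self_eq_norm_sq _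
  have hYN : Y (Fin.last n) (Fin.last n) = ‖gN‖ ^ 2 + 2 * ⟪y 0 - y (Fin.last n), gN⟫_ℝ := by
    have : d (Fin.last n) = y 0 - y (Fin.last n) := by
      rw [hy (Fin.last n)]
      abel
    simp only [Y, this]
    rw [real_inner_self_eq_norm_sq, real_inner_comm (y 0 - y (Fin.last n))]
    ring
  -- the weighted sum of the inequalities between the iterates
  have h1 : ((n : ℝ) + 1) * ‖gN‖ ^ 2 ≤ ‖gN‖ ^ 2 + 2 * ⟪y 0 - y (Fin.last n), gN⟫_ℝ := by
    rw [← hYN, ← hΓ]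
    have : 2 / ((n : ℝ) + 1) * Y (Fin.last n) (Fin.last n) =
      2 * (Y (Fin.last n) (Fin.last n) / ((n : ℝ) + 1)) := by ring
    rw [this] at htotal
    have h3 : Γ (Fin.last n) (Fin.last n) ≤ Y (Fin.last n) (Fin.last n) / ((n : ℝ) + 1) := by
      linarith
    rw [le_div_iff₀ hn] at h3
    linarith
  -- the inequality between the last iterate and the fixed point
  have h2 : ‖gN‖ ^ 2 ≤ 2 * ⟪y (Fin.last n) - yStar, gN⟫_ℝ := by
    have := hcoco (y (Fin.last n)) yStar
    rwa [hfix, sub_self, sub_zero] at this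
  have h3 : ((n : ℝ) + 1) * ‖gN‖ ^ 2 ≤ 2 * ⟪y 0 - yStar, gN⟫_ℝ := by
    have : y 0 - yStar = (y 0 - y (Fin.last n)) + (y (Fin.last n) - yStar) := by abel
    rw [this, inner_add_left]
    linarith
  have h4 : ((n : ℝ) + 1) * ‖gN‖ ≤ 2 * ‖y 0 - yStar‖ := by
    rcases (norm_nonneg gN).eq_or_lt with h | h
    · rw [← h, mul_zero]
      positivity
    · have h5 := real_inner_le_norm (y 0 - yStar) gN
      have h6 : (((n : ℝ) + 1) * ‖gN‖) * ‖gN‖ ≤ (2 * ‖y 0 - yStar‖) * ‖gN‖ := by nlinarith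
      exact le_of_mul_le_mul_right h6 h
  rw [le_div_iff₀ (by positivity)]
  calc ‖gN‖ ^ 2 * ((n : ℝ) + 1) ^ 2 = (((n : ℝ) + 1) * ‖gN‖) ^ 2 := by ring
    _ ≤ (2 * ‖y 0 - yStar‖) ^ 2 := pow_le_pow_left₀ (by positivity) h4 2
    _ = 4 * ‖y 0 - yStar‖ ^ 2 := by ring

/-! ### Extension of nonexpansive maps -/

section Kirszbraun

open scoped InnerProductSpace

variable {E : Type*} [NormedAddCommGroup E] [InnerProductSpace ℝ E]

/-- The variance of a weighted family, as a sum over pairs. -/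
theorem sum_mul_norm_sq_sub {ι : Type*} [Fintype ι] (μ : ι → ℝ) (hμ : ∑ i, μ i = 1) (v : ι → E) :
    ∑ i, μ i * ‖v i‖ ^ 2 - ‖∑ i, μ i • v i‖ ^ 2 =
      1 / 2 * ∑ i, ∑ j, μ i * μ j * ‖v i - v j‖ ^ 2 := by
  have h1 : ∑ i, ∑ j, μ i * μ j * ‖v i‖ ^ 2 = ∑ i, μ i * ‖v i‖ ^ 2 := by
    refine Finset.sum_congr rfl fun i _ => ?_
    rw [← Finset.sum_mul, ← Finset.mul_sum, hμ, mul_one]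
  have h2 : ∑ i, ∑ j, μ i * μ j * ‖v j‖ ^ 2 = ∑ i, μ i * ‖v i‖ ^ 2 := by
    rw [Finset.sum_comm, ← h1]
    exact Finset.sum_congr rfl fun i _ => Finset.sum_congr rfl fun j _ => by ring
  have h3 : ∑ i, ∑ j, μ i * μ j * ⟪v i, v j⟫_ℝ = ‖∑ i, μ i • v i‖ ^ 2 := by
    rw [← real_inner_self_eq_norm_sq, sum_inner]
    refine Finset.sum_congr rfl fun i _ => ?_
    rw [inner_sum]
    refine Finset.sum_congr rfl fun j _ => ?_
    rw [real_inner_smul_left, real_inner_smul_right]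
    ring
  have h4 : ∑ i, ∑ j, μ i * μ j * ‖v i - v j‖ ^ 2 = ∑ i, ∑ j, μ i * μ j * ‖v i‖ ^ 2 -
      2 * ∑ i, ∑ j, μ i * μ j * ⟪v i, v j⟫_ℝ + ∑ i, ∑ j, μ i * μ j * ‖v j‖ ^ 2 := by
    simp only [Finset.mul_sum, ← Finset.sum_sub_distrib, ← Finset.sum_add_distrib]
    refine Finset.sum_congr rfl fun i _ => Finset.sum_congr rfl fun j _ => ?_
    rw [norm_sub_sq_real]
    ring
  rw [h4, h1, h2, h3]
  ring

/-- One-point extension of a nonexpansive map on finitely many points. The image is the barycenter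
whose weights maximize a concave quadratic function on the simplex. -/
theorem exists_norm_sub_le_of_finite {ι : Type*} [Fintype ι] [Nonempty ι] {p z : ι → E}
    (h : ∀ i j, ‖z i - z j‖ ≤ ‖p i - p j‖) (x : E) : ∃ w, ∀ i, ‖w - z i‖ ≤ ‖x - p i‖ := by
  classical
  let c : ι → ℝ := fun i => ‖x - p i‖ ^ 2
  let D : (ι → ℝ) → ℝ := fun μ => ∑ i, μ i * (‖z i‖ ^ 2 - c i) - ‖∑ i, μ i • z i‖ ^ 2
  have hDle : ∀ μ ∈ stdSimplex ℝ ι, D μ ≤ 0 := by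
    intro μ hμ
    have h1 := sum_mul_norm_sq_sub μ hμ.2 z
    have h2 := sum_mul_norm_sq_sub μ hμ.2 (fun i => x - p i)
    have h3 : ∑ i, ∑ j, μ i * μ j * ‖z i - z j‖ ^ 2 ≤
        ∑ i, ∑ j, μ i * μ j * ‖x - p i - (x - p j)‖ ^ 2 := by
      refine Finset.sum_le_sum fun i _ => Finset.sum_le_sum fun j _ => ?_
      rw [sub_sub_sub_cancel_left, norm_sub_rev (p j)]
      exact mul_le_mul_of_nonneg_left (pow_le_pow_left₀ (norm_nonneg _) (h i j) 2)
        (mul_nonneg (hμ.1 i) (hμ.1 j))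
    have h4 := sq_nonneg ‖∑ i, μ i • (x - p i)‖
    simp only [D, c, mul_sub, Finset.sum_sub_distrib]
    linarith
  have hcont : Continuous D := by
    simp only [D]
    fun_prop
  obtain ⟨μ, hμ, hmax⟩ := (isCompact_stdSimplex ℝ ι).exists_isMaxOn
    ⟨_, single_mem_stdSimplex ℝ (Classical.arbitrary ι)⟩ hcont.continuousOn
  set w := ∑ i, μ i • z i with hw
  refine ⟨w, fun i => ?_⟩
  set S := ∑ j, μ j * (‖z j‖ ^ 2 - c j) with hS
  have hD0 : S - ‖w‖ ^ 2 ≤ 0 := hDle μ hμ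
  -- the first-order optimality condition in the direction of the vertex `i`
  have hfirst : ∀ t : ℝ, 0 < t → t ≤ 1 →
      (‖z i‖ ^ 2 - c i) - S - 2 * ⟪w, z i - w⟫_ℝ ≤ t * ‖z i - w‖ ^ 2 := by
    intro t ht ht1
    have hmem : (1 - t) • μ + t • Pi.single i (1 : ℝ) ∈ stdSimplex ℝ ι :=
      convex_stdSimplex ℝ ι hμ (single_mem_stdSimplex ℝ i) (by linarith) ht.le (by ring)
    have h1 : D ((1 - t) • μ + t • Pi.single i (1 : ℝ)) ≤ D μ := hmax hmem
    have h2 : ∑ j, ((1 - t) • μ + t • (Pi.single i (1 : ℝ) : ι → ℝ)) j • z j =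
        w + t • (z i - w) := by
      simp only [Pi.add_apply, Pi.smul_apply, smul_eq_mul, add_smul, Finset.sum_add_distrib,
        mul_smul, ← Finset.smul_sum, ← hw]
      have : ∑ j, (Pi.single i (1 : ℝ) : ι → ℝ) j • z j = z i := by
        rw [Finset.sum_eq_single i] <;> simp +contextual
      rw [this]
      module
    have h3 : ∑ j, ((1 - t) • μ + t • (Pi.single i (1 : ℝ) : ι → ℝ)) j * (‖z j‖ ^ 2 - c j) =
        (1 - t) * S + t * (‖z i‖ ^ 2 - c i) := by
      simp only [Pi.add_apply, Pi.smul_apply, smul_eq_mul, add_mul, Finset.sum_add_distrib,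
        mul_assoc, ← Finset.mul_sum, ← hS]
      have : ∑ j, (Pi.single i (1 : ℝ) : ι → ℝ) j * (‖z j‖ ^ 2 - c j) = ‖z i‖ ^ 2 - c i := by
        rw [Finset.sum_eq_single i] <;> simp +contextual
      rw [this]
    simp only [D] at h1
    rw [h2, h3, ← hS, ← hw, norm_add_sq_real, norm_smul, real_inner_smul_right, mul_pow,
      Real.norm_eq_abs, sq_abs] at h1
    have h5 : t * ((‖z i‖ ^ 2 - c i) - S - 2 * ⟪w, z i - w⟫_ℝ) ≤ t * (t * ‖z i - w‖ ^ 2) := by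
      nlinarith
    exact le_of_mul_le_mul_left h5 ht
  have hzero : (‖z i‖ ^ 2 - c i) - S - 2 * ⟪w, z i - w⟫_ℝ ≤ 0 := by
    by_contra! hpos
    set K := (‖z i‖ ^ 2 - c i) - S - 2 * ⟪w, z i - w⟫_ℝ
    set L := ‖z i - w‖ ^ 2
    have hL : 0 ≤ L := sq_nonneg _
    have h1 := hfirst (min 1 (K / (2 * (L + 1)))) (lt_min one_pos (by positivity)) (min_le_left _ _)
    have h2 : min 1 (K / (2 * (L + 1))) * L ≤ K / (2 * (L + 1)) * L :=
      mul_le_mul_of_nonneg_right (min_le_right _ _) hL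
    have h3 : K / (2 * (L + 1)) * L < K := by
      rw [div_mul_eq_mul_div, div_lt_iff₀ (by positivity)]
      nlinarith
    linarith
  have h6 : ‖w - z i‖ ^ 2 = ‖z i‖ ^ 2 - 2 * ⟪w, z i - w⟫_ℝ - ‖w‖ ^ 2 := by
    rw [norm_sub_sq_real, inner_sub_right, real_inner_self_eq_norm_sq]
    ring
  have h7 : ‖w - z i‖ ^ 2 ≤ ‖x - p i‖ ^ 2 := by
    have : c i = ‖x - p i‖ ^ 2 := rfl
    linarith
  exact (sq_le_sq₀ (norm_nonneg _) (norm_nonneg _)).mp h7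

theorem exists_extend_insert {S : Set E} (hS : S.Finite) {f : E → E}
    (hf : ∀ x ∈ S, ∀ y ∈ S, ‖f x - f y‖ ≤ ‖x - y‖) (x₀ : E) :
    ∃ f' : E → E, (∀ x ∈ insert x₀ S, ∀ y ∈ insert x₀ S, ‖f' x - f' y‖ ≤ ‖x - y‖) ∧
      ∀ x ∈ S, f' x = f x := by
  classical
  by_cases hx : x₀ ∈ S
  · rw [Set.insert_eq_of_mem hx]
    exact ⟨f, hf, fun _ _ => rfl⟩
  · rcases S.eq_empty_or_nonempty with rfl | hne
    · exact ⟨f, by simp, by simp⟩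
    · have := hS.fintype
      have : Nonempty S := hne.to_subtype
      obtain ⟨w, hw⟩ := exists_norm_sub_le_of_finite (p := fun s : S => (s : E))
        (z := fun s : S => f s) (fun i j => hf i i.2 j j.2) x₀
      have hold : ∀ s ∈ S, Function.update f x₀ w s = f s := fun s hs =>
        Function.update_of_ne (fun h : s = x₀ => hx (h ▸ hs)) _ _
      have hnew : Function.update f x₀ w x₀ = w := Function.update_self _ _ _
      refine ⟨Function.update f x₀ w, ?_, hold⟩
      rintro x (rfl | hxS) y (rfl | hyS)
      · simp
      · rw [hnew, hold y hyS]
        exact hw ⟨y, hyS⟩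
      · rw [hnew, hold x hxS, norm_sub_rev, norm_sub_rev x]
        exact hw ⟨x, hxS⟩
      · rw [hold x hxS, hold y hyS]
        exact hf x hxS y hyS

theorem exists_extend_finset {S : Set E} (hS : S.Finite) {f : E → E}
    (hf : ∀ x ∈ S, ∀ y ∈ S, ‖f x - f y‖ ≤ ‖x - y‖) (F : Finset E) :
    ∃ f' : E → E, (∀ x ∈ S ∪ F, ∀ y ∈ S ∪ F, ‖f' x - f' y‖ ≤ ‖x - y‖) ∧
      ∀ x ∈ S, f' x = f x := by
  classical
  induction F using Finset.induction_on with
  | empty => exact ⟨f, by simpa using hf, fun _ _ => rfl⟩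
  | insert a F _ ih =>
    obtain ⟨f₁, h1, h2⟩ := ih
    obtain ⟨f₂, h3, h4⟩ := exists_extend_insert (hS.union F.finite_toSet) h1 a
    refine ⟨f₂, ?_, fun x hx => by rw [h4 x (Or.inl hx), h2 x hx]⟩
    rw [Finset.coe_insert, Set.union_insert]
    exact h3

open Filter in
/-- Kirszbraun's theorem in a finite-dimensional Hilbert space, for maps given on finitely many
points: an extension to the whole space is a limit, along an ultrafilter, of extensions to finite
sets. -/
theorem exists_nonexpansive_extension [FiniteDimensional ℝ E] {ι : Type*} [Finite ι] [Nonempty ι]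
    {p z : ι → E} (h : ∀ i j, ‖z i - z j‖ ≤ ‖p i - p j‖) :
    ∃ T : E → E, (∀ x y, ‖T x - T y‖ ≤ ‖x - y‖) ∧ ∀ i, T (p i) = z i := by
  classical
  let S : Set E := Set.range p
  have hS : S.Finite := Set.finite_range p
  let f : E → E := fun x => if hx : ∃ i, p i = x then z hx.choose else 0
  have hfp : ∀ i, f (p i) = z i := by
    intro i
    have hx : ∃ j, p j = p i := ⟨i, rfl⟩
    have h1 : f (p i) = z hx.choose := dif_pos hx
    have h2 := h hx.choose i
    rw [hx.choose_spec, sub_self, norm_zero] at h2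
    rw [h1]
    exact sub_eq_zero.mp (norm_le_zero_iff.mp h2)
  have hf : ∀ x ∈ S, ∀ y ∈ S, ‖f x - f y‖ ≤ ‖x - y‖ := by
    rintro _ ⟨i, rfl⟩ _ ⟨j, rfl⟩
    rw [hfp, hfp]
    exact h i j
  choose g hg1 hg2 using exists_extend_finset hS hf
  let U : Ultrafilter (Finset E) := Ultrafilter.of atTop
  have hU : ∀ x : E, ∀ᶠ F in (U : Filter (Finset E)), x ∈ F := fun x =>
    Ultrafilter.of_le atTop ((eventually_ge_atTop {x}).mono fun F hF => hF (by simp))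
  obtain ⟨i₀⟩ := ‹Nonempty ι›
  have hlim : ∀ x, ∃ l, Tendsto (fun F => g F x) U (nhds l) := by
    intro x
    have hmem : ∀ᶠ F in (U : Filter (Finset E)), g F x ∈ Metric.closedBall (z i₀) ‖x - p i₀‖ := by
      filter_upwards [hU x] with F hF
      rw [Metric.mem_closedBall, dist_eq_norm, ← hfp i₀, ← hg2 F (p i₀) ⟨i₀, rfl⟩]
      exact hg1 F x (Or.inr hF) (p i₀) (Or.inl ⟨i₀, rfl⟩)
    obtain ⟨l, -, hl⟩ := (isCompact_closedBall (z i₀) ‖x - p i₀‖).ultrafilter_le_nhds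
      (U.map fun F => g F x) (by rw [Filter.le_principal_iff]; exact hmem)
    exact ⟨l, hl⟩
  choose T hT using hlim
  refine ⟨T, fun x y => ?_, fun i => ?_⟩
  · refine le_of_tendsto ((hT x).sub (hT y)).norm ?_
    filter_upwards [hU x, hU y] with F hx hy
    exact hg1 F x (Or.inr hx) y (Or.inr hy)
  · refine tendsto_nhds_unique (hT (p i)) ?_
    have : (fun F => g F (p i)) = fun _ => z i := by
      funext F
      rw [hg2 F (p i) ⟨i, rfl⟩, hfp]
    rw [this]
    exact tendsto_const_nhds

end Kirszbraun

/-! ### Necessity of the certificates -/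

theorem IsLyapunovPair.isUnit_det {n : ℕ} {B G : Matrix (Fin (n + 1)) (Fin (n + 1)) ℝ}
    (h : IsLyapunovPair B G) : IsUnit G.det :=
  (Matrix.isUnit_iff_isUnit_det G).mp h.posDef.isUnit

theorem IsLyapunovPair.inv_last {n : ℕ} {B G : Matrix (Fin (n + 1)) (Fin (n + 1)) ℝ}
    (h : IsLyapunovPair B G) (a : Fin (n + 1)) : G⁻¹ a (Fin.last n) = (n : ℝ) + 1 := by
  have h1 : G.mulVec (fun _ => (n : ℝ) + 1) = Pi.single (Fin.last n) 1 := by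
    ext a
    simp only [Matrix.mulVec, dotProduct, ← Finset.sum_mul, h.sum_row, Pi.single_apply]
    split_ifs
    · field_simp
    · simp
  have h2 : G⁻¹.mulVec (G.mulVec (fun _ => (n : ℝ) + 1)) = fun _ => (n : ℝ) + 1 := by
    rw [Matrix.mulVec_mulVec, Matrix.nonsing_inv_mul G h.isUnit_det, Matrix.one_mulVec]
  rw [h1, Matrix.mulVec_single_one] at h2
  exact congrFun h2 a

/-- The scaled inverse `(n + 1)⁻² G⁻¹`. By `IsLyapunovPair.forwardGram_lyapunov` it behaves like the
Gram matrix of the residuals of a run in which the nonexpansiveness inequality between any two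
iterates is tight. -/
noncomputable def forwardGram {n : ℕ} (G : Matrix (Fin (n + 1)) (Fin (n + 1)) ℝ) :
    Matrix (Fin (n + 1)) (Fin (n + 1)) ℝ :=
  (1 / ((n : ℝ) + 1) ^ 2) • G⁻¹

theorem IsLyapunovPair.forwardGram_last {n : ℕ} {B G : Matrix (Fin (n + 1)) (Fin (n + 1)) ℝ}
    (h : IsLyapunovPair B G) (a : Fin (n + 1)) :
    forwardGram G a (Fin.last n) = 1 / ((n : ℝ) + 1) := by
  rw [forwardGram, Matrix.smul_apply, h.inv_last, smul_eq_mul]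
  field_simp

theorem IsLyapunovPair.forwardGram_symm {n : ℕ} {B G : Matrix (Fin (n + 1)) (Fin (n + 1)) ℝ}
    (h : IsLyapunovPair B G) (a b : Fin (n + 1)) : forwardGram G a b = forwardGram G b a := by
  have := congrFun (congrFun h.posDef.inv.isHermitian b) a
  simp only [Matrix.conjTranspose_apply, star_trivial] at this
  rw [forwardGram, Matrix.smul_apply, Matrix.smul_apply, this]

/-- Conjugating the Lyapunov equation by the inverse of `G` gives the dual Lyapunov equation. -/
theorem IsLyapunovPair.forwardGram_lyapunov {n : ℕ} {B G : Matrix (Fin (n + 1)) (Fin (n + 1)) ℝ}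
    (h : IsLyapunovPair B G) :
    forwardGram G + B * forwardGram G + forwardGram G * B.transpose = Matrix.of fun _ _ => 1 := by
  have hu := h.isUnit_det
  have h1 : G⁻¹ + B * G⁻¹ + G⁻¹ * B.transpose = G⁻¹ * cornerMat n * G⁻¹ := by
    rw [← h.lyapunov, Matrix.mul_add, Matrix.mul_add, Matrix.add_mul, Matrix.add_mul,
      Matrix.nonsing_inv_mul G hu, Matrix.one_mul, ← Matrix.mul_assoc G⁻¹ G B,
      Matrix.nonsing_inv_mul G hu, Matrix.one_mul, ← Matrix.mul_assoc, Matrix.mul_assoc _ G,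
      Matrix.mul_nonsing_inv G hu, Matrix.mul_one]
  have h2 : G⁻¹ * cornerMat n * G⁻¹ = Matrix.of fun _ _ => ((n : ℝ) + 1) ^ 2 := by
    ext a b
    have hsym : G⁻¹ (Fin.last n) b = (n : ℝ) + 1 := by
      rw [← h.inv_last b]
      have := congrFun (congrFun h.posDef.inv.isHermitian b) (Fin.last n)
      simpa using this
    rw [Matrix.mul_apply, Finset.sum_eq_single (Fin.last n)]
    · rw [Matrix.mul_single_apply_same, h.inv_last, hsym]
      simp [sq]
    · intro c _ hc
      rw [Matrix.mul_single_apply_of_ne _ _ _ _ _ hc, zero_mul]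
    · simp
  rw [forwardGram, Matrix.mul_smul, Matrix.smul_mul, ← smul_add, ← smul_add, h1, h2]
  ext a b
  simp
  field_simp

theorem IsLyapunovPair.forwardGram_posDef {n : ℕ} {B G : Matrix (Fin (n + 1)) (Fin (n + 1)) ℝ}
    (h : IsLyapunovPair B G) : (forwardGram G).PosDef :=
  h.posDef.inv.smul (by positivity)

/-- A positive definite matrix stays uniformly positive definite under small perturbations in a
fixed direction. -/
theorem exists_le_dotProduct_of_posDef {m : ℕ} {A : Matrix (Fin m) (Fin m) ℝ} (hA : A.PosDef)
    (D : Matrix (Fin m) (Fin m) ℝ) : ∃ c > 0, ∃ ε₀ > 0, ∀ ε : ℝ, 0 < ε → ε ≤ ε₀ → ∀ x : Fin m → ℝ,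
      c * (x ⬝ᵥ x) ≤ x ⬝ᵥ (A + ε • D).mulVec x := by
  have hex : ∃ c₀ > 0, ∀ x : Fin m → ℝ, c₀ * (x ⬝ᵥ x) ≤ x ⬝ᵥ A.mulVec x := by
    rcases (Metric.sphere (0 : EuclideanSpace ℝ (Fin m)) 1).eq_empty_or_nonempty with hS | hS
    · refine ⟨1, one_pos, fun x => ?_⟩
      have hx : x = 0 := by
        by_contra hx
        have hx' : WithLp.toLp 2 x ≠ (0 : EuclideanSpace ℝ (Fin m)) := by simpa using hx
        have : (‖WithLp.toLp 2 x‖⁻¹ • WithLp.toLp 2 x : EuclideanSpace ℝ (Fin m)) ∈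
            Metric.sphere (0 : EuclideanSpace ℝ (Fin m)) 1 := by
          rw [mem_sphere_zero_iff_norm, norm_smul, norm_inv, norm_norm,
            inv_mul_cancel₀ (norm_ne_zero_iff.mpr hx')]
        rw [hS] at this
        exact this
      simp [hx]
    · have hcont : Continuous fun x : EuclideanSpace ℝ (Fin m) => x.ofLp ⬝ᵥ A.mulVec x.ofLp := by
        simp only [dotProduct, Matrix.mulVec]
        fun_prop
      obtain ⟨x₀, hx₀, hmin⟩ := (isCompact_sphere (0 : EuclideanSpace ℝ (Fin m)) 1).exists_isMinOn
        hS hcont.continuousOn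
      have hx₀' : x₀.ofLp ≠ 0 := by
        intro h0
        have : x₀ = 0 := by
          ext i
          exact congrFun h0 i
        rw [this] at hx₀
        simp at hx₀
      refine ⟨_, by simpa using hA.dotProduct_mulVec_pos hx₀', fun x => ?_⟩
      by_cases hx : x = 0
      · simp [hx]
      · have hx' : WithLp.toLp 2 x ≠ (0 : EuclideanSpace ℝ (Fin m)) := by simpa using hx
        set r := ‖(WithLp.toLp 2 x : EuclideanSpace ℝ (Fin m))‖ with hr
        have hrpos : 0 < r := norm_pos_iff.mpr hx'
        have hmem : (r⁻¹ • WithLp.toLp 2 x : EuclideanSpace ℝ (Fin m)) ∈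
            Metric.sphere (0 : EuclideanSpace ℝ (Fin m)) 1 := by
          rw [mem_sphere_zero_iff_norm, norm_smul, norm_inv, hr, norm_norm,
            inv_mul_cancel₀ (norm_ne_zero_iff.mpr hx')]
        have h1 := hmin hmem
        have h2 : x ⬝ᵥ x = r ^ 2 := by
          rw [hr, EuclideanSpace.real_norm_sq_eq, dotProduct]
          exact Finset.sum_congr rfl fun i _ => by ring
        simp only [Set.mem_ofPred_eq, WithLp.ofLp_smul, Matrix.mulVec_smul, dotProduct_smul,
          smul_dotProduct, smul_eq_mul] at h1
        rw [h2]
        have h3 : r⁻¹ * (r⁻¹ * (x ⬝ᵥ A.mulVec x)) = (x ⬝ᵥ A.mulVec x) / r ^ 2 := by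
          field_simp
        rw [h3, le_div_iff₀ (by positivity)] at h1
        exact h1
  obtain ⟨c₀, hc₀, hA'⟩ := hex
  set M := ∑ a, ∑ b, |D a b| with hM
  have hM0 : 0 ≤ M := Finset.sum_nonneg fun a _ => Finset.sum_nonneg fun b _ => abs_nonneg _
  have hD : ∀ x : Fin m → ℝ, -(M * (x ⬝ᵥ x)) ≤ x ⬝ᵥ D.mulVec x := by
    intro x
    have hsq : ∀ a, x a ^ 2 ≤ x ⬝ᵥ x := by
      intro a
      rw [sq]
      exact Finset.single_le_sum (f := fun i => x i * x i) (fun i _ => mul_self_nonneg _)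
        (Finset.mem_univ a)
    have h1 : x ⬝ᵥ D.mulVec x = ∑ a, ∑ b, D a b * (x a * x b) := by
      simp only [dotProduct, Matrix.mulVec, Finset.mul_sum]
      exact Finset.sum_congr rfl fun a _ => Finset.sum_congr rfl fun b _ => by ring
    rw [h1, hM, Finset.sum_mul, ← Finset.sum_neg_distrib]
    refine Finset.sum_le_sum fun a _ => ?_
    rw [Finset.sum_mul, ← Finset.sum_neg_distrib]
    refine Finset.sum_le_sum fun b _ => ?_
    have h2 : |x a * x b| ≤ x ⬝ᵥ x := by
      rw [abs_le]
      constructor <;> nlinarith [hsq a, hsq b, sq_nonneg (x a + x b), sq_nonneg (x a - x b)]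
    have h3 : |D a b * (x a * x b)| ≤ |D a b| * (x ⬝ᵥ x) := by
      rw [abs_mul]
      exact mul_le_mul_of_nonneg_left h2 (abs_nonneg _)
    exact (abs_le.mp h3).1
  refine ⟨c₀ / 2, by positivity, c₀ / (2 * (M + 1)), by positivity, fun ε hε hε' x => ?_⟩
  have hxx : 0 ≤ x ⬝ᵥ x := Finset.sum_nonneg fun i _ => mul_self_nonneg _
  rw [Matrix.add_mulVec, dotProduct_add, Matrix.smul_mulVec, dotProduct_smul, smul_eq_mul]
  have h1 := hA' x
  have h2 := hD x
  have h3 : ε * M ≤ c₀ / 2 := by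
    calc ε * M ≤ c₀ / (2 * (M + 1)) * M := mul_le_mul_of_nonneg_right hε' hM0
      _ ≤ c₀ / 2 := by
        rw [div_mul_eq_mul_div, div_le_div_iff₀ (by positivity) (by positivity)]
        nlinarith
  have h4 : ε * -(M * (x ⬝ᵥ x)) ≤ ε * (x ⬝ᵥ D.mulVec x) := mul_le_mul_of_nonneg_left h2 hε.le
  have h5 : ε * M * (x ⬝ᵥ x) ≤ c₀ / 2 * (x ⬝ᵥ x) := mul_le_mul_of_nonneg_right h3 hxx
  linarith

open scoped MatrixOrder in
theorem Matrix.PosSemidef.exists_gram {m : ℕ} {Γ : Matrix (Fin m) (Fin m) ℝ} (hΓ : Γ.PosSemidef) :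
    ∃ g : Fin m → EuclideanSpace ℝ (Fin m), ∀ a b, inner ℝ (g a) (g b) = Γ a b := by
  obtain ⟨R, hR⟩ := CStarAlgebra.nonneg_iff_eq_star_mul_self.mp hΓ.nonneg
  refine ⟨fun a => WithLp.toLp 2 fun i => R i a, fun a b => ?_⟩
  rw [hR, Matrix.mul_apply]
  simp [PiLp.inner_apply, mul_comm]

open scoped InnerProductSpace in
/-- If two different residual polynomials have a positive inner product, then the rate is violated:
a small perturbation of the extremal Gram matrix gives points on which a nonexpansive operator can
be prescribed so that the last residual is too large. -/
theorem resGram_nonpos_of_mem_optimalH {n : ℕ} {H : Matrix (Fin n) (Fin n) ℝ}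
    (hopt : H ∈ optimalH n) {j k : Fin (n + 1)} (hjk : j ≠ k) : resGram H j k ≤ 0 := by
  by_contra! hpos
  have hH := hopt.1
  have hpair := (isInvariantH_of_mem_optimalH hopt).isLyapunovPair
  set B := cumMat H with hB
  set G := resGram H with hG
  have hn : (0 : ℝ) < (n : ℝ) + 1 := by positivity
  let W : Matrix (Fin (n + 1)) (Fin (n + 1)) ℝ := Matrix.single j k 1 + Matrix.single k j 1
  have hWsymm : W.transpose = W := by
    simp [W, Matrix.transpose_add, Matrix.transpose_single, add_comm]
  obtain ⟨D, hD⟩ := hpair.lower.exists_dual_lyapunov W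
  have hDsymm : D.transpose = D := by
    rw [← sub_eq_zero]
    apply hpair.lower.eq_zero_of_dual_lyapunov
    have h1 := congrArg Matrix.transpose hD
    rw [Matrix.transpose_add, Matrix.transpose_add, Matrix.transpose_mul, Matrix.transpose_mul,
      Matrix.transpose_transpose, hWsymm, ← hD] at h1
    rw [Matrix.mul_sub, Matrix.sub_mul]
    calc _ = (D.transpose + D.transpose * B.transpose + B * D.transpose) -
        (D + B * D + D * B.transpose) := by abel
      _ = 0 := by rw [h1, sub_self]
  obtain ⟨c, hc, ε₀, hε₀, hbound⟩ := exists_le_dotProduct_of_posDef hpair.forwardGram_posDef D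
  set z : Fin (n + 1) → ℝ := fun a => D a (Fin.last n) with hz
  have hzz : 0 ≤ z ⬝ᵥ z := Finset.sum_nonneg fun i _ => mul_self_nonneg _
  -- to first order in `ε` the bound is violated by `4 ε G j k`, up to a positive factor; the
  -- second-order term, bounded through `c`, limits the size of `ε`
  obtain ⟨ε, hε, hεle, hεlt⟩ : ∃ ε : ℝ, 0 < ε ∧ ε ≤ ε₀ ∧ ε * (z ⬝ᵥ z / c) < 4 * G j k := by
    refine ⟨min ε₀ (4 * G j k / (z ⬝ᵥ z / c + 1)), lt_min hε₀ (by positivity), min_le_left _ _, ?_⟩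
    have h0 : 0 ≤ z ⬝ᵥ z / c := by positivity
    calc _ ≤ 4 * G j k / (z ⬝ᵥ z / c + 1) * (z ⬝ᵥ z / c) :=
          mul_le_mul_of_nonneg_right (min_le_right _ _) h0
      _ < 4 * G j k := by
        rw [div_mul_eq_mul_div, div_lt_iff₀ (by positivity)]
        nlinarith
  -- the Gram matrix of the perturbed residuals: the inequality between `j` and `k` becomes slack,
  -- all others between iterates stay tight
  set Γ := forwardGram G + ε • D with hΓ
  have hΓbound := hbound ε hε hεle
  have hΓsymm : ∀ a b, Γ a b = Γ b a := by
    intro a b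
    have := congrFun (congrFun hDsymm b) a
    rw [Matrix.transpose_apply] at this
    simp only [hΓ, Matrix.add_apply, Matrix.smul_apply, hpair.forwardGram_symm a b, this]
  have hΓpos : Γ.PosDef := by
    refine Matrix.PosDef.of_dotProduct_mulVec_pos ?_ fun x hx => ?_
    · ext a b
      simpa using hΓsymm b a
    · have h1 : 0 < x ⬝ᵥ x := by
        exact lt_of_le_of_ne (Finset.sum_nonneg fun i _ => mul_self_nonneg _)
          fun h => hx (dotProduct_self_eq_zero.mp h.symm)
      have h2 := hΓbound x
      rw [star_trivial]
      have : 0 < c * (x ⬝ᵥ x) := mul_pos hc h1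
      linarith
  set Y : Matrix (Fin (n + 1)) (Fin (n + 1)) ℝ := Matrix.of (fun _ _ => 1) + ε • W with hY
  have hlyap : Γ + B * Γ + Γ * B.transpose = Y := by
    rw [hΓ, hY, ← hpair.forwardGram_lyapunov, ← hD, Matrix.mul_add, Matrix.add_mul,
      Matrix.mul_smul, Matrix.smul_mul, smul_add, smul_add]
    abel
  obtain ⟨g, hg⟩ := hΓpos.posSemidef.exists_gram
  -- the starting point `v` is the combination of the residuals with coefficients `w / 2`, where
  -- `Γ w` has all entries `1`: then the inequalities with the fixed point `0` are tight
  obtain ⟨x, hx⟩ : ∃ x, Γ.mulVec x = z := by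
    refine ⟨Γ⁻¹.mulVec z, ?_⟩
    rw [Matrix.mulVec_mulVec, Matrix.mul_nonsing_inv _
      ((Matrix.isUnit_iff_isUnit_det _).mp hΓpos.isUnit), Matrix.one_mulVec]
  set u : Fin (n + 1) → ℝ := Pi.single (Fin.last n) ((n : ℝ) + 1) with hu
  have hΓu : Γ.mulVec u = fun a => 1 + ε * ((n : ℝ) + 1) * z a := by
    ext a
    rw [hu, Matrix.mulVec_single]
    simp only [hΓ, Pi.smul_apply, Matrix.col_apply, Matrix.add_apply, Matrix.smul_apply,
      hpair.forwardGram_last, smul_eq_mul, MulOpposite.smul_eq_mul_unop, MulOpposite.unop_op, hz]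
    field_simp
  set w : Fin (n + 1) → ℝ := u - (ε * ((n : ℝ) + 1)) • x with hw
  have hΓw : Γ.mulVec w = fun _ => 1 := by
    rw [hw, Matrix.mulVec_sub, Matrix.mulVec_smul, hx, hΓu]
    ext a
    simp
  set v : EuclideanSpace ℝ (Fin (n + 1)) := (1 / 2 : ℝ) • ∑ a, w a • g a with hv
  have hvg : ∀ a, ⟪v, g a⟫_ℝ = 1 / 2 := by
    intro a
    have h1 := congrFun hΓw a
    simp only [Matrix.mulVec, dotProduct] at h1
    rw [hv, real_inner_smul_left, sum_inner]
    simp only [real_inner_smul_left, hg]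
    have h2 : ∑ b, w b * Γ b a = 1 := by
      rw [← h1]
      exact Finset.sum_congr rfl fun b _ => by rw [hΓsymm a b, mul_comm]
    rw [h2, mul_one]
  set d : Fin (n + 1) → EuclideanSpace ℝ (Fin (n + 1)) := fun a => ∑ b, B a b • g b with hd
  have hYgram : ∀ a b, Y a b = ⟪g a, g b⟫_ℝ + ⟪d a, g b⟫_ℝ + ⟪g a, d b⟫_ℝ := by
    intro a b
    rw [← hlyap]
    exact dual_lyapunov_gram_apply B hg a b
  have hWdiag : ∀ a, W a a = 0 := by
    intro a
    simp only [W, Matrix.add_apply, Matrix.single_apply]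
    rw [if_neg fun h => hjk (h.1.trans h.2.symm), if_neg fun h => hjk (h.2.trans h.1.symm),
      add_zero]
  have hWnonneg : ∀ a b, 0 ≤ W a b := by
    intro a b
    simp only [W, Matrix.add_apply, Matrix.single_apply]
    split_ifs <;> norm_num
  have hYdiag : ∀ a, Y a a = 1 := by
    intro a
    simp [hY, hWdiag]
  have hYge : ∀ a b, 1 ≤ Y a b := by
    intro a b
    have := mul_nonneg hε.le (hWnonneg a b)
    simpa [hY] using this
  -- the data: `y a ↦ y a - g a`, and the fixed point `0`
  let y : Fin (n + 1) → EuclideanSpace ℝ (Fin (n + 1)) := fun a => v - d a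
  have hstar : ∀ a, ‖y a - g a‖ ≤ ‖y a‖ := by
    intro a
    rw [← sq_le_sq₀ (norm_nonneg _) (norm_nonneg _), norm_sub_sq_real]
    have h1 : ⟪y a, g a⟫_ℝ = 1 / 2 - ⟪d a, g a⟫_ℝ := by
      rw [inner_sub_left, hvg]
    have h2 := hYgram a a
    rw [hYdiag, real_inner_self_eq_norm_sq, real_inner_comm (d a) (g a)] at h2
    linarith
  have hdata : ∀ a b, ‖(y a - g a) - (y b - g b)‖ ≤ ‖y a - y b‖ := by
    intro a b
    rw [← sq_le_sq₀ (norm_nonneg _) (norm_nonneg _), sub_sub_sub_comm, norm_sub_sq_real]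
    have h1 : y a - y b = d b - d a := sub_sub_sub_cancel_left _ _ _
    have h2 : ‖g a - g b‖ ^ 2 = ⟪g a, g a⟫_ℝ - 2 * ⟪g a, g b⟫_ℝ + ⟪g b, g b⟫_ℝ := by
      rw [norm_sub_sq_real, real_inner_self_eq_norm_sq, real_inner_self_eq_norm_sq]
    have h3 : ⟪y a - y b, g a - g b⟫_ℝ =
        ⟪d b, g a⟫_ℝ - ⟪d b, g b⟫_ℝ - ⟪d a, g a⟫_ℝ + ⟪d a, g b⟫_ℝ := by
      rw [h1, inner_sub_left, inner_sub_right, inner_sub_right]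
      ring
    have h4 := hYgram a a
    have h5 := hYgram b b
    have h6 := hYgram a b
    rw [hYdiag, real_inner_comm (d a) (g a)] at h4
    rw [hYdiag, real_inner_comm (d b) (g b)] at h5
    rw [real_inner_comm (d b) (g a)] at h6
    have h7 := hYge a b
    rw [h2, h3]
    linarith
  obtain ⟨T, hT, hTp⟩ := exists_nonexpansive_extension (ι := Option (Fin (n + 1)))
    (p := fun o => o.elim 0 y) (z := fun o => o.elim 0 fun a => y a - g a) (by
      rintro (_ | a) (_ | b)
      · simp
      · simp only [Option.elim, zero_sub, norm_neg]
        exact hstar b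
      · simpa using hstar a
      · exact hdata a b)
  have hTy : ∀ a, y a - T (y a) = g a := by
    intro a
    have : T (y a) = y a - g a := hTp (some a)
    rw [this, sub_sub_cancel]
  have hy0 : y 0 = v := by
    simp [y, hd, hB, cumMat_zero]
  have htraj : IsTrajectory H T y := by
    rw [isTrajectory_iff hH]
    intro a
    simp only [hTy, hy0]
    rfl
  have hrate := hopt.2 _ T hT 0 (hTp none) y htraj
  rw [hTy, sub_zero, hy0, le_div_iff₀ (by positivity), ← real_inner_self_eq_norm_sq, hg] at hrate
  -- evaluation of both sides
  have hsumW : ∀ M : Matrix (Fin (n + 1)) (Fin (n + 1)) ℝ,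
      ∑ a, ∑ b, M a b * W b a = M k j + M j k := by
    intro M
    have h1 : (M * W).trace = ∑ a, ∑ b, M a b * W b a := by
      simp [Matrix.trace, Matrix.mul_apply]
    rw [← h1]
    simp [W, Matrix.mul_add, Matrix.trace_mul_single]
  have hΓN : Γ (Fin.last n) (Fin.last n) = 1 / ((n : ℝ) + 1) + ε * (2 * G j k) := by
    rw [← sum_mul_dual_lyapunov hpair.lyapunov hlyap]
    have h1 : ∑ a, ∑ b, G a b * Y b a = ∑ a, ∑ b, G a b + ε * ∑ a, ∑ b, G a b * W b a := by
      simp only [hY, Matrix.add_apply, Matrix.of_apply, Matrix.smul_apply, smul_eq_mul,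
        Finset.mul_sum, ← Finset.sum_add_distrib]
      exact Finset.sum_congr rfl fun a _ => Finset.sum_congr rfl fun b _ => by ring
    rw [h1, hsumW, hpair.symm k j]
    simp only [hpair.sum_row, Finset.sum_ite_eq', Finset.mem_univ, if_true]
    ring
  have hDN : z (Fin.last n) = 2 * G j k := by
    rw [hz]
    simp only
    rw [← sum_mul_dual_lyapunov hpair.lyapunov hD, hsumW, hpair.symm k j]
    ring
  have hvv : 4 * ‖v‖ ^ 2 = ∑ a, w a := by
    rw [← real_inner_self_eq_norm_sq]
    conv_lhs => rw [hv, real_inner_smul_right, inner_sum]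
    simp only [real_inner_smul_right]
    rw [← hv]
    simp only [hvg, ← Finset.sum_mul]
    ring
  have hsumx : ∑ a, x a = ((n : ℝ) + 1) * (2 * G j k) - ε * ((n : ℝ) + 1) * (z ⬝ᵥ x) := by
    have h1 : u ⬝ᵥ Γ.mulVec x = Γ.mulVec u ⬝ᵥ x := by
      rw [Matrix.dotProduct_mulVec, ← Matrix.mulVec_transpose]
      congr 2
      ext a b
      exact hΓsymm b a
    rw [hx, hΓu, hu, single_dotProduct, hDN] at h1
    simp only [dotProduct, add_mul, one_mul, Finset.sum_add_distrib, mul_assoc,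
      ← Finset.mul_sum] at h1 ⊢
    linarith
  have hzx : z ⬝ᵥ x ≤ z ⬝ᵥ z / c := by
    have h1 := hΓbound x
    rw [← hΓ, hx, dotProduct_comm x z] at h1
    have h2 : 0 ≤ (z - c • x) ⬝ᵥ (z - c • x) := Finset.sum_nonneg fun i _ => mul_self_nonneg _
    simp only [sub_dotProduct, dotProduct_sub, smul_dotProduct, dotProduct_smul, smul_eq_mul,
      dotProduct_comm x z] at h2
    rw [le_div_iff₀ hc]
    nlinarith
  have hsumw : ∑ a, w a = ((n : ℝ) + 1) - ε * ((n : ℝ) + 1) * ∑ a, x a := by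
    simp [hw, hu, Finset.sum_sub_distrib, Finset.mul_sum]
  rw [hΓN, hvv, hsumw, hsumx] at hrate
  have h1 : (1 / ((n : ℝ) + 1) + ε * (2 * G j k)) * ((n : ℝ) + 1) ^ 2 =
      ((n : ℝ) + 1) + ε * ((n : ℝ) + 1) ^ 2 * (2 * G j k) := by
    field_simp
  rw [h1] at hrate
  have h2 : ε * ((n : ℝ) + 1) ^ 2 * (4 * G j k) ≤ ε * ((n : ℝ) + 1) ^ 2 * (ε * (z ⬝ᵥ x)) := by
    linarith
  have h3 := le_of_mul_le_mul_left h2 (by positivity)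
  have h4 : ε * (z ⬝ᵥ x) ≤ ε * (z ⬝ᵥ z / c) := mul_le_mul_of_nonneg_left hzx hε.le
  linarith

/-! ### Trailing blocks, arcs and vertices -/

/-- The trace of the Lyapunov equation, after multiplication by the inverse of `G`. -/
theorem dotProduct_eq_card_of_lyapunov {ι : Type*} [Fintype ι] [DecidableEq ι]
    {B G : Matrix ι ι ℝ} {e c : ι → ℝ} (hB : ∀ i, B i i = 0) (hG : IsUnit G.det)
    (h : G + G * B + B.transpose * G = Matrix.vecMulVec e e) (hc : G.mulVec c = e) :
    e ⬝ᵥ c = Fintype.card ι := by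
  have htr : B.trace = 0 := Finset.sum_eq_zero fun i _ => hB i
  have h1 : G⁻¹ * (G + G * B + B.transpose * G) = Matrix.vecMulVec c e := by
    rw [h, Matrix.mul_vecMulVec, ← hc, Matrix.mulVec_mulVec, Matrix.nonsing_inv_mul G hG,
      Matrix.one_mulVec]
  have h2 := congrArg Matrix.trace h1
  rw [Matrix.mul_add, Matrix.mul_add, Matrix.nonsing_inv_mul G hG, ← Matrix.mul_assoc,
    Matrix.nonsing_inv_mul G hG, Matrix.one_mul, Matrix.trace_add, Matrix.trace_add,
    Matrix.trace_one, htr, Matrix.trace_mul_comm, Matrix.mul_assoc, Matrix.mul_nonsing_inv G hG,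
    Matrix.mul_one, Matrix.trace_transpose, htr, Matrix.trace_vecMulVec, dotProduct_comm] at h2
  linarith

theorem submatrix_mul_of_strictLower {m : ℕ} {ι : Type*} [Fintype ι]
    {B : Matrix (Fin m) (Fin m) ℝ} (hB : StrictLower B) (G : Matrix (Fin m) (Fin m) ℝ)
    {f : ι → Fin m} (hf : Function.Injective f) (hup : ∀ i c, f i ≤ c → c ∈ Set.range f) :
    (G * B).submatrix f f = G.submatrix f f * B.submatrix f f := by
  ext a b
  simp only [Matrix.submatrix_apply, Matrix.mul_apply]
  symm
  refine Fintype.sum_of_injective f hf _ _ (fun c hc => ?_) fun _ => rfl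
  rw [hB c (f b), mul_zero]
  by_contra hlt
  exact hc (hup b c (not_le.mp hlt).le)

/-- A trailing principal block of a Lyapunov pair satisfies the Lyapunov equation. -/
theorem IsLyapunovPair.submatrix_lyapunov {n : ℕ} {B G : Matrix (Fin (n + 1)) (Fin (n + 1)) ℝ}
    (h : IsLyapunovPair B G) {ι : Type*} [Fintype ι] {f : ι → Fin (n + 1)}
    (hf : Function.Injective f) (hup : ∀ i c, f i ≤ c → c ∈ Set.range f) :
    G.submatrix f f + G.submatrix f f * B.submatrix f f +
      (B.submatrix f f).transpose * G.submatrix f f = (cornerMat n).submatrix f f := by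
  have hsymm : G.transpose = G := by
    ext a b
    exact h.symm b a
  have h1 := submatrix_mul_of_strictLower h.lower G hf hup
  have h2 : (B.transpose * G).submatrix f f =
      (B.submatrix f f).transpose * G.submatrix f f := by
    have := congrArg Matrix.transpose h1
    rw [Matrix.transpose_submatrix, Matrix.transpose_mul, hsymm, Matrix.transpose_mul,
      Matrix.transpose_submatrix G, hsymm] at this
    exact this
  rw [← h1, ← h2, ← h.lyapunov]
  rfl

/-- The trace identity for a trailing block, selected by `f`: if `c` solves `G' c = e` for the block
`G'` of `G` and the last coordinate vector `e`, then the last entry of `c` is the size of the block.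
-/
theorem IsLyapunovPair.dotProduct_eq_card {n : ℕ} {B G : Matrix (Fin (n + 1)) (Fin (n + 1)) ℝ}
    (h : IsLyapunovPair B G) {ι : Type*} [Fintype ι] {f : ι → Fin (n + 1)}
    (hf : Function.Injective f) (hup : ∀ i c, f i ≤ c → c ∈ Set.range f) {c : ι → ℝ}
    (hc : ∀ i, ∑ k, G (f i) (f k) * c k = if f i = Fin.last n then 1 else 0) :
    ∑ i, (if f i = Fin.last n then c i else 0) = Fintype.card ι := by
  classical
  let e : ι → ℝ := fun i => if f i = Fin.last n then 1 else 0
  have he : (cornerMat n).submatrix f f = Matrix.vecMulVec e e := by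
    ext a b
    simp only [Matrix.submatrix_apply, cornerMat, Matrix.single_apply, Matrix.vecMulVec_apply, e,
      eq_comm (a := Fin.last n)]
    by_cases ha : f a = Fin.last n <;> by_cases hb : f b = Fin.last n <;> simp [ha, hb]
  have := dotProduct_eq_card_of_lyapunov (B := B.submatrix f f) (G := G.submatrix f f) (e := e)
    (c := c) (fun i => h.lower _ _ le_rfl)
    ((Matrix.isUnit_iff_isUnit_det _).mp (h.posDef.submatrix hf).isUnit)
    (by rw [h.submatrix_lyapunov hf hup, he]) (funext hc)
  rw [← this, dotProduct]
  exact Finset.sum_congr rfl fun i _ => by simp [e]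

/-- Every node except the last is joined to a larger node: otherwise two consecutive trailing blocks
would contradict the trace identity. -/
theorem IsLyapunovPair.exists_gt_ne_zero {n : ℕ} {B G : Matrix (Fin (n + 1)) (Fin (n + 1)) ℝ}
    (h : IsLyapunovPair B G) (j : Fin n) : ∃ k, j.castSucc < k ∧ G k j.castSucc ≠ 0 := by
  by_contra! hall
  let f₁ : {a : Fin (n + 1) // j.castSucc ≤ a} → Fin (n + 1) := Subtype.val
  let f₂ : {a : Fin (n + 1) // j.castSucc < a} → Fin (n + 1) := Subtype.val
  have hup₁ : ∀ i c, f₁ i ≤ c → c ∈ Set.range f₁ := fun i c hc => ⟨⟨c, i.2.trans hc⟩, rfl⟩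
  have hup₂ : ∀ i c, f₂ i ≤ c → c ∈ Set.range f₂ := fun i c hc => ⟨⟨c, i.2.trans_le hc⟩, rfl⟩
  have hunit : IsUnit (G.submatrix f₂ f₂).det :=
    (Matrix.isUnit_iff_isUnit_det _).mp (h.posDef.submatrix Subtype.val_injective).isUnit
  let e : {a : Fin (n + 1) // j.castSucc < a} → ℝ := fun i => if f₂ i = Fin.last n then 1 else 0
  let c₂ := (G.submatrix f₂ f₂)⁻¹.mulVec e
  have hc₂ : (G.submatrix f₂ f₂).mulVec c₂ = e := by
    rw [Matrix.mulVec_mulVec, Matrix.mul_nonsing_inv _ hunit, Matrix.one_mulVec]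
  -- since `j` is not coupled to larger nodes, the extension of `c₂` by zero solves the system of
  -- the larger block as well
  let c : Fin (n + 1) → ℝ := fun a => if ha : j.castSucc < a then c₂ ⟨a, ha⟩ else 0
  have hc : ∀ i, c (f₂ i) = c₂ i := fun i => dif_pos i.2
  let ι : {a : Fin (n + 1) // j.castSucc < a} → {a : Fin (n + 1) // j.castSucc ≤ a} :=
    fun a => ⟨a, a.2.le⟩
  have hι : Function.Injective ι := fun a b hab =>
    Subtype.ext (congrArg (fun x : {a // j.castSucc ≤ a} => x.val) hab)
  have hnot : ∀ a ∉ Set.range ι, (a : Fin (n + 1)) = j.castSucc := by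
    intro a ha
    by_contra hne
    exact ha ⟨⟨a, lt_of_le_of_ne a.2 (Ne.symm hne)⟩, rfl⟩
  have hcj : c j.castSucc = 0 := dif_neg (lt_irrefl _)
  have hsum : ∀ F : Fin (n + 1) → ℝ, ∑ k, F (f₂ k) * c₂ k = ∑ k, F (f₁ k) * c (f₁ k) := by
    intro F
    refine Fintype.sum_of_injective ι hι _ _ (fun a ha => ?_) fun i => ?_
    · rw [show f₁ a = j.castSucc from hnot a ha, hcj, mul_zero]
    · rw [← hc]
  have h₂ := h.dotProduct_eq_card Subtype.val_injective hup₂ (c := c₂) (congrFun hc₂)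
  have h₁ := h.dotProduct_eq_card (f := f₁) Subtype.val_injective hup₁ (c := fun i => c (f₁ i)) (by
    intro i
    rw [← hsum]
    by_cases hi : j.castSucc < f₁ i
    · exact congrFun hc₂ ⟨f₁ i, hi⟩
    · have hij : f₁ i = j.castSucc := le_antisymm (not_lt.mp hi) i.2
      rw [hij, if_neg (Fin.castSucc_lt_last j).ne]
      refine Finset.sum_eq_zero fun k _ => ?_
      rw [h.symm, hall _ k.2, zero_mul])
  have h₃ := hsum fun a => if a = Fin.last n then 1 else 0
  simp only [ite_mul, one_mul, zero_mul] at h₃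
  rw [h₁, h₂] at h₃
  have hlt := Fintype.card_lt_of_injective_of_notMem ι hι (b := ⟨j.castSucc, le_rfl⟩) (by
    rintro ⟨a, ha⟩
    exact a.2.ne' (congrArg Subtype.val ha))
  exact hlt.ne (by exact_mod_cast h₃)

theorem algDiagram_adj {n : ℕ} (H : Matrix (Fin n) (Fin n) ℝ) (a b : Fin (n + 1)) :
    (algDiagram H).Adj a b ↔ a ≠ b ∧ resGram H a b ≠ 0 := by
  have hn : -((n : ℝ) + 1) ≠ 0 := neg_ne_zero.mpr (by positivity)
  have key : ∀ a b : Fin (n + 1), (∃ j : Fin n, a = j.castSucc ∧ a < b ∧ hCert H b j ≠ 0) ↔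
      a < b ∧ resGram H a b ≠ 0 := by
    intro a b
    constructor
    · rintro ⟨j, rfl, hlt, hne⟩
      rw [hCert_eq, resGram_comm] at hne
      exact ⟨hlt, right_ne_zero_of_mul hne⟩
    · rintro ⟨hlt, hne⟩
      obtain ⟨j, rfl⟩ := Fin.exists_castSucc_eq.mpr (ne_of_lt (lt_of_lt_of_le hlt (Fin.le_last b)))
      refine ⟨j, rfl, hlt, ?_⟩
      rw [hCert_eq, resGram_comm]
      exact mul_ne_zero hn hne
  rw [algDiagram, SimpleGraph.fromRel_adj, key, key, resGram_comm H b a]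
  constructor
  · rintro ⟨h1, h2 | h2⟩
    · exact ⟨h1, h2.2⟩
    · exact ⟨h1, h2.2⟩
  · rintro ⟨h1, h2⟩
    rcases lt_or_gt_of_ne h1 with h | h
    · exact ⟨h1, Or.inl ⟨h, h2⟩⟩
    · exact ⟨h1, Or.inr ⟨h, h2⟩⟩

theorem hCert_ne_zero_iff {n : ℕ} (H : Matrix (Fin n) (Fin n) ℝ) {k : Fin (n + 1)} {j : Fin n}
    (hjk : j.castSucc < k) : hCert H k j ≠ 0 ↔ (algDiagram H).Adj j.castSucc k := by
  rw [algDiagram_adj, hCert_eq, resGram_comm]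
  have : -((n : ℝ) + 1) ≠ 0 := neg_ne_zero.mpr (by positivity)
  exact ⟨fun h => ⟨hjk.ne, right_ne_zero_of_mul h⟩, fun h => mul_ne_zero this h.2⟩

open scoped Classical in
/-- The larger neighbours of a node in the diagram of `H`. -/
noncomputable def upNeighbors {n : ℕ} (H : Matrix (Fin n) (Fin n) ℝ) (j : Fin n) :
    Finset (Fin (n + 1)) :=
  Finset.univ.filter fun k => j.castSucc < k ∧ (algDiagram H).Adj j.castSucc k

/-- The pairs of nodes are those with vanishing certificate and those joined in the diagram. -/
theorem card_zeroCerts_add {n : ℕ} (H : Matrix (Fin n) (Fin n) ℝ) :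
    (zeroCerts H).card + ∑ j, (upNeighbors H j).card =
      (Finset.univ.filter fun p : Fin (n + 1) × Fin n => p.2.castSucc < p.1).card := by
  classical
  have h1 : ∑ j, (upNeighbors H j).card = (Finset.univ.filter fun p : Fin (n + 1) × Fin n =>
      p.2.castSucc < p.1 ∧ hCert H p.1 p.2 ≠ 0).card := by
    rw [Finset.card_eq_sum_card_fiberwise (f := Prod.snd) (t := Finset.univ) (by simp)]
    refine Finset.sum_congr rfl fun j _ => ?_
    refine Finset.card_bij (fun k _ => (k, j)) ?_ ?_ ?_
    · intro k hk
      have hk := (Finset.mem_filter.mp hk).2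
      simp [hk.1, (hCert_ne_zero_iff H hk.1).mpr hk.2]
    · intro a _ b _ hab
      exact (Prod.mk.inj hab).1
    · rintro ⟨k, j'⟩ hb
      simp only [Finset.mem_filter, Finset.mem_univ, true_and] at hb
      obtain ⟨⟨h1, h2⟩, rfl⟩ := hb
      refine ⟨k, ?_, rfl⟩
      simp only [upNeighbors, Finset.mem_filter, Finset.mem_univ, true_and]
      exact ⟨h1, (hCert_ne_zero_iff H h1).mp h2⟩
  rw [h1, zeroCerts, ← Finset.filter_filter, ← Finset.filter_filter]
  exact Finset.card_filter_add_card_filter_not _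

theorem isArcDiagram_algDiagram_iff {n : ℕ} (H : Matrix (Fin n) (Fin n) ℝ) :
    IsArcDiagram (algDiagram H) ↔ ∀ j, (upNeighbors H j).card = 1 := by
  simp only [IsArcDiagram, Finset.card_eq_one, Finset.ext_iff, upNeighbors, Finset.mem_filter,
    Finset.mem_univ, true_and, Finset.mem_singleton, ExistsUnique]
  refine forall_congr' fun j => exists_congr fun k => ?_
  constructor
  · rintro ⟨h1, h2⟩ a
    exact ⟨h2 a, by rintro rfl; exact h1⟩
  · intro h
    exact ⟨(h k).mpr rfl, fun a ha => (h a).mp ha⟩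

theorem one_le_card_upNeighbors {n : ℕ} {H : Matrix (Fin n) (Fin n) ℝ} (hH : H ∈ optimalH n)
    (j : Fin n) : 1 ≤ (upNeighbors H j).card := by
  obtain ⟨k, hk, hne⟩ := (isInvariantH_of_mem_optimalH hH).isLyapunovPair.exists_gt_ne_zero j
  refine Finset.card_pos.mpr ⟨k, ?_⟩
  simp only [upNeighbors, Finset.mem_filter, Finset.mem_univ, true_and]
  rw [algDiagram_adj, resGram_comm]
  exact ⟨hk, hk.ne, hne⟩

/-- Vertices are the optimal matrices whose diagram is an arc diagram, as soon as one such matrix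
exists. -/
theorem isVertexAlg_iff {n : ℕ} {H₀ : Matrix (Fin n) (Fin n) ℝ} (h₀ : H₀ ∈ optimalH n)
    (harc : IsArcDiagram (algDiagram H₀)) (H : Matrix (Fin n) (Fin n) ℝ) :
    IsVertexAlg H ↔ H ∈ optimalH n ∧ IsArcDiagram (algDiagram H) := by
  rw [isArcDiagram_algDiagram_iff] at harc
  have e₀ := card_zeroCerts_add H₀
  simp only [harc] at e₀
  have hge : ∀ H' ∈ optimalH n, ∑ _j : Fin n, 1 ≤ ∑ j, (upNeighbors H' j).card := fun H' h' =>
    Finset.sum_le_sum fun j _ => one_le_card_upNeighbors h' j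
  constructor
  · rintro ⟨hopt, hmax⟩
    refine ⟨hopt, ?_⟩
    rw [isArcDiagram_algDiagram_iff]
    have e := card_zeroCerts_add H
    have h1 := hmax H₀ h₀
    have h2 : ∑ _j : Fin n, 1 = ∑ j, (upNeighbors H j).card :=
      le_antisymm (hge H hopt) (by omega)
    intro j
    exact ((Finset.sum_eq_sum_iff_of_le fun j _ => one_le_card_upNeighbors hopt j).mp h2 j
      (Finset.mem_univ j)).symm
  · rintro ⟨hopt, h⟩
    rw [isArcDiagram_algDiagram_iff] at h
    refine ⟨hopt, fun H' h' => ?_⟩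
    have e := card_zeroCerts_add H
    have e' := card_zeroCerts_add H'
    simp only [h] at e
    have := hge H' h'
    omega

/-! ### The H-dual and crossing arcs -/

theorem hDual_lower {n : ℕ} {H : Matrix (Fin n) (Fin n) ℝ} (hH : ∀ i j, i < j → H i j = 0)
    (i j : Fin n) (hij : i < j) : hDual H i j = 0 :=
  hH _ _ (Fin.rev_lt_rev.mpr hij)

/-- The lower triangular matrix of ones. -/
def summationMat (m : ℕ) : Matrix (Fin m) (Fin m) ℝ := Matrix.of fun a b => if b ≤ a then 1 else 0

/-- The matrix `H` with a zero row on top and a zero column on the right. -/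
noncomputable def shiftedMat {n : ℕ} (H : Matrix (Fin n) (Fin n) ℝ) :
    Matrix (Fin (n + 1)) (Fin (n + 1)) ℝ :=
  Matrix.of fun a b => Fin.cases (motive := fun _ => ℝ) 0
    (fun i => Fin.snoc (α := fun _ => ℝ) (H i) 0 b) a

theorem cumMat_eq_mul {n : ℕ} (H : Matrix (Fin n) (Fin n) ℝ) :
    cumMat H = summationMat (n + 1) * shiftedMat H := by
  ext a b
  rw [Matrix.mul_apply, Fin.sum_univ_succ]
  simp only [summationMat, shiftedMat, cumMat, Matrix.of_apply, Fin.cases_zero, Fin.cases_succ,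
    mul_zero, zero_add, ite_mul, one_mul, zero_mul, Fin.lt_def, Fin.le_def, Fin.val_castSucc,
    Fin.val_succ, Nat.succ_le_iff]

/-- With `cumMat_eq_mul`: passing to the H-dual interchanges the two factors of `cumMat H`, up to
transposition and reversal of the nodes. -/
theorem cumMat_hDual_rev {n : ℕ} (H : Matrix (Fin n) (Fin n) ℝ) (a b : Fin (n + 1)) :
    cumMat (hDual H) b.rev a.rev = (shiftedMat H * summationMat (n + 1)) a b := by
  rw [Matrix.mul_apply, Fin.sum_univ_castSucc]
  cases a using Fin.cases with
  | zero => simp [cumMat, shiftedMat, Fin.rev_zero]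
  | succ a =>
    rw [Fin.rev_succ, cumMat_castSucc]
    simp only [shiftedMat, summationMat, Matrix.of_apply, Fin.cases_succ, Fin.snoc_castSucc,
      Fin.snoc_last, mul_ite, mul_one, mul_zero, ite_self, add_zero]
    rw [← Equiv.sum_comp Fin.revPerm fun i => if i.castSucc < b.rev then hDual H i a.rev else 0]
    refine Finset.sum_congr rfl fun i _ => ?_
    simp only [Fin.revPerm_apply, hDual, Matrix.of_apply, Fin.rev_rev]
    refine if_congr ?_ rfl rfl
    rw [Fin.lt_def, Fin.le_def]
    simp only [Fin.val_castSucc, Fin.val_rev]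
    omega

/-- The Gram matrix of the H-dual consists, in reversed order, of the second differences of the
forward Gram matrix. -/
theorem forwardGram_eq_sum {n : ℕ} {H : Matrix (Fin n) (Fin n) ℝ} (hH : IsInvariantH H)
    (a b : Fin (n + 1)) : forwardGram (resGram H) a b =
      ∑ a' ∈ Finset.Iic a, ∑ b' ∈ Finset.Iic b, resGram (hDual H) a'.rev b'.rev := by
  have hpair := hH.isLyapunovPair
  set S := summationMat (n + 1)
  set A := shiftedMat H
  set K : Matrix (Fin (n + 1)) (Fin (n + 1)) ℝ :=
    (resGram (hDual H)).submatrix Fin.rev Fin.rev with hK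
  have hB : cumMat H = S * A := cumMat_eq_mul H
  have e : ∀ P Q : Matrix (Fin (n + 1)) (Fin (n + 1)) ℝ, (P * Q).submatrix Fin.rev Fin.rev =
      P.submatrix Fin.rev Fin.rev * Q.submatrix Fin.rev Fin.rev := fun P Q =>
    (Matrix.submatrix_mul_equiv P Q _ Fin.revPerm _).symm
  have hA : (cumMat (hDual H)).submatrix Fin.rev Fin.rev = (A * S).transpose := by
    ext a b
    exact cumMat_hDual_rev H b a
  have hKlyap : K + A * S * K + K * (A * S).transpose = Matrix.single 0 0 1 := by
    have h1 := congrArg (fun M => M.submatrix Fin.rev Fin.rev) (resGram_lyapunov (hDual_lower hH.1))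
    simp only [Matrix.submatrix_add, Pi.add_apply, e] at h1
    have h2 : ((cumMat (hDual H)).transpose).submatrix Fin.rev Fin.rev = A * S := by
      rw [← Matrix.transpose_submatrix, hA, Matrix.transpose_transpose]
    rw [h2, hA, ← hK] at h1
    have h3 : (cornerMat n).submatrix Fin.rev Fin.rev = Matrix.single 0 0 1 := by
      ext a b
      simp only [Matrix.submatrix_apply, cornerMat, Matrix.single_apply]
      refine if_congr ?_ rfl rfl
      rw [← Fin.rev_zero, Fin.rev_inj, Fin.rev_inj]
    rw [← h3, ← h1]
    abel
  -- both sides solve the same dual Lyapunov equation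
  have hM : S * K * S.transpose = forwardGram (resGram H) := by
    rw [← sub_eq_zero]
    apply hpair.lower.eq_zero_of_dual_lyapunov
    have h1 : S * K * S.transpose + cumMat H * (S * K * S.transpose) +
        S * K * S.transpose * (cumMat H).transpose = Matrix.of fun _ _ => 1 := by
      have h2 : S * K * S.transpose + cumMat H * (S * K * S.transpose) +
          S * K * S.transpose * (cumMat H).transpose =
          S * (K + A * S * K + K * (A * S).transpose) * S.transpose := by
        rw [hB, Matrix.transpose_mul, Matrix.transpose_mul]
        noncomm_ring
      rw [h2, hKlyap]
      ext a b
      simp only [Matrix.mul_apply, Matrix.single_apply, S, summationMat, ite_and, Matrix.of_apply,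
        Matrix.transpose_apply, mul_ite, mul_one, mul_zero, Finset.sum_ite_eq, Finset.mem_univ,
        if_true, Fin.zero_le]
      rw [Finset.sum_eq_single 0] <;> simp +contextual [eq_comm]
    have h3 := hpair.forwardGram_lyapunov
    rw [Matrix.mul_sub, Matrix.sub_mul]
    calc _ = (S * K * S.transpose + cumMat H * (S * K * S.transpose) +
        S * K * S.transpose * (cumMat H).transpose) - (forwardGram (resGram H) +
        cumMat H * forwardGram (resGram H) +
        forwardGram (resGram H) * (cumMat H).transpose) := by abel
      _ = 0 := by rw [h1, h3, sub_self]
  rw [← hM, Matrix.mul_apply, Finset.sum_comm]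
  simp only [Matrix.mul_apply, Matrix.transpose_apply, S, summationMat, Matrix.of_apply, ite_mul,
    one_mul, zero_mul, mul_ite, mul_one, mul_zero, ← Finset.sum_filter]
  have hIic : ∀ c : Fin (n + 1), Finset.univ.filter (fun x => x ≤ c) = Finset.Iic c := fun c => by
    ext
    simp
  simp only [hIic]
  rfl

/-- If the H-dual is optimal, the rows of the forward Gram matrix decrease to the right of the
diagonal. -/
theorem forwardGram_antitone {n : ℕ} {H : Matrix (Fin n) (Fin n) ℝ} (hH : IsInvariantH H)
    (hdual : hDual H ∈ optimalH n) {a b c : Fin (n + 1)} (hab : a ≤ b) (hbc : b ≤ c) :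
    forwardGram (resGram H) a c ≤ forwardGram (resGram H) a b := by
  rw [forwardGram_eq_sum hH, forwardGram_eq_sum hH]
  refine Finset.sum_le_sum fun a' ha' => ?_
  have hsplit : Finset.Iic c = Finset.Iic b ∪ Finset.Ioc b c := by
    ext x
    simp only [Finset.mem_Iic, Finset.mem_union, Finset.mem_Ioc]
    constructor
    · intro h
      rcases le_or_gt x b with h1 | h1
      · exact Or.inl h1
      · exact Or.inr ⟨h1, h⟩
    · rintro (h | h)
      · exact h.trans hbc
      · exact h.2
  rw [hsplit, Finset.sum_union (Finset.disjoint_left.mpr fun x hx hx' =>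
    not_lt.mpr (Finset.mem_Iic.mp hx) (Finset.mem_Ioc.mp hx').1)]
  have : ∑ b' ∈ Finset.Ioc b c, resGram (hDual H) a'.rev b'.rev ≤ 0 := by
    refine Finset.sum_nonpos fun b' hb' => resGram_nonpos_of_mem_optimalH hdual fun h => ?_
    have h1 := Fin.rev_inj.mp h
    have h2 := Finset.mem_Iic.mp ha'
    have h3 := (Finset.mem_Ioc.mp hb').1
    rw [h1] at h2
    exact absurd (h3.trans_le (h2.trans hab)) (lt_irrefl _)
  linarith

/-- A potential `φ` on a rooted tree whose parents are larger nodes: the flow `w (φ a - φ (par a))`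
from each node to its parent is conserved, except that `κ` is injected at the node `s`. -/
structure IsTreePotential {n : ℕ} (par : Fin (n + 1) → Fin (n + 1)) (w φ : Fin (n + 1) → ℝ)
    (s : Fin (n + 1)) (κ : ℝ) : Prop where
  lt_par : ∀ a, a ≠ Fin.last n → a < par a
  pos : ∀ a, a ≠ Fin.last n → 0 < w a
  inject_pos : 0 < κ
  conserve : ∀ a, a ≠ Fin.last n → w a * (φ a - φ (par a)) =
    ∑ b ∈ Finset.univ.filter (fun b => b < a ∧ par b = a), w b * (φ b - φ (par b)) +
      if a = s then κ else 0

/-- The node `c` carries the whole flow, and no other node below `c` sends flow beyond `c`. -/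
def CarriesFlow {n : ℕ} (par : Fin (n + 1) → Fin (n + 1)) (w φ : Fin (n + 1) → ℝ)
    (κ : ℝ) (c : Fin (n + 1)) : Prop :=
  w c * (φ c - φ (par c)) = κ ∧ ∀ b < c, c < par b → w b * (φ b - φ (par b)) = 0

namespace IsTreePotential

variable {n : ℕ} {par : Fin (n + 1) → Fin (n + 1)} {w φ : Fin (n + 1) → ℝ} {s : Fin (n + 1)} {κ : ℝ}

theorem flow_eq_zero_of_lt (h : IsTreePotential par w φ s κ) :
    ∀ a < s, w a * (φ a - φ (par a)) = 0 := by
  intro a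
  induction a using WellFoundedLT.induction with
  | ind a ih =>
    intro ha
    rw [h.conserve a (ne_of_lt (ha.trans_le (Fin.le_last s))), if_neg ha.ne, add_zero]
    refine Finset.sum_eq_zero fun b hb => ?_
    have hb := (Finset.mem_filter.mp hb).2
    exact ih b hb.1 (hb.1.trans ha)

theorem carriesFlow_source (h : IsTreePotential par w φ s κ) (hs : s ≠ Fin.last n) :
    CarriesFlow par w φ κ s := by
  refine ⟨?_, fun b hb _ => h.flow_eq_zero_of_lt b hb⟩
  rw [h.conserve s hs, if_pos rfl, Finset.sum_eq_zero, zero_add]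
  intro b hb
  exact h.flow_eq_zero_of_lt b (Finset.mem_filter.mp hb).2.1

/-- Below the target of the arc that carries the flow, only this arc could feed a node, and it leads
beyond all nodes in question. -/
theorem flow_eq_zero_between (h : IsTreePotential par w φ s κ) {c : Fin (n + 1)} (hsc : s ≤ c)
    (hc : CarriesFlow par w φ κ c) : ∀ b, c < b → b < par c → w b * (φ b - φ (par b)) = 0 := by
  intro b
  induction b using WellFoundedLT.induction with
  | ind b ih =>
    intro hcb hbc
    rw [h.conserve b (ne_of_lt (hbc.trans_le (Fin.le_last _))), if_neg (hsc.trans_lt hcb).ne',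
      add_zero]
    refine Finset.sum_eq_zero fun x hx => ?_
    obtain ⟨hxb, hpar⟩ := (Finset.mem_filter.mp hx).2
    rcases lt_trichotomy x c with hxc | rfl | hxc
    · exact hc.2 x hxc (hpar ▸ hcb)
    · exact absurd hpar hbc.ne'
    · exact ih x hxb hxc (hxb.trans hbc)

theorem carriesFlow_par (h : IsTreePotential par w φ s κ) {c : Fin (n + 1)} (hsc : s ≤ c)
    (hcl : c ≠ Fin.last n) (hc : CarriesFlow par w φ κ c) (hpl : par c ≠ Fin.last n) :
    CarriesFlow par w φ κ (par c) := by
  have hlt := h.lt_par c hcl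
  constructor
  · rw [h.conserve _ hpl, if_neg (hsc.trans_lt hlt).ne', add_zero, ← hc.1,
      Finset.sum_eq_single c]
    · intro x hx hxc
      obtain ⟨hxb, hpar⟩ := (Finset.mem_filter.mp hx).2
      rcases lt_or_gt_of_ne hxc with hxc | hxc
      · exact hc.2 x hxc (hpar ▸ hlt)
      · exact h.flow_eq_zero_between hsc hc x hxc hxb
    · intro hnot
      exact absurd (Finset.mem_filter.mpr ⟨Finset.mem_univ c, hlt, rfl⟩) hnot
  · intro b hb hpar
    rcases lt_trichotomy b c with hbc | rfl | hbc
    · exact hc.2 b hbc (hlt.trans hpar)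
    · exact absurd hpar (lt_irrefl _)
    · exact h.flow_eq_zero_between hsc hc b hbc hb

theorem eq_of_flow_eq_zero (h : IsTreePotential par w φ s κ) {b : Fin (n + 1)}
    (hb : b ≠ Fin.last n) (hz : w b * (φ b - φ (par b)) = 0) : φ b = φ (par b) := by
  rcases mul_eq_zero.mp hz with h1 | h1
  · exact absurd h1 (h.pos b hb).ne'
  · linarith

/-- Beyond a node carrying the whole flow, the potential is strictly smaller. -/
theorem lt_of_carriesFlow (h : IsTreePotential par w φ s κ) : ∀ c, s ≤ c → c ≠ Fin.last n →
    CarriesFlow par w φ κ c → ∀ b, c < b → φ b < φ c := by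
  intro c
  induction c using WellFoundedGT.induction with
  | ind c ih =>
    intro hsc hcl hc b
    have hlt := h.lt_par c hcl
    have hdrop : φ (par c) < φ c := by
      by_contra! hle
      have h1 := hc.1
      have h2 := h.pos c hcl
      have h3 := h.inject_pos
      nlinarith
    induction b using WellFoundedGT.induction with
    | ind b ihb =>
      intro hcb
      rcases lt_trichotomy b (par c) with hb | rfl | hb
      · have hbl : b ≠ Fin.last n := ne_of_lt (hb.trans_le (Fin.le_last _))
        rw [h.eq_of_flow_eq_zero hbl (h.flow_eq_zero_between hsc hc b hcb hb)]
        exact ihb (par b) (h.lt_par b hbl) (hcb.trans (h.lt_par b hbl))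
      · exact hdrop
      · have hpl : par c ≠ Fin.last n := ne_of_lt (hb.trans_le (Fin.le_last _))
        exact (ih (par c) hlt (hsc.trans hlt.le) hpl (h.carriesFlow_par hsc hcl hc hpl) b hb).trans
          hdrop

/-- If the arcs of `s` and `j` cross, no flow passes through `j`, so `j` has the potential of its
parent, which lies beyond the first node `par s` on the path of the flow, and the potential is
smaller there. -/
theorem lt_of_crossing (h : IsTreePotential par w φ s κ) {j : Fin (n + 1)} (hsj : s < j)
    (hjk : j < par s) (hcross : par s < par j) : φ j < φ (par s) := by
  have hsl : s ≠ Fin.last n := ne_of_lt (hsj.trans_le (Fin.le_last _))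
  have hjl : j ≠ Fin.last n := ne_of_lt (hjk.trans_le (Fin.le_last _))
  have hpl : par s ≠ Fin.last n := ne_of_lt (hcross.trans_le (Fin.le_last _))
  have hs := h.carriesFlow_source hsl
  rw [h.eq_of_flow_eq_zero hjl (h.flow_eq_zero_between le_rfl hs j hsj hjk)]
  exact h.lt_of_carriesFlow (par s) (h.lt_par s hsl).le hpl (h.carriesFlow_par le_rfl hsl hs hpl) _
    hcross

end IsTreePotential

/-- If the graph of `G` is a tree, the row `s` of the scaled inverse of `G` is the potential of a
flow from `s` to the root, as `G` acts like a graph Laplacian away from the root. -/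
theorem forwardGram_isTreePotential {n : ℕ} {B G : Matrix (Fin (n + 1)) (Fin (n + 1)) ℝ}
    (h : IsLyapunovPair B G) (hneg : ∀ a b, a ≠ b → G a b ≤ 0) {par : Fin (n + 1) → Fin (n + 1)}
    (hpar : ∀ a, a ≠ Fin.last n → a < par a)
    (hG : ∀ a b, a < b → (G a b ≠ 0 ↔ b = par a)) (s : Fin (n + 1)) :
    IsTreePotential par (fun a => -G a (par a)) (fun b => forwardGram G s b) s
      (1 / ((n : ℝ) + 1) ^ 2) where
  lt_par := hpar
  pos a ha := neg_pos.mpr (lt_of_le_of_ne (hneg a _ (hpar a ha).ne) ((hG a _ (hpar a ha)).mpr rfl))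
  inject_pos := by positivity
  conserve a ha := by
    set φ : Fin (n + 1) → ℝ := fun b => forwardGram G s b with hφ
    have h1 : ∑ b, G a b * φ b = if a = s then 1 / ((n : ℝ) + 1) ^ 2 else 0 := by
      have h2 : G * forwardGram G = (1 / ((n : ℝ) + 1) ^ 2) • (1 : Matrix _ _ ℝ) := by
        rw [forwardGram, Matrix.mul_smul, Matrix.mul_nonsing_inv G h.isUnit_det]
      have h3 := congrFun (congrFun h2 a) s
      rw [Matrix.mul_apply, Matrix.smul_apply, Matrix.one_apply] at h3
      simp only [hφ, h.forwardGram_symm s]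
      rw [h3]
      simp
    have h4 : ∑ b, G a b * (φ b - φ a) = if a = s then 1 / ((n : ℝ) + 1) ^ 2 else 0 := by
      simp only [mul_sub, Finset.sum_sub_distrib, ← Finset.sum_mul, h.sum_row, h1, if_neg ha]
      simp
    have hzero : ∀ b, b ≠ par a → ¬(b < a ∧ par b = a) → G a b * (φ b - φ a) = 0 := by
      intro b hb1 hb2
      rcases lt_trichotomy a b with hab | rfl | hab
      · have : G a b = 0 := by
          by_contra hne
          exact hb1 ((hG a b hab).mp hne)
        rw [this, zero_mul]
      · rw [sub_self, mul_zero]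
      · have : G b a = 0 := by
          by_contra hne
          exact hb2 ⟨hab, ((hG b a hab).mp hne).symm⟩
        rw [h.symm, this, zero_mul]
    have h5 : ∑ b, G a b * (φ b - φ a) = G a (par a) * (φ (par a) - φ a) +
        ∑ b ∈ Finset.univ.filter (fun b => b < a ∧ par b = a), G a b * (φ b - φ a) := by
      have hnot : par a ∉ Finset.univ.filter (fun b => b < a ∧ par b = a) := fun hmem =>
        absurd (Finset.mem_filter.mp hmem).2.1 (not_lt.mpr (hpar a ha).le)
      rw [← Finset.sum_insert (f := fun b => G a b * (φ b - φ a)) hnot]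
      refine (Finset.sum_subset (Finset.subset_univ _) fun b _ hb => ?_).symm
      rw [Finset.mem_insert, not_or] at hb
      exact hzero b hb.1 fun hb' => hb.2 (Finset.mem_filter.mpr ⟨Finset.mem_univ b, hb'⟩)
    have h6 : ∑ b ∈ Finset.univ.filter (fun b => b < a ∧ par b = a), G a b * (φ b - φ a) =
        -∑ b ∈ Finset.univ.filter (fun b => b < a ∧ par b = a),
          -G b (par b) * (φ b - φ (par b)) := by
      rw [← Finset.sum_neg_distrib]
      refine Finset.sum_congr rfl fun b hb => ?_
      rw [(Finset.mem_filter.mp hb).2.2, h.symm a b]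
      ring
    rw [h5, h6] at h4
    linarith

/-- An optimal matrix with an arc diagram whose H-dual is optimal has a non-crossing diagram: at a
crossing, `IsTreePotential.lt_of_crossing` contradicts `forwardGram_antitone`. -/
theorem nonCrossing_of_hDual_mem {n : ℕ} {H : Matrix (Fin n) (Fin n) ℝ} (hH : H ∈ optimalH n)
    (harc : IsArcDiagram (algDiagram H)) (hdual : hDual H ∈ optimalH n) :
    NonCrossing (algDiagram H) := by
  rintro ⟨j₁, j₂, k₁, k₂, h1, h2, h12, h2k, hkk⟩
  have hinv := isInvariantH_of_mem_optimalH hH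
  choose p hp hpu using harc
  let par : Fin (n + 1) → Fin (n + 1) := Fin.snoc (α := fun _ => Fin (n + 1)) p (Fin.last n)
  have hparc : ∀ j : Fin n, par j.castSucc = p j := fun j => Fin.snoc_castSucc _ _ _
  have hpar : ∀ a, a ≠ Fin.last n → a < par a := by
    intro a ha
    obtain ⟨j, rfl⟩ := Fin.exists_castSucc_eq.mpr ha
    rw [hparc]
    exact (hp j).1
  have hG : ∀ a b, a < b → (resGram H a b ≠ 0 ↔ b = par a) := by
    intro a b hab
    obtain ⟨j, rfl⟩ := Fin.exists_castSucc_eq.mpr (ne_of_lt (hab.trans_le (Fin.le_last b)))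
    rw [hparc]
    constructor
    · intro hne
      exact hpu j b ⟨hab, (algDiagram_adj H _ _).mpr ⟨hab.ne, hne⟩⟩
    · rintro rfl
      exact ((algDiagram_adj H _ _).mp (hp j).2).2
  have hpot := forwardGram_isTreePotential hinv.isLyapunovPair
    (fun a b hab => resGram_nonpos_of_mem_optimalH hH hab) hpar hG j₁
  have e1 : k₁ = par j₁ := (hG _ _ (h12.trans h2k)).mp ((algDiagram_adj H _ _).mp h1).2
  have e2 : k₂ = par j₂ := (hG _ _ (h2k.trans hkk)).mp ((algDiagram_adj H _ _).mp h2).2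
  have hlt := hpot.lt_of_crossing h12 (e1 ▸ h2k) (e1 ▸ e2 ▸ hkk)
  have hle := forwardGram_antitone hinv hdual h12.le (e1 ▸ h2k).le
  exact absurd hlt (not_lt.mpr hle)

/-! ### Indices and diagrams of a gluing -/

/-- The node of a gluing corresponding to a node of the left part. -/
def leftNode {a : ℕ} (b : ℕ) (i : Fin (a + 1)) : Fin (a + 1 + b + 1) := Fin.castAdd (b + 1) i

/-- The node of a gluing corresponding to a node of the right part. -/
def rightNode (a : ℕ) {b : ℕ} (k : Fin (b + 1)) : Fin (a + 1 + b + 1) := Fin.natAdd (a + 1) k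

@[simp] theorem val_leftNode {a : ℕ} (b : ℕ) (i : Fin (a + 1)) : (leftNode b i : ℕ) = i := rfl

@[simp] theorem val_rightNode (a : ℕ) {b : ℕ} (k : Fin (b + 1)) :
    (rightNode a k : ℕ) = a + 1 + k := rfl

theorem leftNode_injective {a : ℕ} (b : ℕ) : Function.Injective (leftNode (a := a) b) :=
  fun i j h => Fin.ext (show ((leftNode b i : ℕ) = leftNode b j) by rw [h])

theorem rightNode_injective (a : ℕ) {b : ℕ} : Function.Injective (rightNode a (b := b)) :=
  fun k l h => Fin.ext (by have := congrArg Fin.val h; simp at this; omega)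

@[simp] theorem leftNode_inj {a b : ℕ} {i j : Fin (a + 1)} : leftNode b i = leftNode b j ↔ i = j :=
  (leftNode_injective b).eq_iff

@[simp] theorem rightNode_inj {a b : ℕ} {k l : Fin (b + 1)} :
    rightNode a k = rightNode a l ↔ k = l :=
  (rightNode_injective a).eq_iff

@[simp] theorem leftNode_le {a b : ℕ} {i j : Fin (a + 1)} :
    leftNode b i ≤ leftNode b j ↔ i ≤ j := Iff.rfl

@[simp] theorem leftNode_lt {a b : ℕ} {i j : Fin (a + 1)} :
    leftNode b i < leftNode b j ↔ i < j := Iff.rfl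

@[simp] theorem rightNode_le {a b : ℕ} {k l : Fin (b + 1)} :
    rightNode a k ≤ rightNode a l ↔ k ≤ l := by
  rw [Fin.le_def, Fin.le_def, val_rightNode, val_rightNode, add_le_add_iff_left]

@[simp] theorem rightNode_lt {a b : ℕ} {k l : Fin (b + 1)} :
    rightNode a k < rightNode a l ↔ k < l := by
  rw [Fin.lt_def, Fin.lt_def, val_rightNode, val_rightNode, add_lt_add_iff_left]

theorem leftNode_lt_rightNode {a b : ℕ} (i : Fin (a + 1)) (k : Fin (b + 1)) :
    leftNode b i < rightNode a k := by
  rw [Fin.lt_def, val_leftNode, val_rightNode]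
  omega

@[simp] theorem leftNode_ne_rightNode {a b : ℕ} (i : Fin (a + 1)) (k : Fin (b + 1)) :
    leftNode b i ≠ rightNode a k := (leftNode_lt_rightNode i k).ne

@[simp] theorem rightNode_ne_leftNode {a b : ℕ} (i : Fin (a + 1)) (k : Fin (b + 1)) :
    rightNode a k ≠ leftNode b i := (leftNode_lt_rightNode i k).ne'

@[simp] theorem rightNode_last (a b : ℕ) : rightNode a (Fin.last b) = Fin.last (a + 1 + b) := rfl

theorem last_eq_rightNode (a b : ℕ) : Fin.last (a + 1 + b) = rightNode a (Fin.last b) := rfl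

theorem eq_leftNode_or_rightNode {a b : ℕ} (x : Fin (a + 1 + b + 1)) :
    (∃ i, x = leftNode b i) ∨ ∃ k, x = rightNode a k := by
  by_cases h : (x : ℕ) < a + 1
  · exact Or.inl ⟨⟨x, h⟩, rfl⟩
  · exact Or.inr ⟨⟨x - (a + 1), by omega⟩, Fin.ext (by simp; omega)⟩

theorem sum_nodes {a b : ℕ} {M : Type*} [AddCommMonoid M] (f : Fin (a + 1 + b + 1) → M) :
    ∑ x, f x = ∑ i, f (leftNode b i) + ∑ k, f (rightNode a k) :=
  Fin.sum_univ_add (a := a + 1) (b := b + 1) f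

section GlueDiagram

variable {a b : ℕ} (G₁ : SimpleGraph (Fin (a + 1))) (G₂ : SimpleGraph (Fin (b + 1)))

theorem glueDiagram_adj (x y : Fin (a + 1 + b + 1)) : (glueDiagram G₁ G₂).Adj x y ↔
    ((∃ i j, G₁.Adj i j ∧ leftNode b i = x ∧ leftNode b j = y) ∨
      ∃ k l, G₂.Adj k l ∧ rightNode a k = x ∧ rightNode a l = y) ∨
      (x = leftNode b (Fin.last a) ∧ y = rightNode a (Fin.last b) ∨
        x = rightNode a (Fin.last b) ∧ y = leftNode b (Fin.last a)) := by
  have h : Fin.castAdd (b + 1) (Fin.last a) ≠ Fin.last (a + 1 + b) :=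
    leftNode_ne_rightNode (Fin.last a) (Fin.last b)
  simp only [glueDiagram, SimpleGraph.sup_adj, SimpleGraph.map_adj, SimpleGraph.edge_adj]
  refine or_congr Iff.rfl ?_
  constructor
  · rintro ⟨h1, -⟩
    exact h1
  · intro h1
    refine ⟨h1, ?_⟩
    rintro rfl
    rcases h1 with h1 | h1
    · exact h (h1.1.symm.trans h1.2)
    · exact h (h1.2.symm.trans h1.1)

@[simp] theorem glueDiagram_adj_left (i j : Fin (a + 1)) :
    (glueDiagram G₁ G₂).Adj (leftNode b i) (leftNode b j) ↔ G₁.Adj i j := by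
  rw [glueDiagram_adj]
  simp [-rightNode_last]

@[simp] theorem glueDiagram_adj_right (k l : Fin (b + 1)) :
    (glueDiagram G₁ G₂).Adj (rightNode a k) (rightNode a l) ↔ G₂.Adj k l := by
  rw [glueDiagram_adj]
  simp [-rightNode_last]

@[simp] theorem glueDiagram_adj_left_right (i : Fin (a + 1)) (k : Fin (b + 1)) :
    (glueDiagram G₁ G₂).Adj (leftNode b i) (rightNode a k) ↔ i = Fin.last a ∧ k = Fin.last b := by
  rw [glueDiagram_adj]
  simp [-rightNode_last]

@[simp] theorem glueDiagram_adj_right_left (i : Fin (a + 1)) (k : Fin (b + 1)) :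
    (glueDiagram G₁ G₂).Adj (rightNode a k) (leftNode b i) ↔ i = Fin.last a ∧ k = Fin.last b := by
  rw [SimpleGraph.adj_comm, glueDiagram_adj_left_right]

end GlueDiagram

/-! ### A non-crossing diagram determines the matrix -/

theorem StrictLower.pow_apply_eq_zero {m : ℕ} {X : Matrix (Fin m) (Fin m) ℝ} (hX : StrictLower X) :
    ∀ (k : ℕ) (a b : Fin m), (a : ℕ) < b + k → (X ^ k) a b = 0 := by
  intro k
  induction k with
  | zero =>
    intro a b h
    rw [pow_zero, Matrix.one_apply_ne]
    rintro rfl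
    omega
  | succ k ih =>
    intro a b h
    rw [pow_succ, Matrix.mul_apply]
    refine Finset.sum_eq_zero fun c _ => ?_
    by_cases hc : c ≤ b
    · rw [hX c b hc, mul_zero]
    · rw [ih a c, zero_mul]
      rw [not_le, Fin.lt_def] at hc
      omega

/-- The Gram matrix determines the triangular matrix: the difference of two solutions is nilpotent
and skew-adjoint for the inner product given by `G`. -/
theorem IsLyapunovPair.left_unique {n : ℕ} {B B' G : Matrix (Fin (n + 1)) (Fin (n + 1)) ℝ}
    (h : IsLyapunovPair B G) (h' : IsLyapunovPair B' G) : B = B' := by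
  rw [← sub_eq_zero]
  set X := B - B' with hX
  have hlow : StrictLower X := fun a b hab => by
    rw [hX, Matrix.sub_apply, h.lower a b hab, h'.lower a b hab, sub_zero]
  have hskew : X.transpose * G = -(G * X) := by
    have h1 := h.lyapunov.trans h'.lyapunov.symm
    rw [← sub_eq_zero] at h1
    rw [hX, Matrix.transpose_sub, Matrix.sub_mul, Matrix.mul_sub, ← sub_eq_zero, ← h1]
    abel
  have hpow : ∀ k : ℕ, (X ^ k).transpose * G = (-1 : ℝ) ^ k • (G * X ^ k) := by
    intro k
    induction k with
    | zero => simp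
    | succ k ih =>
      rw [pow_succ', Matrix.transpose_mul, Matrix.mul_assoc, hskew, Matrix.mul_neg,
        ← Matrix.mul_assoc, ih, Matrix.smul_mul, Matrix.mul_assoc, ← pow_succ, pow_succ', pow_succ']
      simp
  -- the Gram matrix of the columns of `X ^ (m + 1)` with respect to `G` is `± G X ^ (2 m + 2)`
  have hdesc : ∀ m : ℕ, X ^ (m + 2) = 0 → X ^ (m + 1) = 0 := by
    intro m hm
    have h1 : (X ^ (m + 1)).transpose * G * X ^ (m + 1) = 0 := by
      rw [hpow, Matrix.smul_mul, Matrix.mul_assoc, ← pow_add X,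
        show m + 1 + (m + 1) = (m + 2) + m by ring, pow_add X, hm, Matrix.zero_mul, Matrix.mul_zero,
        smul_zero]
    ext a b
    rw [Matrix.zero_apply]
    by_contra hne
    have hcol : (X ^ (m + 1)).col b ≠ 0 := fun h0 => hne (congrFun h0 a)
    have h2 := h.posDef.dotProduct_mulVec_pos hcol
    have h3 : star ((X ^ (m + 1)).col b) ⬝ᵥ G.mulVec ((X ^ (m + 1)).col b) =
        ((X ^ (m + 1)).transpose * G * X ^ (m + 1)) b b := by
      rw [Matrix.mul_assoc]
      simp only [dotProduct, Matrix.mulVec, Matrix.mul_apply, Matrix.transpose_apply,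
        Matrix.col_apply, star_trivial]
    rw [h3, h1, Matrix.zero_apply] at h2
    exact lt_irrefl _ h2
  have hone : ∀ m : ℕ, X ^ (m + 1) = 0 → X = 0 := by
    intro m
    induction m with
    | zero => simp
    | succ m ih => exact fun hm => ih (hdesc m hm)
  refine hone n ?_
  ext a b
  exact hlow.pow_apply_eq_zero (n + 1) a b (by omega)

theorem cumMat_injective {n : ℕ} : Function.Injective (cumMat (n := n)) := by
  intro H H' h
  ext i j
  have h1 := cumMat_succ_sub H i j.castSucc
  have h2 := cumMat_succ_sub H' i j.castSucc
  rw [h, Fin.snoc_castSucc] at h1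
  rw [Fin.snoc_castSucc] at h2
  linarith

/-- The sum of all entries of the Lyapunov equation. -/
theorem IsLyapunovPair.sum_last_row {n : ℕ} {B G : Matrix (Fin (n + 1)) (Fin (n + 1)) ℝ}
    (h : IsLyapunovPair B G) : ∑ k, B (Fin.last n) k = (n : ℝ) / 2 := by
  have hn : (0 : ℝ) < (n : ℝ) + 1 := by positivity
  have hcol : ∀ c, ∑ a, G a c = if c = Fin.last n then 1 / ((n : ℝ) + 1) else 0 := by
    intro c
    rw [← h.sum_row c]
    exact Finset.sum_congr rfl fun a _ => h.symm a c
  have h1 : ∑ a, ∑ b, (G * B) a b = 1 / ((n : ℝ) + 1) * ∑ k, B (Fin.last n) k := by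
    simp only [Matrix.mul_apply]
    rw [Finset.sum_comm]
    have : ∀ b, ∑ a, ∑ c, G a c * B c b = 1 / ((n : ℝ) + 1) * B (Fin.last n) b := by
      intro b
      rw [Finset.sum_comm]
      simp only [← Finset.sum_mul, hcol]
      simp
    simp only [this, Finset.mul_sum]
  have h2 : ∑ a, ∑ b, (B.transpose * G) a b = 1 / ((n : ℝ) + 1) * ∑ k, B (Fin.last n) k := by
    rw [← h1]
    refine Finset.sum_comm.trans
      (Finset.sum_congr rfl fun a _ => Finset.sum_congr rfl fun b _ => ?_)
    simp only [Matrix.mul_apply, Matrix.transpose_apply]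
    exact Finset.sum_congr rfl fun c _ => by rw [h.symm c a, mul_comm]
  have h3 : ∑ a, ∑ b, G a b = 1 / ((n : ℝ) + 1) := by
    simp [h.sum_row]
  have h4 : ∑ a, ∑ b, cornerMat n a b = 1 := by
    simp [cornerMat, Matrix.single_apply, ite_and]
  rw [← h.lyapunov] at h4
  simp only [Matrix.add_apply, Finset.sum_add_distrib, h1, h2, h3] at h4
  field_simp at h4
  linarith

/-- The last coordinate vector. -/
def lastVec (n : ℕ) : Fin (n + 1) → ℝ := Pi.single (Fin.last n) 1

@[simp] theorem lastVec_last (n : ℕ) : lastVec n (Fin.last n) = 1 := Pi.single_eq_same _ _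

theorem lastVec_of_ne {n : ℕ} {i : Fin (n + 1)} (h : i ≠ Fin.last n) : lastVec n i = 0 :=
  Pi.single_eq_of_ne h _

theorem lastVec_apply {n : ℕ} (i : Fin (n + 1)) :
    lastVec n i = if i = Fin.last n then 1 else 0 := Pi.single_apply _ _ _

@[simp] theorem sum_lastVec_mul {n : ℕ} (f : Fin (n + 1) → ℝ) :
    ∑ i, lastVec n i * f i = f (Fin.last n) := by
  simp [lastVec_apply]

@[simp] theorem sum_lastVec (n : ℕ) : ∑ i, lastVec n i = 1 := by
  simpa using sum_lastVec_mul (n := n) fun _ => 1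

@[simp] theorem lastVec_leftNode {a b : ℕ} (i : Fin (a + 1)) :
    lastVec (a + 1 + b) (leftNode b i) = 0 :=
  lastVec_of_ne (leftNode_ne_rightNode i (Fin.last b))

@[simp] theorem lastVec_rightNode {a b : ℕ} (k : Fin (b + 1)) :
    lastVec (a + 1 + b) (rightNode a k) = lastVec b k := by
  simp only [lastVec_apply, last_eq_rightNode, rightNode_inj]

theorem lastVec_mul_eq_zero {n : ℕ} {i j : Fin (n + 1)} (hij : i ≠ j) :
    lastVec n i * lastVec n j = 0 := by
  by_cases hi : i = Fin.last n
  · rw [lastVec_of_ne (i := j) (fun hj => hij (hi.trans hj.symm)), mul_zero]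
  · rw [lastVec_of_ne hi, zero_mul]

theorem cornerMat_apply {n : ℕ} (a b : Fin (n + 1)) :
    cornerMat n a b = lastVec n a * lastVec n b := by
  simp only [cornerMat, Matrix.single_apply, lastVec_apply, eq_comm (a := Fin.last n), mul_ite,
    mul_one, mul_zero]
  split_ifs <;> simp_all

/-- The Lyapunov equation in coordinates. -/
theorem lyapunov_iff {n : ℕ} {B G : Matrix (Fin (n + 1)) (Fin (n + 1)) ℝ} :
    G + G * B + B.transpose * G = cornerMat n ↔
      ∀ a b, G a b + ∑ c, G a c * B c b + ∑ c, B c a * G c b = lastVec n a * lastVec n b := by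
  rw [← Matrix.ext_iff]
  refine forall_congr' fun a => forall_congr' fun b => ?_
  rw [cornerMat_apply]
  simp only [Matrix.add_apply, Matrix.mul_apply, Matrix.transpose_apply]

theorem IsLyapunovPair.sum_row_eq {n : ℕ} {B G : Matrix (Fin (n + 1)) (Fin (n + 1)) ℝ}
    (h : IsLyapunovPair B G) (a : Fin (n + 1)) : ∑ b, G a b = lastVec n a / ((n : ℝ) + 1) := by
  rw [h.sum_row, lastVec_apply]
  split_ifs <;> simp

theorem IsLyapunovPair.sum_col_eq {n : ℕ} {B G : Matrix (Fin (n + 1)) (Fin (n + 1)) ℝ}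
    (h : IsLyapunovPair B G) (b : Fin (n + 1)) : ∑ a, G a b = lastVec n b / ((n : ℝ) + 1) := by
  rw [← h.sum_row_eq b]
  exact Finset.sum_congr rfl fun a _ => h.symm a b

/-- The left and right parts of a Lyapunov pair whose Gram matrix couples the two blocks of nodes
only through their last nodes. The left part is rescaled by the square of
`α = (a + 1) / (a + b + 2)` and loses the part of the corner entry that stems from the coupling. The
strength of the coupling is fixed by the trace identity for the right block. -/
theorem IsLyapunovPair.of_block {a b : ℕ}
    {B G : Matrix (Fin (a + 1 + b + 1)) (Fin (a + 1 + b + 1)) ℝ} (h : IsLyapunovPair B G)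
    (hG : ∀ (i : Fin (a + 1)) (k : Fin (b + 1)), ¬(i = Fin.last a ∧ k = Fin.last b) →
      G (leftNode b i) (rightNode a k) = 0) {α : ℝ} (hα : α = ((a : ℝ) + 1) / (a + b + 2)) :
    (∀ i k, G (leftNode b i) (rightNode a k) = -(α / (b + 1)) * (lastVec a i * lastVec b k)) ∧
    IsLyapunovPair (B.submatrix (rightNode a) (rightNode a))
      (G.submatrix (rightNode a) (rightNode a)) ∧
    IsLyapunovPair (B.submatrix (leftNode b) (leftNode b))
      ((α ^ 2)⁻¹ • G.submatrix (leftNode b) (leftNode b) - ((b : ℝ) + 1)⁻¹ • cornerMat a) := by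
  have hN : (0 : ℝ) < (a : ℝ) + b + 2 := by positivity
  have ha : (0 : ℝ) < (a : ℝ) + 1 := by positivity
  have hb : (0 : ℝ) < (b : ℝ) + 1 := by positivity
  have hα0 : 0 < α := hα ▸ div_pos ha hN
  obtain ⟨μ, hμ⟩ : ∃ μ : ℝ, ∀ i k, G (leftNode b i) (rightNode a k) =
      -(μ * (lastVec a i * lastVec b k)) := by
    refine ⟨-G (leftNode b (Fin.last a)) (rightNode a (Fin.last b)), fun i k => ?_⟩
    by_cases hik : i = Fin.last a ∧ k = Fin.last b
    · rw [hik.1, hik.2]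
      simp
    · rw [hG i k hik]
      rcases not_and_or.mp hik with h1 | h1 <;> simp [lastVec_of_ne h1]
  have hμ' : ∀ k i, G (rightNode a k) (leftNode b i) = -(μ * (lastVec a i * lastVec b k)) :=
    fun k i => (h.symm _ _).trans (hμ i k)
  have hlow : ∀ i k, B (leftNode b i) (rightNode a k) = 0 := fun i k =>
    h.lower _ _ (leftNode_lt_rightNode i k).le
  have hup : ∀ (i : Fin (b + 1)) c, rightNode a i ≤ c → c ∈ Set.range (rightNode a (b := b)) := by
    intro i c hc
    rcases eq_leftNode_or_rightNode c with ⟨j, rfl⟩ | ⟨k, rfl⟩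
    · exact absurd hc (leftNode_lt_rightNode j i).not_ge
    · exact ⟨k, rfl⟩
  -- row sums of the right block
  obtain ⟨r, hr⟩ : ∃ r : ℝ, r = ((a : ℝ) + b + 2)⁻¹ + μ := ⟨_, rfl⟩
  have hrow : ∀ k, ∑ l, G (rightNode a k) (rightNode a l) = r * lastVec b k := by
    intro k
    have h1 := h.sum_row_eq (rightNode a k)
    rw [sum_nodes] at h1
    simp only [hμ', lastVec_rightNode, Finset.sum_neg_distrib, ← Finset.mul_sum,
      ← Finset.sum_mul, sum_lastVec] at h1
    rw [hr]
    push_cast at h1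
    rw [show (a : ℝ) + 1 + b + 1 = a + b + 2 by ring, div_eq_mul_inv] at h1
    linarith
  have hcol : ∀ l, ∑ k, G (rightNode a k) (rightNode a l) = r * lastVec b l := fun l => by
    rw [← hrow l]
    exact Finset.sum_congr rfl fun k _ => h.symm _ _
  have hpos : (G.submatrix (rightNode a) (rightNode a)).PosDef :=
    h.posDef.submatrix (rightNode_injective a)
  have hr0 : 0 < r := by
    have h1 := hpos.dotProduct_mulVec_pos (x := fun _ : Fin (b + 1) => (1 : ℝ))
      (fun h0 => one_ne_zero (congrFun h0 0))
    simpa [dotProduct, Matrix.mulVec, hrow, ← Finset.mul_sum] using h1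
  have hr1 : r = ((b : ℝ) + 1)⁻¹ := by
    have h1 := h.dotProduct_eq_card (rightNode_injective a) hup (c := fun _ => r⁻¹) (by
      intro i
      rw [← Finset.sum_mul, hrow, last_eq_rightNode, lastVec_apply]
      simp only [rightNode_inj]
      split_ifs
      · field_simp
      · simp)
    simp only [last_eq_rightNode, rightNode_inj, Finset.sum_ite_eq', Finset.mem_univ, if_true,
      Fintype.card_fin] at h1
    rw [← inv_inv r, h1]
    push_cast
    rfl
  have hμα : μ = α / (b + 1) := by
    have : μ = ((b : ℝ) + 1)⁻¹ - ((a : ℝ) + b + 2)⁻¹ := by linarith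
    rw [this, hα]
    field_simp
    ring
  have hright : IsLyapunovPair (B.submatrix (rightNode a) (rightNode a))
      (G.submatrix (rightNode a) (rightNode a)) := by
    refine ⟨fun k l hkl => h.lower _ _ (rightNode_le.mpr hkl), ?_, hpos, fun k => ?_⟩
    · rw [h.submatrix_lyapunov (rightNode_injective a) hup]
      ext k l
      rw [Matrix.submatrix_apply, cornerMat_apply, cornerMat_apply, lastVec_rightNode,
        lastVec_rightNode]
    · simp only [Matrix.submatrix_apply]
      rw [hrow, hr1, lastVec_apply]
      split_ifs <;> simp
  refine ⟨fun i k => by rw [hμ, hμα, neg_mul], hright, ?_⟩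
  have hlyap := lyapunov_iff.mp h.lyapunov
  -- the part of the last row of the right block that acts on the left block
  have hβ : ∀ j, B (rightNode a (Fin.last b)) (leftNode b j) =
      α * (lastVec a j * (1 + b / 2) + B (leftNode b (Fin.last a)) (leftNode b j)) := by
    intro j
    have h1 : ∀ k, -(μ * (lastVec a j * lastVec b k)) -
        μ * (lastVec a j * B (rightNode a (Fin.last b)) (rightNode a k)) -
        μ * (B (leftNode b (Fin.last a)) (leftNode b j) * lastVec b k) +
        ∑ l, B (rightNode a l) (leftNode b j) * G (rightNode a l) (rightNode a k) = 0 := by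
      intro k
      have h2 := hlyap (leftNode b j) (rightNode a k)
      rw [sum_nodes, sum_nodes] at h2
      simp only [hμ, hlow, lastVec_leftNode, mul_zero, zero_mul, Finset.sum_const_zero,
        zero_add] at h2
      have h3 : ∑ l, -(μ * (lastVec a j * lastVec b l)) * B (rightNode a l) (rightNode a k) =
          -(μ * (lastVec a j * B (rightNode a (Fin.last b)) (rightNode a k))) := by
        rw [← sum_lastVec_mul (fun l => B (rightNode a l) (rightNode a k)), Finset.mul_sum,
          Finset.mul_sum, ← Finset.sum_neg_distrib]
        exact Finset.sum_congr rfl fun l _ => by ring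
      have h4 : ∑ i, B (leftNode b i) (leftNode b j) * -(μ * (lastVec a i * lastVec b k)) =
          -(μ * (B (leftNode b (Fin.last a)) (leftNode b j) * lastVec b k)) := by
        rw [← sum_lastVec_mul (fun i => B (leftNode b i) (leftNode b j)), Finset.sum_mul,
          Finset.mul_sum, ← Finset.sum_neg_distrib]
        exact Finset.sum_congr rfl fun l _ => by ring
      rw [h3, h4] at h2
      linarith
    have h5 := Finset.sum_eq_zero (s := Finset.univ) fun k _ => h1 k
    have h6 := hright.sum_last_row
    simp only [Matrix.submatrix_apply] at h6
    simp only [Finset.sum_add_distrib, Finset.sum_sub_distrib, Finset.sum_neg_distrib,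
      ← Finset.mul_sum, sum_lastVec, h6] at h5
    rw [Finset.sum_comm] at h5
    have h7 : ∑ l, B (rightNode a l) (leftNode b j) * (r * lastVec b l) =
        r * B (rightNode a (Fin.last b)) (leftNode b j) := by
      rw [← sum_lastVec_mul (fun l => B (rightNode a l) (leftNode b j)), Finset.mul_sum]
      exact Finset.sum_congr rfl fun l _ => by ring
    simp only [← Finset.mul_sum, hrow] at h5
    rw [h7, hr1, hμα] at h5
    field_simp at h5
    field_simp
    linarith
  have hG1 : ∀ i j, ((α ^ 2)⁻¹ • G.submatrix (leftNode b) (leftNode b) -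
      ((b : ℝ) + 1)⁻¹ • cornerMat a) i j =
      (α ^ 2)⁻¹ * G (leftNode b i) (leftNode b j) -
        ((b : ℝ) + 1)⁻¹ * (lastVec a i * lastVec a j) := fun i j => by
    rw [← cornerMat_apply, Matrix.sub_apply, Matrix.smul_apply, Matrix.smul_apply,
      Matrix.submatrix_apply, smul_eq_mul, smul_eq_mul]
  have hrow1 : ∀ i, ∑ j, G (leftNode b i) (leftNode b j) = μ * lastVec a i := by
    intro i
    have h1 := h.sum_row_eq (leftNode b i)
    rw [sum_nodes] at h1
    simp only [hμ, lastVec_leftNode, Finset.sum_neg_distrib, ← Finset.mul_sum, sum_lastVec,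
      zero_div, mul_one] at h1
    linarith
  refine ⟨fun i j hij => h.lower _ _ hij, ?_, ?_, ?_⟩
  · rw [lyapunov_iff]
    intro i j
    have h2 := hlyap (leftNode b i) (leftNode b j)
    rw [sum_nodes, sum_nodes] at h2
    simp only [hμ, hμ', lastVec_leftNode, zero_mul] at h2
    have h3 : ∑ k, -(μ * (lastVec a i * lastVec b k)) * B (rightNode a k) (leftNode b j) =
        -(μ * (lastVec a i * B (rightNode a (Fin.last b)) (leftNode b j))) := by
      rw [← sum_lastVec_mul (fun k => B (rightNode a k) (leftNode b j)), Finset.mul_sum,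
        Finset.mul_sum, ← Finset.sum_neg_distrib]
      exact Finset.sum_congr rfl fun l _ => by ring
    have h4 : ∑ k, B (rightNode a k) (leftNode b i) * -(μ * (lastVec a j * lastVec b k)) =
        -(μ * (B (rightNode a (Fin.last b)) (leftNode b i) * lastVec a j)) := by
      rw [← sum_lastVec_mul (fun k => B (rightNode a k) (leftNode b i)), Finset.sum_mul,
        Finset.mul_sum, ← Finset.sum_neg_distrib]
      exact Finset.sum_congr rfl fun l _ => by ring
    rw [h3, h4, hβ, hβ, hμα] at h2
    have h5 : ∑ c, ((α ^ 2)⁻¹ * G (leftNode b i) (leftNode b c) -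
        ((b : ℝ) + 1)⁻¹ * (lastVec a i * lastVec a c)) * B (leftNode b c) (leftNode b j) =
        (α ^ 2)⁻¹ * ∑ c, G (leftNode b i) (leftNode b c) * B (leftNode b c) (leftNode b j) -
        ((b : ℝ) + 1)⁻¹ * (lastVec a i * B (leftNode b (Fin.last a)) (leftNode b j)) := by
      rw [← sum_lastVec_mul (fun c => B (leftNode b c) (leftNode b j)), Finset.mul_sum,
        Finset.mul_sum, Finset.mul_sum, ← Finset.sum_sub_distrib]
      exact Finset.sum_congr rfl fun l _ => by ring
    have h6 : ∑ c, B (leftNode b c) (leftNode b i) * ((α ^ 2)⁻¹ * G (leftNode b c) (leftNode b j) -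
        ((b : ℝ) + 1)⁻¹ * (lastVec a c * lastVec a j)) =
        (α ^ 2)⁻¹ * ∑ c, B (leftNode b c) (leftNode b i) * G (leftNode b c) (leftNode b j) -
        ((b : ℝ) + 1)⁻¹ * (B (leftNode b (Fin.last a)) (leftNode b i) * lastVec a j) := by
      rw [← sum_lastVec_mul (fun c => B (leftNode b c) (leftNode b i)), Finset.sum_mul,
        Finset.mul_sum, Finset.mul_sum, ← Finset.sum_sub_distrib]
      exact Finset.sum_congr rfl fun l _ => by ring
    simp only [hG1, Matrix.submatrix_apply]
    rw [h5, h6]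
    field_simp at h2
    field_simp
    linarith
  · refine Matrix.PosDef.of_dotProduct_mulVec_pos ?_ fun x hx => ?_
    · rw [Matrix.IsHermitian, Matrix.conjTranspose_eq_transpose_of_trivial]
      ext i j
      rw [Matrix.transpose_apply, hG1, hG1, h.symm, mul_comm (lastVec a i)]
    · -- extend `x` to the right block by the constant that minimises the quadratic form
      obtain ⟨X, hXl, hXr⟩ : ∃ X : Fin (a + 1 + b + 1) → ℝ, (∀ i, X (leftNode b i) = x i) ∧
          ∀ k, X (rightNode a k) = α * x (Fin.last a) :=
        ⟨Fin.append (m := a + 1) (n := b + 1) x fun _ => α * x (Fin.last a),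
          fun i => Fin.append_left _ _ i, fun k => Fin.append_right _ _ k⟩
      have hX : X ≠ 0 := by
        rintro rfl
        exact hx (funext fun i => (hXl i).symm)
      have h1 := h.posDef.dotProduct_mulVec_pos hX
      have h2 : ∀ i, ∑ k, G (leftNode b i) (rightNode a k) = -(μ * lastVec a i) := fun i => by
        simp only [hμ, Finset.sum_neg_distrib, ← Finset.mul_sum, sum_lastVec, mul_one]
      have h3 : ∀ k, ∑ i, G (rightNode a k) (leftNode b i) * x i =
          -(μ * x (Fin.last a)) * lastVec b k := fun k => by
        rw [← sum_lastVec_mul x, Finset.mul_sum, ← Finset.sum_neg_distrib, Finset.sum_mul]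
        exact Finset.sum_congr rfl fun i _ => by rw [hμ']; ring
      have h4 : ∑ i, x i * (-(μ * lastVec a i) * (α * x (Fin.last a))) =
          -(μ * α) * x (Fin.last a) * x (Fin.last a) := by
        refine Eq.trans ?_ (sum_lastVec_mul fun i => -(μ * α) * x i * x (Fin.last a))
        exact Finset.sum_congr rfl fun i _ => by ring
      have h5 : ∑ i, x i * ∑ j, ((α ^ 2)⁻¹ * G (leftNode b i) (leftNode b j) -
          ((b : ℝ) + 1)⁻¹ * (lastVec a i * lastVec a j)) * x j =
          (α ^ 2)⁻¹ * ∑ i, x i * ∑ j, G (leftNode b i) (leftNode b j) * x j -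
          ((b : ℝ) + 1)⁻¹ * (x (Fin.last a) * x (Fin.last a)) := by
        conv_rhs => rw [← sum_lastVec_mul x, Finset.sum_mul_sum]
        simp only [Finset.mul_sum, ← Finset.sum_sub_distrib]
        exact Finset.sum_congr rfl fun i _ => Finset.sum_congr rfl fun j _ => by ring
      simp only [dotProduct, Matrix.mulVec, star_trivial, sum_nodes, hXl, hXr, ← Finset.sum_mul,
        h2, h3, hrow, mul_add, Finset.sum_add_distrib, h4] at h1
      simp only [dotProduct, Matrix.mulVec, star_trivial, hG1, h5]
      simp only [← Finset.mul_sum, ← Finset.sum_mul, sum_lastVec, hr1, hμα] at h1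
      have h6 : (α ^ 2)⁻¹ * (∑ i, x i * ∑ j, G (leftNode b i) (leftNode b j) * x j) -
          ((b : ℝ) + 1)⁻¹ * (x (Fin.last a) * x (Fin.last a)) =
          (α ^ 2)⁻¹ * ((∑ i, x i * ∑ j, G (leftNode b i) (leftNode b j) * x j) -
            α ^ 2 * ((b : ℝ) + 1)⁻¹ * (x (Fin.last a) * x (Fin.last a))) := by
        field_simp
      rw [h6]
      refine mul_pos (by positivity) ?_
      refine h1.trans_eq ?_
      field_simp
      ring
  · intro i
    simp only [hG1, Finset.sum_sub_distrib, ← Finset.mul_sum, hrow1, sum_lastVec, hμα]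
    rw [lastVec_apply]
    split_ifs
    · rw [hα]
      field_simp
      ring
    · simp

/-- Two Lyapunov pairs supported on the same basic diagram have the same Gram matrix. -/
theorem IsBasicDiagram.gram_unique {n : ℕ} {D : SimpleGraph (Fin (n + 1))} (hD : IsBasicDiagram D) :
    ∀ {B B' G G' : Matrix (Fin (n + 1)) (Fin (n + 1)) ℝ}, IsLyapunovPair B G →
      IsLyapunovPair B' G' → (∀ x y, x ≠ y → ¬D.Adj x y → G x y = 0) →
      (∀ x y, x ≠ y → ¬D.Adj x y → G' x y = 0) → G = G' := by
  induction hD with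
  | single D =>
    intro B B' G G' h h' _ _
    ext x y
    have h1 := h.sum_row x
    have h2 := h'.sum_row x
    rw [Fin.sum_univ_one] at h1 h2
    rw [show y = 0 from Subsingleton.elim (α := Fin 1) y 0, h1, h2]
  | @glue a b D₁ D₂ _ _ ih₁ ih₂ =>
    intro B B' G G' h h' hG hG'
    have hcross : ∀ M : Matrix (Fin (a + 1 + b + 1)) (Fin (a + 1 + b + 1)) ℝ,
        (∀ x y, x ≠ y → ¬(glueDiagram D₁ D₂).Adj x y → M x y = 0) →
        ∀ (i : Fin (a + 1)) (k : Fin (b + 1)), ¬(i = Fin.last a ∧ k = Fin.last b) →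
        M (leftNode b i) (rightNode a k) = 0 := fun M hM i k hik =>
      hM _ _ (leftNode_ne_rightNode i k) (by rwa [glueDiagram_adj_left_right])
    obtain ⟨α, hα⟩ : ∃ α : ℝ, α = ((a : ℝ) + 1) / (a + b + 2) := ⟨_, rfl⟩
    have hα0 : α ≠ 0 := by rw [hα]; positivity
    obtain ⟨h1, h2, h3⟩ := h.of_block (hcross G hG) hα
    obtain ⟨h1', h2', h3'⟩ := h'.of_block (hcross G' hG') hα
    have hleft : ∀ M : Matrix (Fin (a + 1 + b + 1)) (Fin (a + 1 + b + 1)) ℝ,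
        (∀ x y, x ≠ y → ¬(glueDiagram D₁ D₂).Adj x y → M x y = 0) →
        ∀ i j, i ≠ j → ¬D₁.Adj i j → ((α ^ 2)⁻¹ • M.submatrix (leftNode b) (leftNode b) -
          ((b : ℝ) + 1)⁻¹ • cornerMat a) i j = 0 := by
      intro M hM i j hij hadj
      rw [Matrix.sub_apply, Matrix.smul_apply, Matrix.smul_apply, cornerMat_apply,
        lastVec_mul_eq_zero hij, Matrix.submatrix_apply, hM _ _ (fun h => hij (leftNode_inj.mp h))
          (by rwa [glueDiagram_adj_left])]
      simp
    have hright : ∀ M : Matrix (Fin (a + 1 + b + 1)) (Fin (a + 1 + b + 1)) ℝ,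
        (∀ x y, x ≠ y → ¬(glueDiagram D₁ D₂).Adj x y → M x y = 0) →
        ∀ k l, k ≠ l → ¬D₂.Adj k l → M.submatrix (rightNode a) (rightNode a) k l = 0 :=
      fun M hM k l hkl hadj => hM _ _ (fun h => hkl (rightNode_inj.mp h))
        (by rwa [glueDiagram_adj_right])
    have e1 := ih₁ h3 h3' (hleft G hG) (hleft G' hG')
    have e2 := ih₂ h2 h2' (hright G hG) (hright G' hG')
    rw [sub_left_inj] at e1
    have e1' := smul_right_injective _ (inv_ne_zero (pow_ne_zero 2 hα0)) e1
    ext x y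
    rcases eq_leftNode_or_rightNode x with ⟨i, rfl⟩ | ⟨k, rfl⟩ <;>
      rcases eq_leftNode_or_rightNode y with ⟨j, rfl⟩ | ⟨l, rfl⟩
    · exact congrFun (congrFun e1' i) j
    · rw [h1, h1']
    · rw [h.symm, h'.symm, h1, h1']
    · exact congrFun (congrFun e2 k) l

/-! ### Gluing of H-matrices -/

theorem castSucc_natAdd (a : ℕ) {b : ℕ} (k : Fin b) :
    (Fin.natAdd (a + 1) k).castSucc = rightNode a k.castSucc := rfl

theorem castSucc_castAdd {a : ℕ} (b : ℕ) (i : Fin (a + 1)) :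
    (Fin.castAdd b i).castSucc = leftNode b i := rfl

section Trailing

variable {a b : ℕ} {H : Matrix (Fin (a + 1 + b)) (Fin (a + 1 + b)) ℝ}
  {H₂ : Matrix (Fin b) (Fin b) ℝ}

theorem cumMat_rightNode_rightNode (hH : ∀ i j, i < j → H i j = 0)
    (hR : ∀ i j, H (Fin.natAdd (a + 1) i) (Fin.natAdd (a + 1) j) = H₂ i j) (k l : Fin (b + 1)) :
    cumMat H (rightNode a k) (rightNode a l) = cumMat H₂ k l := by
  cases l using Fin.lastCases with
  | last => rw [rightNode_last, cumMat_last, cumMat_last]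
  | cast l =>
    rw [← castSucc_natAdd, cumMat_castSucc, cumMat_castSucc, Fin.sum_univ_add]
    rw [Finset.sum_eq_zero, zero_add]
    · simp only [castSucc_natAdd, rightNode_lt, hR]
    · intro i _
      rw [hH _ _ (show Fin.castAdd b i < Fin.natAdd (a + 1) l from
        leftNode_lt_rightNode i l.castSucc), ite_self]

/-- The residual polynomials of the nodes in the right block only depend on the right block. -/
theorem resPoly_rightNode (hH : ∀ i j, i < j → H i j = 0) (hH₂ : ∀ i j, i < j → H₂ i j = 0)
    (hR : ∀ i j, H (Fin.natAdd (a + 1) i) (Fin.natAdd (a + 1) j) = H₂ i j) (k : Fin (b + 1)) :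
    resPoly H (rightNode a k) = resPoly H₂ k := by
  induction k using WellFoundedGT.induction with
  | ind k ih =>
    rw [resPoly_rec hH, resPoly_rec hH₂, sum_nodes]
    congr 1
    · simp only [last_eq_rightNode, rightNode_inj]
    congr 1
    rw [Finset.sum_eq_zero, zero_add]
    · refine Finset.sum_congr rfl fun l _ => ?_
      rw [cumMat_rightNode_rightNode hH hR]
      by_cases hl : k < l
      · rw [ih l hl]
      · rw [cumMat_strictLower hH₂ l k (not_lt.mp hl), zero_smul, zero_smul]
    · intro i _
      rw [cumMat_strictLower hH _ _ (leftNode_lt_rightNode i k).le, zero_smul]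

end Trailing

/-- The explicit gluing of two H-matrices. Its column `N'` is, below the diagonal, a multiple of the
row sums of the right block, just as its row `N'` is a multiple of the column sums of the left
block. -/
noncomputable def glueMatrix {a b : ℕ} (H₁ : Matrix (Fin a) (Fin a) ℝ)
    (H₂ : Matrix (Fin b) (Fin b) ℝ) : Matrix (Fin (a + 1 + b)) (Fin (a + 1 + b)) ℝ :=
  Fin.append (α := Fin (a + 1 + b) → ℝ)
    (Fin.snoc (α := fun _ => Fin (a + 1 + b) → ℝ)
      (fun i => Fin.append (Fin.snoc (α := fun _ => ℝ) (H₁ i) 0) 0)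
      (Fin.append (Fin.snoc (α := fun _ => ℝ)
        (fun j => -(((b : ℝ) + 1) / (a + b + 2)) * ∑ k, H₁ k j)
        (((a : ℝ) + 1) * (b + 1) / (a + b + 2))) 0))
    (fun i => Fin.append (Fin.snoc (α := fun _ => ℝ) 0
      (-(((a : ℝ) + 1) / (a + b + 2)) * ∑ k, H₂ i k)) (H₂ i))

section GlueMatrix

variable {a b : ℕ} (H₁ : Matrix (Fin a) (Fin a) ℝ) (H₂ : Matrix (Fin b) (Fin b) ℝ)

theorem glueMatrix_left_left (i j : Fin a) : glueMatrix H₁ H₂ (Fin.castAdd b i.castSucc)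
    (Fin.castAdd b j.castSucc) = H₁ i j := by
  simp only [glueMatrix, Fin.append_left, Fin.snoc_castSucc]

theorem glueMatrix_left_mid (i : Fin a) : glueMatrix H₁ H₂ (Fin.castAdd b i.castSucc)
    (Fin.castAdd b (Fin.last a)) = 0 := by
  simp only [glueMatrix, Fin.append_left, Fin.snoc_castSucc, Fin.snoc_last]

theorem glueMatrix_left_right (i : Fin (a + 1)) (j : Fin b) :
    glueMatrix H₁ H₂ (Fin.castAdd b i) (Fin.natAdd (a + 1) j) = 0 := by
  cases i using Fin.lastCases with
  | last => simp only [glueMatrix, Fin.append_left, Fin.append_right, Fin.snoc_last, Pi.zero_apply]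
  | cast i =>
    simp only [glueMatrix, Fin.append_left, Fin.append_right, Fin.snoc_castSucc, Pi.zero_apply]

theorem glueMatrix_mid_left (j : Fin a) : glueMatrix H₁ H₂ (Fin.castAdd b (Fin.last a))
    (Fin.castAdd b j.castSucc) = -(((b : ℝ) + 1) / (a + b + 2)) * ∑ k, H₁ k j := by
  simp only [glueMatrix, Fin.append_left, Fin.snoc_castSucc, Fin.snoc_last]

theorem glueMatrix_mid_mid : glueMatrix H₁ H₂ (Fin.castAdd b (Fin.last a))
    (Fin.castAdd b (Fin.last a)) = ((a : ℝ) + 1) * (b + 1) / (a + b + 2) := by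
  simp only [glueMatrix, Fin.append_left, Fin.snoc_last]

theorem glueMatrix_right_left (i : Fin b) (j : Fin a) : glueMatrix H₁ H₂ (Fin.natAdd (a + 1) i)
    (Fin.castAdd b j.castSucc) = 0 := by
  simp only [glueMatrix, Fin.append_left, Fin.append_right, Fin.snoc_castSucc, Pi.zero_apply]

theorem glueMatrix_right_mid (i : Fin b) : glueMatrix H₁ H₂ (Fin.natAdd (a + 1) i)
    (Fin.castAdd b (Fin.last a)) = -(((a : ℝ) + 1) / (a + b + 2)) * ∑ k, H₂ i k := by
  simp only [glueMatrix, Fin.append_left, Fin.append_right, Fin.snoc_last]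

theorem glueMatrix_right_right (i j : Fin b) : glueMatrix H₁ H₂ (Fin.natAdd (a + 1) i)
    (Fin.natAdd (a + 1) j) = H₂ i j := by
  simp only [glueMatrix, Fin.append_right]

/-- An index of a row or column of a gluing lies in the left block, is the index between the two
blocks, or lies in the right block. -/
theorem eq_index {a b : ℕ} (x : Fin (a + 1 + b)) : (∃ i : Fin a, x = Fin.castAdd b i.castSucc) ∨
    x = Fin.castAdd b (Fin.last a) ∨ ∃ k : Fin b, x = Fin.natAdd (a + 1) k := by
  induction x using Fin.addCases with
  | left i =>
    cases i using Fin.lastCases with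
    | last => exact Or.inr (Or.inl rfl)
    | cast i => exact Or.inl ⟨i, rfl⟩
  | right k => exact Or.inr (Or.inr ⟨k, rfl⟩)

variable {H₁ H₂}

theorem glueMatrix_lower (h₁ : ∀ i j, i < j → H₁ i j = 0) (h₂ : ∀ i j, i < j → H₂ i j = 0)
    (x y : Fin (a + 1 + b)) (hxy : x < y) : glueMatrix H₁ H₂ x y = 0 := by
  rcases eq_index x with ⟨i, rfl⟩ | rfl | ⟨k, rfl⟩ <;>
    rcases eq_index y with ⟨j, rfl⟩ | rfl | ⟨l, rfl⟩
  · rw [glueMatrix_left_left, h₁ i j hxy]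
  · rw [glueMatrix_left_mid]
  · rw [glueMatrix_left_right]
  · exact absurd hxy (Fin.castSucc_lt_last j).not_gt
  · exact absurd hxy (lt_irrefl _)
  · rw [glueMatrix_left_right]
  · rw [glueMatrix_right_left]
  · exact absurd hxy (leftNode_lt_rightNode (Fin.last a) k.castSucc).not_gt
  · rw [glueMatrix_right_right, h₂]
    exact rightNode_lt.mp (show rightNode a k.castSucc < rightNode a l.castSucc from hxy)

theorem cumMat_glueMatrix_left (i j : Fin (a + 1)) :
    cumMat (glueMatrix H₁ H₂) (leftNode b i) (leftNode b j) = cumMat H₁ i j := by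
  rw [← castSucc_castAdd b j, cumMat_castSucc, Fin.sum_univ_add, Fin.sum_univ_castSucc,
    Finset.sum_eq_zero (s := (Finset.univ : Finset (Fin b)))]
  · simp only [castSucc_castAdd, leftNode_lt, (Fin.le_last i).not_gt, if_false, add_zero]
    cases j using Fin.lastCases with
    | last => simp only [glueMatrix_left_mid, ite_self, Finset.sum_const_zero, cumMat_last]
    | cast j => simp only [glueMatrix_left_left, cumMat_castSucc]
  · intro k _
    rw [castSucc_natAdd, if_neg (leftNode_lt_rightNode i k.castSucc).not_gt]

theorem cumMat_glueMatrix_right_left (k : Fin (b + 1)) (j : Fin (a + 1)) :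
    cumMat (glueMatrix H₁ H₂) (rightNode a k) (leftNode b j) = ((a : ℝ) + 1) / (a + b + 2) *
      (cumMat H₁ (Fin.last a) j + lastVec a j * ((b + 1) - ∑ l, cumMat H₂ k l)) := by
  have hN : (0 : ℝ) < (a : ℝ) + b + 2 := by positivity
  rw [← castSucc_castAdd b j, cumMat_castSucc, Fin.sum_univ_add, Fin.sum_univ_castSucc]
  simp only [castSucc_castAdd, castSucc_natAdd, leftNode_lt_rightNode, if_true, rightNode_lt]
  cases j using Fin.lastCases with
  | last =>
    have h1 : ∑ l, cumMat H₂ k l = ∑ i : Fin b, if i.castSucc < k then ∑ l, H₂ i l else 0 := by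
      rw [Fin.sum_univ_castSucc, cumMat_last, add_zero]
      simp only [cumMat_castSucc]
      rw [Finset.sum_comm]
      refine Finset.sum_congr rfl fun i _ => ?_
      split_ifs <;> simp
    have h2 : ∀ i : Fin b, (if i.castSucc < k then
        -(((a : ℝ) + 1) / (a + b + 2)) * ∑ l, H₂ i l else 0) =
        -(((a : ℝ) + 1) / (a + b + 2)) * if i.castSucc < k then ∑ l, H₂ i l else 0 := by
      intro i
      split_ifs <;> simp
    simp only [glueMatrix_left_mid, glueMatrix_mid_mid, glueMatrix_right_mid, h2, ← Finset.mul_sum,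
      Finset.sum_const_zero, cumMat_last, lastVec_last, h1]
    ring
  | cast j =>
    simp only [glueMatrix_left_left, glueMatrix_mid_left, glueMatrix_right_left, ite_self,
      Finset.sum_const_zero, cumMat_castSucc, Fin.castSucc_lt_last, if_true,
      lastVec_of_ne (Fin.castSucc_lt_last j).ne]
    field_simp
    ring

/-- The Gram matrix of a gluing: the two Gram matrices, the left one rescaled, coupled by one arc
between their last nodes. The diagonal term added to the left one and the coupling are the
contributions of this arc. -/
noncomputable def glueGram {a b : ℕ} (G₁ : Matrix (Fin (a + 1)) (Fin (a + 1)) ℝ)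
    (G₂ : Matrix (Fin (b + 1)) (Fin (b + 1)) ℝ) :
    Matrix (Fin (a + 1 + b + 1)) (Fin (a + 1 + b + 1)) ℝ :=
  Fin.append (m := a + 1) (n := b + 1) (α := Fin (a + 1 + (b + 1)) → ℝ)
    (fun i => Fin.append
      (fun j => (((a : ℝ) + 1) / (a + b + 2)) ^ 2 * (G₁ i j + lastVec a i * lastVec a j / (b + 1)))
      (fun k => -(((a : ℝ) + 1) / (a + b + 2) / (b + 1)) * (lastVec a i * lastVec b k)))
    (fun k => Fin.append
      (fun i => -(((a : ℝ) + 1) / (a + b + 2) / (b + 1)) * (lastVec a i * lastVec b k)) (G₂ k))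

section GlueGram

variable (G₁ : Matrix (Fin (a + 1)) (Fin (a + 1)) ℝ) (G₂ : Matrix (Fin (b + 1)) (Fin (b + 1)) ℝ)

theorem glueGram_left_left (i j : Fin (a + 1)) :
    glueGram G₁ G₂ (leftNode b i) (leftNode b j) =
      (((a : ℝ) + 1) / (a + b + 2)) ^ 2 * (G₁ i j + lastVec a i * lastVec a j / (b + 1)) := by
  simp only [glueGram, leftNode]
  rw [Fin.append_left, Fin.append_left]

theorem glueGram_left_right (i : Fin (a + 1)) (k : Fin (b + 1)) :
    glueGram G₁ G₂ (leftNode b i) (rightNode a k) =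
      -(((a : ℝ) + 1) / (a + b + 2) / (b + 1)) * (lastVec a i * lastVec b k) := by
  simp only [glueGram, leftNode, rightNode]
  rw [Fin.append_left, Fin.append_right]

theorem glueGram_right_left (k : Fin (b + 1)) (i : Fin (a + 1)) :
    glueGram G₁ G₂ (rightNode a k) (leftNode b i) =
      -(((a : ℝ) + 1) / (a + b + 2) / (b + 1)) * (lastVec a i * lastVec b k) := by
  simp only [glueGram, leftNode, rightNode]
  rw [Fin.append_right, Fin.append_left]

theorem glueGram_right_right (k l : Fin (b + 1)) :
    glueGram G₁ G₂ (rightNode a k) (rightNode a l) = G₂ k l := by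
  simp only [glueGram, rightNode]
  rw [Fin.append_right, Fin.append_right]

end GlueGram

/-- The solution of the Lyapunov equation is unique, so it suffices to check that `glueGram` solves
it. -/
theorem resGram_glueMatrix (h₁ : IsInvariantH H₁) (h₂ : IsInvariantH H₂) :
    resGram (glueMatrix H₁ H₂) = glueGram (resGram H₁) (resGram H₂) := by
  have hlow := glueMatrix_lower h₁.1 h₂.1
  refine (strictLower_cumMat hlow).lyapunov_unique (resGram_lyapunov hlow) ?_
  have p₁ := h₁.isLyapunovPair
  have p₂ := h₂.isLyapunovPair
  have e₁ := lyapunov_iff.mp p₁.lyapunov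
  have e₂ := lyapunov_iff.mp p₂.lyapunov
  have hN : (0 : ℝ) < (a : ℝ) + b + 2 := by positivity
  have ha : (0 : ℝ) < (a : ℝ) + 1 := by positivity
  have hb : (0 : ℝ) < (b : ℝ) + 1 := by positivity
  have hzero : ∀ i k, cumMat (glueMatrix H₁ H₂) (leftNode b i) (rightNode a k) = 0 := fun i k =>
    cumMat_strictLower hlow _ _ (leftNode_lt_rightNode i k).le
  have hright := cumMat_rightNode_rightNode hlow (glueMatrix_right_right H₁ H₂)
  have hsymm : ∀ x y, glueGram (resGram H₁) (resGram H₂) x y =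
      glueGram (resGram H₁) (resGram H₂) y x := by
    intro x y
    rcases eq_leftNode_or_rightNode x with ⟨i, rfl⟩ | ⟨k, rfl⟩ <;>
      rcases eq_leftNode_or_rightNode y with ⟨j, rfl⟩ | ⟨l, rfl⟩
    · rw [glueGram_left_left, glueGram_left_left, p₁.symm, mul_comm (lastVec a i)]
    · rw [glueGram_left_right, glueGram_right_left]
    · rw [glueGram_left_right, glueGram_right_left]
    · rw [glueGram_right_right, glueGram_right_right, p₂.symm]
  obtain ⟨α, hα⟩ : ∃ α : ℝ, ((a : ℝ) + 1) / (a + b + 2) = α := ⟨_, rfl⟩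
  -- the coupling of a node of the left part with a node of the right part
  have hcross : ∀ i k, glueGram (resGram H₁) (resGram H₂) (leftNode b i) (rightNode a k) +
      ∑ c, glueGram (resGram H₁) (resGram H₂) (leftNode b i) c *
        cumMat (glueMatrix H₁ H₂) c (rightNode a k) +
      ∑ c, cumMat (glueMatrix H₁ H₂) c (leftNode b i) *
        glueGram (resGram H₁) (resGram H₂) c (rightNode a k) = 0 := by
    intro i k
    simp only [sum_nodes, hzero, hright, glueGram_left_right, glueGram_right_right,
      cumMat_glueMatrix_left, cumMat_glueMatrix_right_left, mul_zero, Finset.sum_const_zero,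
      zero_add, hα]
    have h1 : ∑ l, -(α / (b + 1)) * (lastVec a i * lastVec b l) * cumMat H₂ l k =
        -(α / (b + 1)) * (lastVec a i * cumMat H₂ (Fin.last b) k) := by
      refine Eq.trans ?_
        (sum_lastVec_mul fun l => -(α / (b + 1)) * (lastVec a i * cumMat H₂ l k))
      exact Finset.sum_congr rfl fun l _ => by ring
    have h2 : ∑ j, cumMat H₁ j i * (-(α / (b + 1)) * (lastVec a j * lastVec b k)) =
        -(α / (b + 1)) * (cumMat H₁ (Fin.last a) i * lastVec b k) := by
      refine Eq.trans ?_
        (sum_lastVec_mul fun j => -(α / (b + 1)) * (cumMat H₁ j i * lastVec b k))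
      exact Finset.sum_congr rfl fun l _ => by ring
    have h3 : ∑ m, ∑ l, cumMat H₂ l m * resGram H₂ l k =
        lastVec b k - lastVec b k / (b + 1) - cumMat H₂ (Fin.last b) k / (b + 1) := by
      have h4 := Finset.sum_congr rfl fun m (_ : m ∈ Finset.univ) => e₂ m k
      rw [Finset.sum_add_distrib, Finset.sum_add_distrib, p₂.sum_col_eq,
        Finset.sum_comm (f := fun m c => resGram H₂ m c * cumMat H₂ c k)] at h4
      simp only [← Finset.sum_mul, p₂.sum_col_eq, sum_lastVec, one_mul] at h4
      have h5 : ∑ c, lastVec b c / ((b : ℝ) + 1) * cumMat H₂ c k =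
          cumMat H₂ (Fin.last b) k / (b + 1) := by
        refine Eq.trans ?_ (sum_lastVec_mul fun c => cumMat H₂ c k / ((b : ℝ) + 1))
        exact Finset.sum_congr rfl fun l _ => by ring
      rw [h5] at h4
      linarith
    have h6 : ∑ l, α * (cumMat H₁ (Fin.last a) i + lastVec a i *
        ((b : ℝ) + 1 - ∑ m, cumMat H₂ l m)) * resGram H₂ l k =
        α * ((cumMat H₁ (Fin.last a) i + lastVec a i * ((b : ℝ) + 1)) * (lastVec b k / (b + 1)) -
          lastVec a i * ∑ m, ∑ l, cumMat H₂ l m * resGram H₂ l k) := by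
      rw [← p₂.sum_col_eq k, Finset.sum_comm (f := fun m l => cumMat H₂ l m * resGram H₂ l k)]
      simp only [← Finset.sum_mul]
      rw [Finset.mul_sum, Finset.mul_sum, ← Finset.sum_sub_distrib, Finset.mul_sum]
      exact Finset.sum_congr rfl fun l _ => by ring
    rw [h1, h2, h6, h3]
    field_simp
    ring
  rw [lyapunov_iff]
  intro x y
  rcases eq_leftNode_or_rightNode x with ⟨i, rfl⟩ | ⟨k, rfl⟩ <;>
    rcases eq_leftNode_or_rightNode y with ⟨j, rfl⟩ | ⟨l, rfl⟩
  · simp only [sum_nodes, glueGram_left_left, glueGram_left_right, glueGram_right_left,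
      cumMat_glueMatrix_left, cumMat_glueMatrix_right_left, lastVec_leftNode, zero_mul, hα]
    have h1 : ∑ c, α ^ 2 * (resGram H₁ i c + lastVec a i * lastVec a c / (b + 1)) *
        cumMat H₁ c j = α ^ 2 * (∑ c, resGram H₁ i c * cumMat H₁ c j +
          lastVec a i * cumMat H₁ (Fin.last a) j / (b + 1)) := by
      rw [← sum_lastVec_mul fun c => cumMat H₁ c j, Finset.mul_sum, Finset.sum_div,
        ← Finset.sum_add_distrib, Finset.mul_sum]
      exact Finset.sum_congr rfl fun c _ => by ring
    have h2 : ∑ c, cumMat H₁ c i * (α ^ 2 * (resGram H₁ c j + lastVec a c * lastVec a j /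
        (b + 1))) = α ^ 2 * (∑ c, cumMat H₁ c i * resGram H₁ c j +
          lastVec a j * cumMat H₁ (Fin.last a) i / (b + 1)) := by
      rw [← sum_lastVec_mul fun c => cumMat H₁ c i, Finset.mul_sum, Finset.sum_div,
        ← Finset.sum_add_distrib, Finset.mul_sum]
      exact Finset.sum_congr rfl fun c _ => by ring
    have h3 : ∀ i j, ∑ k, -(α / (b + 1)) * (lastVec a i * lastVec b k) *
        (α * (cumMat H₁ (Fin.last a) j + lastVec a j * ((b : ℝ) + 1 - ∑ l, cumMat H₂ k l))) =
        -(α ^ 2 / (b + 1)) * (lastVec a i * (cumMat H₁ (Fin.last a) j +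
          lastVec a j * (b / 2 + 1))) := by
      intro i j
      have h4 := p₂.sum_last_row
      refine Eq.trans ?_ ((sum_lastVec_mul fun k => -(α ^ 2 / ((b : ℝ) + 1)) * (lastVec a i *
        (cumMat H₁ (Fin.last a) j + lastVec a j * ((b : ℝ) + 1 - ∑ l, cumMat H₂ k l)))).trans ?_)
      · exact Finset.sum_congr rfl fun c _ => by ring
      · rw [h4]
        ring
    have h3' : ∀ i j, ∑ k, (α * (cumMat H₁ (Fin.last a) j + lastVec a j *
        ((b : ℝ) + 1 - ∑ l, cumMat H₂ k l))) * (-(α / (b + 1)) * (lastVec a i * lastVec b k)) =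
        -(α ^ 2 / (b + 1)) * (lastVec a i * (cumMat H₁ (Fin.last a) j +
          lastVec a j * (b / 2 + 1))) := fun i j => by
      rw [← h3]
      exact Finset.sum_congr rfl fun c _ => mul_comm _ _
    rw [h1, h2, h3, h3']
    rw [show resGram H₁ i j = lastVec a i * lastVec a j - ∑ c, resGram H₁ i c * cumMat H₁ c j -
      ∑ c, cumMat H₁ c i * resGram H₁ c j by rw [← e₁ i j]; ring]
    field_simp
    ring
  · rw [hcross, lastVec_leftNode, zero_mul]
  · rw [lastVec_leftNode, mul_zero, ← hcross j k, hsymm, add_right_comm]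
    congr 1
    · congr 1
      exact Finset.sum_congr rfl fun c _ => by rw [hsymm, mul_comm]
    · exact Finset.sum_congr rfl fun c _ => by rw [hsymm, mul_comm]
  · simp only [sum_nodes, hzero, hright, glueGram_right_right, mul_zero, zero_mul,
      Finset.sum_const_zero, zero_add, lastVec_rightNode, e₂]

/-- The gluing of optimal matrices is optimal. -/
theorem glueMatrix_mem_optimalH (h₁ : H₁ ∈ optimalH a) (h₂ : H₂ ∈ optimalH b) :
    glueMatrix H₁ H₂ ∈ optimalH (a + 1 + b) := by
  have i₁ := isInvariantH_of_mem_optimalH h₁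
  have i₂ := isInvariantH_of_mem_optimalH h₂
  have p₁ := i₁.isLyapunovPair
  have p₂ := i₂.isLyapunovPair
  have hN : (0 : ℝ) < (a : ℝ) + b + 2 := by positivity
  have hle : ∀ i k, -(((a : ℝ) + 1) / (a + b + 2) / (b + 1)) * (lastVec a i * lastVec b k) ≤ 0 := by
    intro i k
    refine mul_nonpos_of_nonpos_of_nonneg (neg_nonpos.mpr (by positivity)) ?_
    simp only [lastVec_apply]
    split_ifs <;> simp
  refine mem_optimalH_of_resGram (glueMatrix_lower i₁.1 i₂.1) (fun x => ?_) fun x y hxy => ?_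
  · rw [resGram_glueMatrix i₁ i₂, sum_nodes, last_eq_rightNode]
    rcases eq_leftNode_or_rightNode x with ⟨i, rfl⟩ | ⟨k, rfl⟩
    · simp only [glueGram_left_left, glueGram_left_right, ← Finset.mul_sum,
        Finset.sum_add_distrib, p₁.sum_row_eq, ← Finset.sum_div, sum_lastVec,
        leftNode_ne_rightNode, if_false]
      field_simp
      ring
    · simp only [glueGram_right_left, glueGram_right_right, ← Finset.mul_sum, ← Finset.sum_mul,
        p₂.sum_row_eq, sum_lastVec, rightNode_inj]
      rw [lastVec_apply]
      push_cast
      split_ifs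
      · field_simp
        ring
      · simp
  · rw [resGram_glueMatrix i₁ i₂]
    rcases eq_leftNode_or_rightNode x with ⟨i, rfl⟩ | ⟨k, rfl⟩ <;>
      rcases eq_leftNode_or_rightNode y with ⟨j, rfl⟩ | ⟨l, rfl⟩
    · have hij : i ≠ j := fun h => hxy (congrArg _ h)
      rw [glueGram_left_left, lastVec_mul_eq_zero hij, zero_div, add_zero]
      exact mul_nonpos_of_nonneg_of_nonpos (by positivity) (resGram_nonpos_of_mem_optimalH h₁ hij)
    · rw [glueGram_left_right]
      exact hle i l
    · rw [glueGram_right_left]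
      exact hle j k
    · rw [glueGram_right_right]
      exact resGram_nonpos_of_mem_optimalH h₂ fun h => hxy (congrArg _ h)

theorem algDiagram_glueMatrix (h₁ : IsInvariantH H₁) (h₂ : IsInvariantH H₂) :
    algDiagram (glueMatrix H₁ H₂) = glueDiagram (algDiagram H₁) (algDiagram H₂) := by
  have hα : ((a : ℝ) + 1) / (a + b + 2) ≠ 0 := by positivity
  have hα' : -(((a : ℝ) + 1) / (a + b + 2) / (b + 1)) ≠ 0 := neg_ne_zero.mpr (by positivity)
  have hlast : ∀ i k, lastVec a i * lastVec b k ≠ 0 ↔ i = Fin.last a ∧ k = Fin.last b := by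
    intro i k
    simp only [lastVec_apply]
    split_ifs <;> simp_all
  ext x y
  rw [algDiagram_adj, resGram_glueMatrix h₁ h₂]
  rcases eq_leftNode_or_rightNode x with ⟨i, rfl⟩ | ⟨k, rfl⟩ <;>
    rcases eq_leftNode_or_rightNode y with ⟨j, rfl⟩ | ⟨l, rfl⟩
  · rw [glueDiagram_adj_left, algDiagram_adj, glueGram_left_left, ne_eq, leftNode_inj]
    refine and_congr_right fun hij => ?_
    rw [lastVec_mul_eq_zero hij, zero_div, add_zero]
    exact mul_ne_zero_iff_left (pow_ne_zero 2 hα)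
  · rw [glueDiagram_adj_left_right, glueGram_left_right, mul_ne_zero_iff_left hα', hlast]
    simp
  · rw [glueDiagram_adj_right_left, glueGram_right_left, mul_ne_zero_iff_left hα', hlast]
    simp
  · rw [glueDiagram_adj_right, algDiagram_adj, glueGram_right_right, ne_eq, rightNode_inj]

open Polynomial in
/-- The residual polynomial of the node `N'` of a gluing. -/
theorem resPoly_glueMatrix_mid (h₁ : ∀ i j, i < j → H₁ i j = 0) (h₂ : IsInvariantH H₂) :
    resPoly (glueMatrix H₁ H₂) (leftNode b (Fin.last a)) = (((a : ℝ) + 1) / (a + b + 2)) •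
      (X ^ (b + 1) - ((b : ℝ) + 1)⁻¹ • ∑ i ∈ Finset.range (b + 1), X ^ i) := by
  have hlow := glueMatrix_lower h₁ h₂.1
  have hb : (b : ℝ) + 1 ≠ 0 := by positivity
  have hS : ∑ k, resPoly H₂ k = ((b : ℝ) + 1)⁻¹ • ∑ i ∈ Finset.range (b + 1), X ^ i := by
    ext i
    rw [coeff_smul, finsetSum_coeff (s := Finset.range (b + 1))]
    simp only [coeff_X_pow, Finset.sum_ite_eq, Finset.mem_range, smul_eq_mul]
    split_ifs with hi
    · rw [h₂.2 i (by omega), mul_one, one_div]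
    · rw [finsetSum_coeff, mul_zero]
      exact Finset.sum_eq_zero fun k _ => resPoly_coeff_eq_zero h₂.1 k i (by omega)
  have h3 : (X - 1) * ∑ k, (∑ l, cumMat H₂ k l) • resPoly H₂ k = (∑ k, resPoly H₂ k) - 1 := by
    have h4 : ∑ l, resPoly H₂ l = 1 + (X - 1) * ∑ l, ∑ k, cumMat H₂ k l • resPoly H₂ k := by
      conv_lhs => rw [Finset.sum_congr rfl fun l _ => resPoly_rec h₂.1 l]
      rw [Finset.sum_add_distrib, ← Finset.mul_sum]
      simp
    rw [h4, Finset.sum_comm, add_sub_cancel_left]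
    simp only [Finset.sum_smul]
  have h5 : ((b : ℝ) + 1) • ((X - 1) * ∑ k, resPoly H₂ k) = X ^ (b + 1) - 1 := by
    rw [hS, mul_smul_comm, smul_smul, mul_inv_cancel₀ hb, one_smul, mul_geom_sum]
  rw [resPoly_rec hlow, sum_nodes, Finset.sum_eq_zero, zero_add,
    last_eq_rightNode, if_neg (leftNode_ne_rightNode (Fin.last a) (Fin.last b)), zero_add, ← hS]
  · simp only [cumMat_glueMatrix_right_left, resPoly_rightNode hlow h₂.1
      (glueMatrix_right_right H₁ H₂), cumMat_last, lastVec_last, one_mul, zero_add, mul_smul,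
      ← Finset.smul_sum, sub_smul, Finset.sum_sub_distrib]
    rw [mul_smul_comm, mul_sub, h3, mul_smul_comm, h5]
    congr 1
    abel
  · intro i _
    rw [cumMat_glueMatrix_left, cumMat_last, zero_smul]

end GlueMatrix

/-! ### The values of the Q-functions in a gluing -/

section GlueMatrix

variable {a b : ℕ} {H₁ : Matrix (Fin a) (Fin a) ℝ} {H₂ : Matrix (Fin b) (Fin b) ℝ}

open Polynomial in
/-- The values `Q(k, j; H)` are the coefficients of the residual polynomial at `X + 1`. -/
theorem coeff_resPoly_comp {n : ℕ} (H : Matrix (Fin n) (Fin n) ℝ) (j : Fin n) {k : ℕ}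
    (hk : k ∈ Finset.Icc 1 n) : ((resPoly H j.castSucc).comp (X + 1)).coeff k = qFun H k j := by
  rw [resPoly_castSucc, Polynomial.sum_comp, finsetSum_coeff, Finset.sum_eq_single k]
  · simp
  · intro m _ hm
    simp [coeff_X_pow, hm.symm]
  · exact fun h => absurd hk h

open Polynomial in
theorem qFun_glueMatrix_mid (h₁ : ∀ i j, i < j → H₁ i j = 0) (h₂ : IsInvariantH H₂) {k : ℕ}
    (hk : k ∈ Finset.Icc 1 (b + 1)) :
    qFun (glueMatrix H₁ H₂) k (Fin.castAdd b (Fin.last a)) =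
      ((a : ℝ) + 1) * (b + 2) / ((a + b + 2) * (k + 1)) * (b.choose (k - 1) : ℝ) := by
  obtain ⟨hk1, hk2⟩ := Finset.mem_Icc.mp hk
  rw [← coeff_resPoly_comp _ _ (Finset.mem_Icc.mpr ⟨hk1, by omega⟩), castSucc_castAdd,
    resPoly_glueMatrix_mid h₁ h₂, smul_comp, sub_comp, smul_comp, pow_comp, X_comp,
    Polynomial.sum_comp]
  simp only [pow_comp, X_comp, coeff_smul, coeff_sub, smul_eq_mul]
  have hgeom : (∑ i ∈ Finset.range (b + 1), (X + 1 : ℝ[X]) ^ i).coeff k =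
      ((b + 1).choose (k + 1) : ℝ) := by
    have h1 := congrArg (fun p => p.coeff (k + 1)) (mul_geom_sum (X + 1 : ℝ[X]) (b + 1))
    simp only [add_sub_cancel_right, coeff_X_mul, coeff_sub, coeff_X_add_one_pow] at h1
    rw [h1, coeff_one, if_neg (Nat.succ_ne_zero k), sub_zero]
  rw [hgeom, coeff_X_add_one_pow]
  obtain ⟨j, rfl⟩ := Nat.exists_eq_add_of_le' hk1
  have c1 : ((b + 1).choose (j + 1) : ℝ) * (j + 1) = (b + 1) * b.choose j := by
    exact_mod_cast (Nat.add_one_mul_choose_eq b j).symm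
  have c2 : ((b + 1).choose (j + 2) : ℝ) * (j + 2) = (b + 1) * b.choose (j + 1) := by
    exact_mod_cast (Nat.add_one_mul_choose_eq b (j + 1)).symm
  have c3 : (b.choose (j + 1) : ℝ) * (j + 1) = b.choose j * (b - j) := by
    have := Nat.choose_succ_right_eq b j
    rw [← Nat.cast_sub (by omega : j ≤ b)]
    exact_mod_cast this
  have hj1 : (j : ℝ) + 1 ≠ 0 := by positivity
  have hj2 : (j : ℝ) + 2 ≠ 0 := by positivity
  have hb : (b : ℝ) + 1 ≠ 0 := by positivity
  rw [eq_div_of_mul_eq hj1 c1, eq_div_of_mul_eq hj2 c2, eq_div_of_mul_eq hj1 c3, Nat.add_sub_cancel]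
  push_cast
  field_simp
  ring

theorem isGluing_glueMatrix (h₁ : ∀ i j, i < j → H₁ i j = 0) (h₂ : IsInvariantH H₂) :
    IsGluing H₁ H₂ (glueMatrix H₁ H₂) where
  lower := glueMatrix_lower h₁ h₂.1
  left := glueMatrix_left_left H₁ H₂
  right := glueMatrix_right_right H₁ H₂
  corner := glueMatrix_right_left H₁ H₂
  row j := by
    rw [glueMatrix_mid_left]
    congr 1
    symm
    refine Finset.sum_subset (Finset.subset_univ _) fun k _ hk => h₁ k j ?_
    simpa using hk
  diag := glueMatrix_mid_mid H₁ H₂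
  column _ hk := qFun_glueMatrix_mid h₁ h₂ hk

/-- The prescribed values of `Q(·, N'; H)` leave no choice for the column `N'`, because the residual
polynomials of the right block are linearly independent. -/
theorem IsGluing.eq_glueMatrix {H : Matrix (Fin (a + 1 + b)) (Fin (a + 1 + b)) ℝ}
    (h : IsGluing H₁ H₂ H) (h₁ : ∀ i j, i < j → H₁ i j = 0) (h₂ : IsInvariantH H₂) :
    H = glueMatrix H₁ H₂ := by
  have hM := isGluing_glueMatrix h₁ h₂
  have hq : resPoly H (leftNode b (Fin.last a)) =
      resPoly (glueMatrix H₁ H₂) (leftNode b (Fin.last a)) := by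
    rw [← castSucc_castAdd, resPoly_castSucc, resPoly_castSucc]
    refine Finset.sum_congr rfl fun k hk => ?_
    by_cases hk' : k ∈ Finset.Icc 1 (b + 1)
    · rw [h.column k hk', hM.column k hk']
    · have hlt : a + 1 + b < k + (Fin.castAdd b (Fin.last a) : Fin (a + 1 + b)) := by
        rw [Finset.mem_Icc] at hk hk'
        simp
        omega
      rw [qFun_eq_zero H k _ hlt, qFun_eq_zero _ k _ hlt]
  have hexp : ∀ {M : Matrix (Fin (a + 1 + b)) (Fin (a + 1 + b)) ℝ}, IsGluing H₁ H₂ M →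
      resPoly M (leftNode b (Fin.last a)) = (Polynomial.X - 1) *
        ∑ k, cumMat M (rightNode a k) (leftNode b (Fin.last a)) • resPoly H₂ k := by
    intro M hM
    rw [resPoly_rec hM.lower, sum_nodes, Finset.sum_eq_zero, zero_add, last_eq_rightNode,
      if_neg (leftNode_ne_rightNode (Fin.last a) (Fin.last b)), zero_add]
    · simp only [resPoly_rightNode hM.lower h₂.1 hM.right]
    · intro i _
      rw [cumMat_strictLower hM.lower _ _ (leftNode_le.mpr (Fin.le_last i)), zero_smul]
  rw [hexp h, hexp hM, mul_right_inj' (by simpa using Polynomial.X_sub_C_ne_zero (1 : ℝ)),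
    ← sub_eq_zero, ← Finset.sum_sub_distrib] at hq
  simp only [← sub_smul] at hq
  have hcum := fun k => sub_eq_zero.mp (congrFun (h₂.linearIndependent hq) k)
  have hcol : ∀ k : Fin b, H (Fin.natAdd (a + 1) k) (Fin.castAdd b (Fin.last a)) =
      glueMatrix H₁ H₂ (Fin.natAdd (a + 1) k) (Fin.castAdd b (Fin.last a)) := by
    intro k
    have e := cumMat_succ_sub H (Fin.natAdd (a + 1) k) (Fin.castAdd b (Fin.last a)).castSucc
    have e' := cumMat_succ_sub (glueMatrix H₁ H₂) (Fin.natAdd (a + 1) k)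
      (Fin.castAdd b (Fin.last a)).castSucc
    rw [Fin.snoc_castSucc] at e e'
    have c1 := hcum k.succ
    have c2 := hcum k.castSucc
    change cumMat H (Fin.natAdd (a + 1) k).succ (Fin.castAdd b (Fin.last a)).castSucc =
      cumMat _ (Fin.natAdd (a + 1) k).succ (Fin.castAdd b (Fin.last a)).castSucc at c1
    change cumMat H (Fin.natAdd (a + 1) k).castSucc (Fin.castAdd b (Fin.last a)).castSucc =
      cumMat _ (Fin.natAdd (a + 1) k).castSucc (Fin.castAdd b (Fin.last a)).castSucc at c2
    linarith
  ext x y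
  rcases eq_index x with ⟨i, rfl⟩ | rfl | ⟨k, rfl⟩ <;>
    rcases eq_index y with ⟨j, rfl⟩ | rfl | ⟨l, rfl⟩
  · rw [h.left, hM.left]
  · rw [h.lower, hM.lower] <;> exact Fin.castSucc_lt_last i
  · rw [h.lower, hM.lower] <;> exact leftNode_lt_rightNode i.castSucc l.castSucc
  · rw [h.row, hM.row]
  · rw [h.diag, hM.diag]
  · rw [h.lower, hM.lower] <;> exact leftNode_lt_rightNode (Fin.last a) l.castSucc
  · rw [h.corner, hM.corner]
  · exact hcol k
  · rw [h.right, hM.right]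

end GlueMatrix

/-! ### Basic matrices -/

theorem mem_optimalH_zero (H : Matrix (Fin 0) (Fin 0) ℝ) : H ∈ optimalH 0 := by
  refine mem_optimalH_of_resGram (fun i => i.elim0) (fun a => ?_) fun a b hab =>
    absurd (Subsingleton.elim (α := Fin 1) a b) hab
  have ha : a = Fin.last 0 := Subsingleton.elim (α := Fin 1) _ _
  have h : resPoly H 0 = 1 := resPoly_last H
  rw [Fin.sum_univ_one, if_pos ha, ha]
  simp [resGram, coeffForm_apply, h]

theorem IsBasicMatrix.mem_optimalH {n : ℕ} {H : Matrix (Fin n) (Fin n) ℝ} (h : IsBasicMatrix H) :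
    H ∈ optimalH n := by
  induction h with
  | empty H => exact mem_optimalH_zero H
  | glue H₁ H₂ H _ _ hg ih₁ ih₂ =>
    have i₁ := isInvariantH_of_mem_optimalH ih₁
    have i₂ := isInvariantH_of_mem_optimalH ih₂
    rw [hg.eq_glueMatrix i₁.1 i₂]
    exact glueMatrix_mem_optimalH ih₁ ih₂

theorem IsBasicMatrix.isInvariantH {n : ℕ} {H : Matrix (Fin n) (Fin n) ℝ} (h : IsBasicMatrix H) :
    IsInvariantH H :=
  isInvariantH_of_mem_optimalH h.mem_optimalH

theorem IsBasicMatrix.isBasicDiagram {n : ℕ} {H : Matrix (Fin n) (Fin n) ℝ}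
    (h : IsBasicMatrix H) : IsBasicDiagram (algDiagram H) := by
  induction h with
  | empty H => exact .single _
  | glue H₁ H₂ H h₁ h₂ hg ih₁ ih₂ =>
    rw [hg.eq_glueMatrix h₁.isInvariantH.1 h₂.isInvariantH,
      algDiagram_glueMatrix h₁.isInvariantH h₂.isInvariantH]
    exact .glue _ _ ih₁ ih₂

theorem IsBasicMatrix.glueMatrix {a b : ℕ} {H₁ : Matrix (Fin a) (Fin a) ℝ}
    {H₂ : Matrix (Fin b) (Fin b) ℝ} (h₁ : IsBasicMatrix H₁) (h₂ : IsBasicMatrix H₂) :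
    IsBasicMatrix (glueMatrix H₁ H₂) :=
  .glue _ _ _ h₁ h₂ (isGluing_glueMatrix h₁.isInvariantH.1 h₂.isInvariantH)

theorem IsBasicDiagram.exists_isBasicMatrix {n : ℕ} {D : SimpleGraph (Fin (n + 1))}
    (h : IsBasicDiagram D) :
    ∃ H : Matrix (Fin n) (Fin n) ℝ, IsBasicMatrix H ∧ algDiagram H = D := by
  induction h with
  | single D =>
    refine ⟨0, .empty _, ?_⟩
    ext x y
    have hxy : x = y := Subsingleton.elim (α := Fin 1) x y
    subst hxy
    simp
  | glue D₁ D₂ _ _ ih₁ ih₂ =>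
    obtain ⟨H₁, h₁, rfl⟩ := ih₁
    obtain ⟨H₂, h₂, rfl⟩ := ih₂
    exact ⟨_, h₁.glueMatrix h₂, algDiagram_glueMatrix h₁.isInvariantH h₂.isInvariantH⟩

/-- An optimal matrix is determined by its diagram if the diagram is basic. -/
theorem eq_of_algDiagram_eq {n : ℕ} {H H' : Matrix (Fin n) (Fin n) ℝ} (hH : H ∈ optimalH n)
    (hH' : H' ∈ optimalH n) (hD : IsBasicDiagram (algDiagram H))
    (heq : algDiagram H = algDiagram H') : H = H' := by
  have p := (isInvariantH_of_mem_optimalH hH).isLyapunovPair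
  have p' := (isInvariantH_of_mem_optimalH hH').isLyapunovPair
  have hG : resGram H = resGram H' := by
    refine hD.gram_unique p p' (fun x y hxy hadj => ?_) fun x y hxy hadj => ?_
    · rw [algDiagram_adj] at hadj
      by_contra hne
      exact hadj ⟨hxy, hne⟩
    · rw [heq, algDiagram_adj] at hadj
      by_contra hne
      exact hadj ⟨hxy, hne⟩
  rw [← hG] at p'
  exact cumMat_injective (p.left_unique p')

theorem isBasicMatrix_iff {n : ℕ} {H : Matrix (Fin n) (Fin n) ℝ} :
    IsBasicMatrix H ↔ H ∈ optimalH n ∧ IsBasicDiagram (algDiagram H) := by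
  refine ⟨fun h => ⟨h.mem_optimalH, h.isBasicDiagram⟩, fun ⟨h1, h2⟩ => ?_⟩
  obtain ⟨H', h3, h4⟩ := h2.exists_isBasicMatrix
  rwa [eq_of_algDiagram_eq h1 h3.mem_optimalH h2 h4.symm]

theorem IsBasicMatrix.submatrix_cast {m n : ℕ} (e : m = n) {H : Matrix (Fin n) (Fin n) ℝ}
    (h : IsBasicMatrix H) : IsBasicMatrix (H.submatrix (Fin.cast e) (Fin.cast e)) := by
  subst e
  exact h

/-- The H-dual of a gluing is the gluing of the H-duals in the opposite order. -/
theorem hDual_glueMatrix {a b : ℕ} (H₁ : Matrix (Fin a) (Fin a) ℝ) (H₂ : Matrix (Fin b) (Fin b) ℝ) :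
    hDual (glueMatrix H₁ H₂) = (glueMatrix (hDual H₂) (hDual H₁)).submatrix
      (Fin.cast (by omega)) (Fin.cast (by omega)) := by
  have e : b + 1 + a = a + 1 + b := by omega
  suffices h : ∀ x y : Fin (b + 1 + a),
      glueMatrix H₁ H₂ (Fin.cast e y).rev (Fin.cast e x).rev =
        glueMatrix (hDual H₂) (hDual H₁) x y by
    ext x y
    exact h (Fin.cast e.symm x) (Fin.cast e.symm y)
  have hl : ∀ i : Fin b, (Fin.cast e (Fin.castAdd a i.castSucc)).rev =
      Fin.natAdd (a + 1) i.rev := fun i => Fin.ext (by simp [Fin.val_rev]; omega)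
  have hm : (Fin.cast e (Fin.castAdd a (Fin.last b))).rev = Fin.castAdd b (Fin.last a) :=
    Fin.ext (by simp [Fin.val_rev]; omega)
  have hr : ∀ i : Fin a, (Fin.cast e (Fin.natAdd (b + 1) i)).rev =
      Fin.castAdd b i.rev.castSucc := fun i => Fin.ext (by simp [Fin.val_rev]; omega)
  have hN : (b : ℝ) + a + 2 = a + b + 2 := by ring
  intro x y
  rcases eq_index x with ⟨i, rfl⟩ | rfl | ⟨k, rfl⟩ <;>
    rcases eq_index y with ⟨j, rfl⟩ | rfl | ⟨l, rfl⟩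
  · rw [hl, hl, glueMatrix_right_right, glueMatrix_left_left, hDual, Matrix.of_apply]
  · rw [hl, hm, glueMatrix_left_right, glueMatrix_left_mid]
  · rw [hl, hr, glueMatrix_left_right, glueMatrix_left_right]
  · rw [hl, hm, glueMatrix_right_mid, glueMatrix_mid_left, hN,
      ← Equiv.sum_comp Fin.revPerm fun k => H₂ j.rev k]
    rfl
  · rw [hm, glueMatrix_mid_mid, glueMatrix_mid_mid, hN, mul_comm ((a : ℝ) + 1)]
  · rw [hm, hr, glueMatrix_left_mid, glueMatrix_left_right]
  · rw [hl, hr, glueMatrix_right_left, glueMatrix_right_left]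
  · rw [hm, hr, glueMatrix_mid_left, glueMatrix_right_mid, hN,
      ← Equiv.sum_comp Fin.revPerm fun i => H₁ i k.rev]
    rfl
  · rw [hr, hr, glueMatrix_left_left, glueMatrix_right_right, hDual, Matrix.of_apply]

theorem IsBasicMatrix.hDual {n : ℕ} {H : Matrix (Fin n) (Fin n) ℝ} (h : IsBasicMatrix H) :
    IsBasicMatrix (hDual H) := by
  induction h with
  | empty H => exact .empty _
  | glue H₁ H₂ H h₁ h₂ hg ih₁ ih₂ =>
    rw [hg.eq_glueMatrix h₁.isInvariantH.1 h₂.isInvariantH, hDual_glueMatrix]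
    exact (ih₂.glueMatrix ih₁).submatrix_cast _

/-! ### Basic diagrams are the non-crossing arc diagrams -/

theorem isArcDiagram_iff {n : ℕ} {D : SimpleGraph (Fin (n + 1))} :
    IsArcDiagram D ↔ ∀ x, x ≠ Fin.last n → ∃! y, x < y ∧ D.Adj x y := by
  constructor
  · intro h x hx
    obtain ⟨j, rfl⟩ := Fin.exists_castSucc_eq.mpr hx
    exact h j
  · exact fun h j => h _ (Fin.castSucc_lt_last j).ne

section GlueDiagram

variable {a b : ℕ} {D₁ : SimpleGraph (Fin (a + 1))} {D₂ : SimpleGraph (Fin (b + 1))}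

theorem isArcDiagram_glueDiagram :
    IsArcDiagram (glueDiagram D₁ D₂) ↔ IsArcDiagram D₁ ∧ IsArcDiagram D₂ := by
  simp only [isArcDiagram_iff]
  constructor
  · refine fun h => ⟨fun i hi => ?_, fun k hk => ?_⟩
    · obtain ⟨y, ⟨hy1, hy2⟩, hy3⟩ := h (leftNode b i) (leftNode_ne_rightNode i (Fin.last b))
      rcases eq_leftNode_or_rightNode y with ⟨j, rfl⟩ | ⟨l, rfl⟩
      · refine ⟨j, ⟨hy1, by simpa using hy2⟩, fun j' hj' => ?_⟩
        exact leftNode_inj.mp (hy3 (leftNode b j') ⟨hj'.1, by simpa using hj'.2⟩)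
      · rw [glueDiagram_adj_left_right] at hy2
        exact absurd hy2.1 hi
    · obtain ⟨y, ⟨hy1, hy2⟩, hy3⟩ := h (rightNode a k) (fun h => hk (rightNode_inj.mp h))
      rcases eq_leftNode_or_rightNode y with ⟨j, rfl⟩ | ⟨l, rfl⟩
      · exact absurd hy1 (leftNode_lt_rightNode j k).not_gt
      · refine ⟨l, ⟨rightNode_lt.mp hy1, by simpa [-rightNode_last] using hy2⟩, fun l' hl' => ?_⟩
        exact rightNode_inj.mp (hy3 (rightNode a l')
          ⟨rightNode_lt.mpr hl'.1, by simpa [-rightNode_last] using hl'.2⟩)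
  · rintro ⟨h₁, h₂⟩ x hx
    rcases eq_leftNode_or_rightNode x with ⟨i, rfl⟩ | ⟨k, rfl⟩
    · by_cases hi : i = Fin.last a
      · refine ⟨rightNode a (Fin.last b), ⟨leftNode_lt_rightNode _ _, ?_⟩, ?_⟩
        · rw [glueDiagram_adj_left_right]
          exact ⟨hi, rfl⟩
        · rintro y ⟨hy1, hy2⟩
          rcases eq_leftNode_or_rightNode y with ⟨j, rfl⟩ | ⟨l, rfl⟩
          · rw [hi, leftNode_lt] at hy1
            exact absurd hy1 (Fin.le_last j).not_gt
          · rw [glueDiagram_adj_left_right] at hy2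
            rw [hy2.2]
      · obtain ⟨j, ⟨hj1, hj2⟩, hj3⟩ := h₁ i hi
        refine ⟨leftNode b j, ⟨hj1, by rwa [glueDiagram_adj_left]⟩, ?_⟩
        rintro y ⟨hy1, hy2⟩
        rcases eq_leftNode_or_rightNode y with ⟨j', rfl⟩ | ⟨l, rfl⟩
        · rw [glueDiagram_adj_left] at hy2
          rw [hj3 j' ⟨hy1, hy2⟩]
        · rw [glueDiagram_adj_left_right] at hy2
          exact absurd hy2.1 hi
    · have hk : k ≠ Fin.last b := by
        rintro rfl
        exact hx rfl
      obtain ⟨l, ⟨hl1, hl2⟩, hl3⟩ := h₂ k hk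
      refine ⟨rightNode a l, ⟨rightNode_lt.mpr hl1, by rwa [glueDiagram_adj_right]⟩, ?_⟩
      rintro y ⟨hy1, hy2⟩
      rcases eq_leftNode_or_rightNode y with ⟨j, rfl⟩ | ⟨l', rfl⟩
      · exact absurd hy1 (leftNode_lt_rightNode j k).not_gt
      · rw [glueDiagram_adj_right] at hy2
        rw [hl3 l' ⟨rightNode_lt.mp hy1, hy2⟩]

theorem nonCrossing_glueDiagram :
    NonCrossing (glueDiagram D₁ D₂) ↔ NonCrossing D₁ ∧ NonCrossing D₂ := by
  constructor
  · refine fun h => ⟨?_, ?_⟩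
    · rintro ⟨j₁, j₂, k₁, k₂, h1, h2, h3, h4, h5⟩
      exact h ⟨leftNode b j₁, leftNode b j₂, leftNode b k₁, leftNode b k₂, by
        rwa [glueDiagram_adj_left], by rwa [glueDiagram_adj_left], h3, h4, h5⟩
    · rintro ⟨j₁, j₂, k₁, k₂, h1, h2, h3, h4, h5⟩
      exact h ⟨rightNode a j₁, rightNode a j₂, rightNode a k₁, rightNode a k₂, by
        rwa [glueDiagram_adj_right], by rwa [glueDiagram_adj_right], rightNode_lt.mpr h3,
        rightNode_lt.mpr h4, rightNode_lt.mpr h5⟩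
  · rintro ⟨hD₁, hD₂⟩ ⟨j₁, j₂, k₁, k₂, h1, h2, h3, h4, h5⟩
    have hnot : ∀ (k : Fin (b + 1)) (i : Fin (a + 1)), ¬rightNode a k < leftNode b i :=
      fun k i => (leftNode_lt_rightNode i k).not_gt
    rcases eq_leftNode_or_rightNode j₁ with ⟨i₁, rfl⟩ | ⟨i₁, rfl⟩ <;>
      rcases eq_leftNode_or_rightNode j₂ with ⟨i₂, rfl⟩ | ⟨i₂, rfl⟩ <;>
      first | exact hnot _ _ h3 | skip
    all_goals
      rcases eq_leftNode_or_rightNode k₁ with ⟨l₁, rfl⟩ | ⟨l₁, rfl⟩ <;>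
      first | exact hnot _ _ h4 | skip
    all_goals
      rcases eq_leftNode_or_rightNode k₂ with ⟨l₂, rfl⟩ | ⟨l₂, rfl⟩ <;>
      first | exact hnot _ _ h5 | skip
    all_goals
      simp only [glueDiagram_adj_left, glueDiagram_adj_right, glueDiagram_adj_left_right,
        leftNode_lt, rightNode_lt] at h1 h2 h3 h4 h5
    · exact hD₁ ⟨i₁, i₂, l₁, l₂, h1, h2, h3, h4, h5⟩
    · exact (Fin.le_last l₁).not_gt (h2.1 ▸ h4)
    · exact (Fin.le_last i₂).not_gt (h1.1 ▸ h3)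
    · exact (Fin.le_last l₂).not_gt (h1.2 ▸ h5)
    · exact hD₂ ⟨i₁, i₂, l₁, l₂, h1, h2, h3, h4, h5⟩

end GlueDiagram

/-- A non-crossing arc diagram splits after the smallest neighbour of its last node. -/
theorem exists_eq_glueDiagram {n : ℕ} (hn : n ≠ 0) {D : SimpleGraph (Fin (n + 1))}
    (harc : IsArcDiagram D) (hcross : NonCrossing D) : ∃ a b : ℕ, ∃ e : a + 1 + b = n,
      ∃ (D₁ : SimpleGraph (Fin (a + 1))) (D₂ : SimpleGraph (Fin (b + 1))),
        e ▸ glueDiagram D₁ D₂ = D := by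
  rw [isArcDiagram_iff] at harc
  have hex : ∃ x, D.Adj x (Fin.last n) := by
    obtain ⟨m, rfl⟩ := Nat.exists_eq_succ_of_ne_zero hn
    obtain ⟨y, ⟨hy1, hy2⟩, -⟩ := harc (Fin.last m).castSucc (Fin.castSucc_lt_last _).ne
    refine ⟨(Fin.last m).castSucc, ?_⟩
    rwa [show y = Fin.last (m + 1) by
      refine le_antisymm (Fin.le_last y) ?_
      rw [Fin.lt_def] at hy1
      rw [Fin.le_def]
      simpa using hy1] at hy2
  obtain ⟨x, hx, hmin⟩ :=
    WellFounded.has_min (wellFounded_lt (α := Fin (n + 1))) {x | D.Adj x (Fin.last n)} hex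
  have hxn : (x : ℕ) < n := Fin.lt_def.mp (lt_of_le_of_ne (Fin.le_last x) hx.ne)
  obtain ⟨a, ha⟩ : ∃ a : ℕ, a = x := ⟨_, rfl⟩
  obtain ⟨b, rfl⟩ : ∃ b, n = a + 1 + b := ⟨n - (a + 1), by omega⟩
  obtain rfl : x = leftNode b (Fin.last a) := Fin.ext ha.symm
  refine ⟨a, b, rfl, D.comap (leftNode b), D.comap (rightNode a), ?_⟩
  have key : ∀ i k, D.Adj (leftNode b i) (rightNode a k) ↔ i = Fin.last a ∧ k = Fin.last b := by
    intro i k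
    constructor
    · intro h
      have hi : i = Fin.last a := by
        by_contra hi
        have hlt : leftNode b i < leftNode b (Fin.last a) :=
          lt_of_le_of_ne (Fin.le_last i) fun h => hi (leftNode_inj.mp h)
        by_cases hk : k = Fin.last b
        · rw [hk] at h
          exact hmin _ h hlt
        · exact hcross ⟨_, _, _, _, h, hx, hlt, leftNode_lt_rightNode _ _,
            rightNode_lt.mpr (lt_of_le_of_ne (Fin.le_last k) hk)⟩
      refine ⟨hi, ?_⟩
      rw [hi] at h
      have := (harc _ (leftNode_ne_rightNode (Fin.last a) (Fin.last b))).unique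
        ⟨leftNode_lt_rightNode _ _, h⟩ ⟨leftNode_lt_rightNode _ (Fin.last b), hx⟩
      exact rightNode_inj.mp this
    · rintro ⟨rfl, rfl⟩
      exact hx
  ext x y
  rcases eq_leftNode_or_rightNode x with ⟨i, rfl⟩ | ⟨k, rfl⟩ <;>
    rcases eq_leftNode_or_rightNode y with ⟨j, rfl⟩ | ⟨l, rfl⟩
  · rw [glueDiagram_adj_left, SimpleGraph.comap_adj]
  · rw [glueDiagram_adj_left_right, key]
  · rw [glueDiagram_adj_right_left, D.adj_comm, key]
  · rw [glueDiagram_adj_right, SimpleGraph.comap_adj]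

theorem IsBasicDiagram.isArcDiagram_and_nonCrossing {n : ℕ} {D : SimpleGraph (Fin (n + 1))}
    (h : IsBasicDiagram D) : IsArcDiagram D ∧ NonCrossing D := by
  induction h with
  | single D =>
    refine ⟨fun j => j.elim0, ?_⟩
    rintro ⟨j₁, j₂, k₁, k₂, -, -, h, -⟩
    exact h.ne (Subsingleton.elim (α := Fin 1) _ _)
  | glue D₁ D₂ _ _ ih₁ ih₂ =>
    rw [isArcDiagram_glueDiagram, nonCrossing_glueDiagram]
    exact ⟨⟨ih₁.1, ih₂.1⟩, ih₁.2, ih₂.2⟩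

theorem isBasicDiagram_iff {n : ℕ} {D : SimpleGraph (Fin (n + 1))} :
    IsBasicDiagram D ↔ IsArcDiagram D ∧ NonCrossing D := by
  refine ⟨fun h => h.isArcDiagram_and_nonCrossing, ?_⟩
  induction n using Nat.strong_induction_on with
  | _ n ih =>
    rintro ⟨harc, hcross⟩
    by_cases hn : n = 0
    · subst hn
      exact .single D
    · obtain ⟨a, b, rfl, D₁, D₂, rfl⟩ := exists_eq_glueDiagram hn harc hcross
      rw [isArcDiagram_glueDiagram] at harc
      rw [nonCrossing_glueDiagram] at hcross
      exact .glue D₁ D₂ (ih a (by omega) ⟨harc.1, hcross.1⟩) (ih b (by omega) ⟨harc.2, hcross.2⟩)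

/-! ### Counting basic diagrams -/

/-- The diagram of a binary tree: a node of the tree is the gluing of the diagrams of its two
subtrees. -/
def treeDiagram : BinaryTree Unit → Σ n : ℕ, SimpleGraph (Fin (n + 1))
  | .nil => ⟨0, ⊥⟩
  | .node _ l r => ⟨(treeDiagram l).1 + 1 + (treeDiagram r).1,
      glueDiagram (treeDiagram l).2 (treeDiagram r).2⟩

theorem treeDiagram_fst (t : BinaryTree Unit) : (treeDiagram t).1 = t.numNodes := by
  induction t with
  | nil => rfl
  | node _ l r ihl ihr =>
    change (treeDiagram l).1 + 1 + (treeDiagram r).1 = l.numNodes + r.numNodes + 1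
    omega

theorem isBasicDiagram_treeDiagram (t : BinaryTree Unit) : IsBasicDiagram (treeDiagram t).2 := by
  induction t with
  | nil => exact .single _
  | node _ l r ihl ihr => exact .glue _ _ ihl ihr

theorem IsBasicDiagram.exists_treeDiagram_eq {n : ℕ} {D : SimpleGraph (Fin (n + 1))}
    (h : IsBasicDiagram D) : ∃ t, treeDiagram t = ⟨n, D⟩ := by
  induction h with
  | single D =>
    refine ⟨.nil, ?_⟩
    rw [treeDiagram]
    congr 1
    ext x y
    have hxy : x = y := Subsingleton.elim (α := Fin 1) x y
    subst hxy
    simp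
  | glue D₁ D₂ _ _ ih₁ ih₂ =>
    obtain ⟨t₁, h₁⟩ := ih₁
    obtain ⟨t₂, h₂⟩ := ih₂
    refine ⟨.node () t₁ t₂, ?_⟩
    rw [treeDiagram, h₁, h₂]

/-- The positions of the neighbours of the last node. -/
def lastNeighbors (s : Σ n : ℕ, SimpleGraph (Fin (n + 1))) : Set ℕ :=
  {k | ∃ x : Fin (s.1 + 1), (x : ℕ) = k ∧ s.2.Adj x (Fin.last s.1)}

theorem isLeast_lastNeighbors_glueDiagram {a b : ℕ} (D₁ : SimpleGraph (Fin (a + 1)))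
    (D₂ : SimpleGraph (Fin (b + 1))) :
    IsLeast (lastNeighbors ⟨a + 1 + b, glueDiagram D₁ D₂⟩) a := by
  refine ⟨⟨leftNode b (Fin.last a), by simp, ?_⟩, ?_⟩
  · exact (glueDiagram_adj_left_right D₁ D₂ _ (Fin.last b)).mpr ⟨rfl, rfl⟩
  · rintro _ ⟨x, rfl, hx⟩
    rcases eq_leftNode_or_rightNode x with ⟨i, rfl⟩ | ⟨k, rfl⟩
    · have := (glueDiagram_adj_left_right D₁ D₂ i (Fin.last b)).mp hx
      rw [this.1]
      simp
    · rw [val_rightNode]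
      omega

/-- The smallest neighbour of the last node shows where the left part of a gluing ends. -/
theorem glueDiagram_injective {p q p' q' : Σ n : ℕ, SimpleGraph (Fin (n + 1))}
    (h : (⟨p.1 + 1 + q.1, glueDiagram p.2 q.2⟩ : Σ n : ℕ, SimpleGraph (Fin (n + 1))) =
      ⟨p'.1 + 1 + q'.1, glueDiagram p'.2 q'.2⟩) : p = p' ∧ q = q' := by
  obtain ⟨a, D₁⟩ := p
  obtain ⟨b, D₂⟩ := q
  obtain ⟨a', D₁'⟩ := p'
  obtain ⟨b', D₂'⟩ := q'
  have ha : a = a' := (isLeast_lastNeighbors_glueDiagram D₁ D₂).unique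
    (h ▸ isLeast_lastNeighbors_glueDiagram D₁' D₂')
  subst ha
  have hb : b = b' := by
    have := congrArg Sigma.fst h
    simpa using this
  subst hb
  have hD : glueDiagram D₁ D₂ = glueDiagram D₁' D₂' := eq_of_heq (Sigma.mk.inj h).2
  constructor
  · congr 1
    ext i j
    rw [← glueDiagram_adj_left D₁ D₂, hD, glueDiagram_adj_left]
  · congr 1
    ext k l
    rw [← glueDiagram_adj_right D₁ D₂, hD, glueDiagram_adj_right]

theorem treeDiagram_injective : Function.Injective treeDiagram := by
  intro t
  induction t with
  | nil =>
    intro t' h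
    cases t' with
    | nil => rfl
    | node _ l r =>
      have := congrArg Sigma.fst h
      rw [treeDiagram_fst, treeDiagram_fst, BinaryTree.numNodes, BinaryTree.numNodes] at this
      omega
  | node _ l r ihl ihr =>
    intro t' h
    cases t' with
    | nil =>
      have := congrArg Sigma.fst h
      rw [treeDiagram_fst, treeDiagram_fst, BinaryTree.numNodes, BinaryTree.numNodes] at this
      omega
    | node _ l' r' =>
      obtain ⟨h1, h2⟩ := glueDiagram_injective h
      rw [ihl h1, ihr h2]

theorem ncard_isBasicDiagram (n : ℕ) :
    {D : SimpleGraph (Fin (n + 1)) | IsBasicDiagram D}.ncard = catalan n := by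
  have hinj : Function.Injective (fun D : SimpleGraph (Fin (n + 1)) =>
      (⟨n, D⟩ : Σ n : ℕ, SimpleGraph (Fin (n + 1)))) := fun _ _ h => eq_of_heq (Sigma.mk.inj h).2
  rw [← BinaryTree.treesOfNumNodesEq_card_eq_catalan, ← Set.ncard_coe_finset,
    ← Set.ncard_image_of_injective _ treeDiagram_injective,
    ← Set.ncard_image_of_injective {D : SimpleGraph (Fin (n + 1)) | IsBasicDiagram D} hinj]
  congr 1
  ext s
  constructor
  · rintro ⟨D, hD, rfl⟩
    obtain ⟨t, ht⟩ := IsBasicDiagram.exists_treeDiagram_eq hD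
    refine ⟨t, ?_, ht⟩
    rw [Finset.mem_coe, BinaryTree.mem_treesOfNumNodesEq, ← treeDiagram_fst, ht]
  · rintro ⟨t, ht, rfl⟩
    rw [Finset.mem_coe, BinaryTree.mem_treesOfNumNodesEq, ← treeDiagram_fst] at ht
    subst ht
    exact ⟨_, isBasicDiagram_treeDiagram t, rfl⟩

/-! ### Vertices -/

/-- Any sequence of gluings gives a basic matrix; here single nodes are added on the right. -/
theorem exists_isBasicMatrix (n : ℕ) : ∃ H : Matrix (Fin n) (Fin n) ℝ, IsBasicMatrix H := by
  induction n with
  | zero => exact ⟨0, .empty 0⟩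
  | succ n ih =>
    obtain ⟨H, hH⟩ := ih
    exact ⟨_, hH.glueMatrix (.empty 0)⟩

theorem isVertexAlg_iff_isArcDiagram {n : ℕ} (H : Matrix (Fin n) (Fin n) ℝ) :
    IsVertexAlg H ↔ H ∈ optimalH n ∧ IsArcDiagram (algDiagram H) := by
  obtain ⟨H₀, h₀⟩ := exists_isBasicMatrix n
  exact isVertexAlg_iff h₀.mem_optimalH h₀.isBasicDiagram.isArcDiagram_and_nonCrossing.1 H

theorem isBasicMatrix_iff_isVertexAlg {n : ℕ} (H : Matrix (Fin n) (Fin n) ℝ) :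
    IsBasicMatrix H ↔ IsVertexAlg H ∧ IsArcDiagram (algDiagram H) ∧ NonCrossing (algDiagram H) := by
  rw [isBasicMatrix_iff, isBasicDiagram_iff, isVertexAlg_iff_isArcDiagram]
  tauto

theorem ncard_isBasicMatrix (n : ℕ) :
    {H : Matrix (Fin n) (Fin n) ℝ | IsBasicMatrix H}.ncard = catalan n := by
  have hinj : Set.InjOn algDiagram {H : Matrix (Fin n) (Fin n) ℝ | IsBasicMatrix H} :=
    fun H hH H' hH' h => eq_of_algDiagram_eq (IsBasicMatrix.mem_optimalH hH)
      (IsBasicMatrix.mem_optimalH hH') (IsBasicMatrix.isBasicDiagram hH) h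
  rw [← ncard_isBasicDiagram, ← hinj.ncard_image]
  congr 1
  ext D
  constructor
  · rintro ⟨H, hH, rfl⟩
    exact IsBasicMatrix.isBasicDiagram hH
  · exact fun hD => IsBasicDiagram.exists_isBasicMatrix hD

theorem isBasicMatrix_iff_hDual_mem {n : ℕ} (H : Matrix (Fin n) (Fin n) ℝ) :
    IsBasicMatrix H ↔ IsVertexAlg H ∧ hDual H ∈ optimalH n := by
  constructor
  · exact fun h => ⟨((isBasicMatrix_iff_isVertexAlg H).mp h).1, h.hDual.mem_optimalH⟩
  · rintro ⟨h1, h2⟩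
    obtain ⟨h3, h4⟩ := (isVertexAlg_iff_isArcDiagram H).mp h1
    exact (isBasicMatrix_iff_isVertexAlg H).mpr ⟨h1, h4, nonCrossing_of_hDual_mem h3 h4 h2⟩

/-- Here `N = n + 1`. -/
theorem mainTheorem7 (n : ℕ) :
    (∀ G : SimpleGraph (Fin (n + 1)), IsBasicDiagram G ↔ IsArcDiagram G ∧ NonCrossing G) ∧
    {G : SimpleGraph (Fin (n + 1)) | IsArcDiagram G ∧ NonCrossing G}.ncard = catalan n ∧
    (∀ H : Matrix (Fin n) (Fin n) ℝ, IsBasicMatrix H ↔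
      IsVertexAlg H ∧ IsArcDiagram (algDiagram H) ∧ NonCrossing (algDiagram H)) ∧
    {H : Matrix (Fin n) (Fin n) ℝ | IsVertexAlg H ∧
      IsArcDiagram (algDiagram H) ∧ NonCrossing (algDiagram H)}.ncard = catalan n ∧
    {H : Matrix (Fin n) (Fin n) ℝ | IsVertexAlg H ∧ hDual H ∈ optimalH n}.ncard = catalan n ∧
    (catalan n : ℚ) = 1 / ((n : ℚ) + 1) * ((2 * n).choose n : ℚ) := by
  refine ⟨fun G => isBasicDiagram_iff, ?_, isBasicMatrix_iff_isVertexAlg, ?_, ?_, ?_⟩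
  · simp only [← isBasicDiagram_iff]
    exact ncard_isBasicDiagram n
  · simp only [← isBasicMatrix_iff_isVertexAlg]
    exact ncard_isBasicMatrix n
  · simp only [← isBasicMatrix_iff_hDual_mem]
    exact ncard_isBasicMatrix n
  · have h := congrArg (Nat.cast (R := ℚ)) (succ_mul_catalan_eq_centralBinom n)
    rw [Nat.centralBinom_eq_two_mul_choose] at h
    push_cast at h
    rw [← h]
    field_simp
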